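/- Let $\mathbb V$ be the complex vector space with basis $\{u_i\}_{i\in\mathbb Z}$, and let $\mathfrak{sl}(\infty)$ be the Lie algebra of all traceless linear operators on $\mathbb V$ annihilating almost all $u_i$, with matrix units $E_{ij}u_k=\delta_{jk}u_i$ and Chevalley generators $e_a=E_{a,a+1}$, $f_a=E_{a+1,a}$. Let $\mathbb V^\vee$ be the $\mathfrak{sl}(\infty)$-module with basis $\{w_i\}_{i\in\mathbb Z}$ on which $E_{ij}w_k=-(-1)^{i+j}\delta_{ik}w_j$, so that $e_aw_b=\delta_{a,b}w_{b+1}$ and $f_aw_b=\delta_{a+1,b}w_{b-1}$. Let $\mathfrak F$ be the Fock space, spanned by the semi-infinite wedges $u_{i_1}\wedge u_{i_2}\wedge\cdots$ with $i_1>i_2>\cdots$ and $i_k=-k$ for all sufficiently large $k$. For $t\in\mathbb Z$ let $\mathfrak F^\vee_t$ be spanned by the semi-infinite wedges $w_{i_1}\wedge w_{i_2}\wedge\cdots$ with $i_1>i_2>\cdots$ and $i_k=t-k$ for all sufficiently large $k$. On wedges and on tensor products $\mathfrak{sl}(\infty)$ acts by the Leibniz rule. For $m,n\ge 0$ let $S_{m,n}$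 be the socle (the sum of all simple submodules) of $\Lambda^m\mathbb V^\vee\otimes\Lambda^n\mathbb V$. Let $t\in\mathbb Z$. For all $m,n\ge0$ with $m-n=t$ the module $S_{m,n}$ is simple, and it is the kernel of the contraction $\Lambda^m\mathbb V^\vee\otimes\Lambda^n\mathbb V\to\Lambda^{m-1}\mathbb V^\vee\otimes\Lambda^{n-1}\mathbb V$ induced by the pairing $w_i\otimes u_j\mapsto(-1)^j\delta_{ij}$ (where $\Lambda^{-1}=0$). Moreover: 1. The $\mathfrak{sl}(\infty)$-module $\mathfrak R:=\mathfrak F^\vee_t\otimes\mathfrak F$ has an infinite strictly decreasing filtration by submodules $$\mathfrak R=\mathfrak R^0\supset\mathfrak R^1\supset\cdots\supset\mathfrak R^k\supset\cdots,\qquad \bigcap_k\mathfrak R^k=0,$$ such that for all $k\ge 0$ $$\mathfrak R^k/\mathfrak R^{k+1}\simeq\begin{cases}S_{k+t,k}&\text{if }t\ge0,\\ S_{k,k-t}&\text{if }t<0.\end{cases}$$ 2. Every non-zero submodule of $\mathfrak R$ coincides with $\mathfrak R^r$ for some $r\ge0$ (so the submodules of $\mathfrak R$ form a chain). -/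

import Mathlib

open scoped TensorProduct

noncomputable section

namespace ExteriorLie

/-! ### The action of a Lie algebra on exterior powers, and contractions -/

variable {R : Type*} [CommRing R] {M N : Type*} [AddCommGroup M] [Module R M]
  [AddCommGroup N] [Module R N]

/-- The alternating map `v ↦ ∑ i, v₁ ∧ ⋯ ∧ φ vᵢ ∧ ⋯ ∧ vₙ`. -/
def derAlt (n : ℕ) (φ : Module.End R M) : M [⋀^Fin n]→ₗ[R] (⋀[R]^n M) where
  toMultilinearMap := ∑ i : Fin n, (exteriorPower.ιMulti R n).toMultilinearMap.compLinearMap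
    (Function.update (fun _ => LinearMap.id) i φ)
  map_eq_zero_of_eq' := by
    intro v i j hv hij
    have key : ∀ k : Fin n, (fun l => (Function.update (fun _ : Fin n => (LinearMap.id : M →ₗ[R] M))
        k φ l) (v l)) = Function.update v k (φ (v k)) := by
      intro k; ext l
      by_cases h : l = k
      · subst h; simp
      · simp [h]
    simp only [MultilinearMap.toFun_eq_coe, sum_apply,
      MultilinearMap.compLinearMap_apply, AlternatingMap.coe_multilinearMap, key]
    rw [Fintype.sum_eq_add i j hij]
    · have h1 : Function.update v j (φ (v j))
          = Function.update v i (φ (v i)) ∘ Equiv.swap i j := by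
        ext l
        by_cases hl : l = j
        · subst hl; simp [hv]
        · by_cases hl' : l = i
          · subst hl'; simp [hij, Ne.symm hij, hv]
          · simp [hl, hl', Equiv.swap_apply_of_ne_of_ne]
      rw [h1, AlternatingMap.map_swap _ _ hij, add_neg_cancel]
    · rintro k ⟨hki, hkj⟩
      exact AlternatingMap.map_eq_zero_of_eq _ _
        (by simp [Ne.symm hki, Ne.symm hkj, hv]) hij

/-- The endomorphism of `⋀ⁿ M` acting by `φ` as a derivation. -/
def der (n : ℕ) (φ : Module.End R M) : Module.End R (⋀[R]^n M) :=
  exteriorPower.alternatingMapLinearEquiv (derAlt n φ)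

theorem der_ιMulti (n : ℕ) (φ : Module.End R M) (v : Fin n → M) :
    der n φ (exteriorPower.ιMulti R n v)
      = ∑ i, exteriorPower.ιMulti R n (Function.update v i (φ (v i))) := by
  have key : ∀ k : Fin n, (fun l => (Function.update (fun _ : Fin n => (LinearMap.id : M →ₗ[R] M))
      k φ l) (v l)) = Function.update v k (φ (v k)) := by
    intro k; ext l
    by_cases h : l = k
    · subst h; simp
    · simp [h]
  rw [der, exteriorPower.alternatingMapLinearEquiv_apply_ιMulti]
  change (∑ i : Fin n, (exteriorPower.ιMulti R n).toMultilinearMap.compLinearMap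
    (Function.update (fun _ => LinearMap.id) i φ)) v = _
  simp [MultilinearMap.compLinearMap_apply, key]

theorem der_add (n : ℕ) (φ ψ : Module.End R M) : der n (φ + ψ) = der n φ + der n ψ := by
  apply exteriorPower.linearMap_ext
  ext1 v
  simp [der_ιMulti, Finset.sum_add_distrib, AlternatingMap.map_update_add]

theorem der_smul (n : ℕ) (c : R) (φ : Module.End R M) : der n (c • φ) = c • der n φ := by
  apply exteriorPower.linearMap_ext
  ext1 v
  simp [der_ιMulti, Finset.smul_sum, AlternatingMap.map_update_smul]

theorem der_lie (n : ℕ) (φ ψ : Module.End R M) : 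
    der n (φ * ψ - ψ * φ) = der n φ * der n ψ - der n ψ * der n φ := by
  have key : ∀ (φ ψ : Module.End R M) (v : Fin n → M),
      der n φ (der n ψ (exteriorPower.ιMulti R n v))
        = ∑ i, exteriorPower.ιMulti R n (Function.update v i (φ (ψ (v i))))
          + ∑ i, ∑ j, if i = j then 0 else exteriorPower.ιMulti R n
              (Function.update (Function.update v i (ψ (v i))) j (φ (v j))) := by
    intro φ ψ v
    simp only [der_ιMulti, map_sum]
    rw [← Finset.sum_add_distrib]
    refine Finset.sum_congr rfl fun i _ => ?_
    rw [← Finset.add_sum_erase _ _ (Finset.mem_univ i)]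
    congr 1
    · simp
    · rw [← Finset.add_sum_erase Finset.univ
        (fun j => if i = j then 0 else exteriorPower.ιMulti R n
              (Function.update (Function.update v i (ψ (v i))) j (φ (v j)))) (Finset.mem_univ i)]
      simp only [if_true, zero_add]
      refine Finset.sum_congr rfl fun j hj => ?_
      have hj' : j ≠ i := Finset.ne_of_mem_erase hj
      simp [hj', hj'.symm]
  apply exteriorPower.linearMap_ext
  ext1 v
  simp only [LinearMap.compAlternatingMap_apply, LinearMap.sub_apply,
    Module.End.mul_apply, key]
  rw [Finset.sum_comm (f := fun i j => if i = j then 0 else exteriorPower.ιMulti R n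
              (Function.update (Function.update v i (φ (v i))) j (ψ (v j))))]
  have : ∀ i j : Fin n, (if i = j then (0 : ⋀[R]^n M) else exteriorPower.ιMulti R n
              (Function.update (Function.update v i (ψ (v i))) j (φ (v j))))
      = if j = i then 0 else exteriorPower.ιMulti R n
              (Function.update (Function.update v j (φ (v j))) i (ψ (v i))) := by
    intro i j
    by_cases h : i = j
    · simp [h]
    · rw [if_neg h, if_neg (Ne.symm h), Function.update_comm h]
  simp only [this, der_ιMulti, add_sub_add_right_eq_sub]
  rw [← Finset.sum_sub_distrib]
  refine Finset.sum_congr rfl fun i _ => ?_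
  simp [AlternatingMap.map_update_sub]

variable {L : Type*} [LieRing L] [LieAlgebra R L] [LieRingModule L M] [LieModule R L M]

/-- A Lie algebra acts on `⋀ⁿ M` by
`x (v₁ ∧ ⋯ ∧ vₙ) = ∑ i, v₁ ∧ ⋯ ∧ x vᵢ ∧ ⋯ ∧ vₙ`. -/
instance instLieRingModule (n : ℕ) : LieRingModule L (⋀[R]^n M) where
  bracket x m := der n (LieModule.toEnd R L M x) m
  add_lie x y m := by simp [der_add]
  lie_add x m m' := by simp
  leibniz_lie x y m := by
    have h : LieModule.toEnd R L M ⁅x, y⁆ = LieModule.toEnd R L M x * LieModule.toEnd R L M y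
        - LieModule.toEnd R L M y * LieModule.toEnd R L M x := by
      ext v; simp
    rw [h, der_lie]
    simp

instance instLieModule (n : ℕ) : LieModule R L (⋀[R]^n M) where
  smul_lie c x m := by
    change der n (LieModule.toEnd R L M (c • x)) m = c • der n (LieModule.toEnd R L M x) m
    simp [der_smul]
  lie_smul c x m := by
    change der n (LieModule.toEnd R L M x) (c • m) = c • der n (LieModule.toEnd R L M x) m
    simp

theorem lie_ιMulti (n : ℕ) (x : L) (v : Fin n → M) :
    ⁅x, exteriorPower.ιMulti R n v⁆
      = ∑ i, exteriorPower.ιMulti R n (Function.update v i ⁅x, v i⁆) :=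
  der_ιMulti n (LieModule.toEnd R L M x) v

/-- The comultiplication component `⋀ⁿ⁺¹ M → M ⊗ ⋀ⁿ M`,
`v₀ ∧ ⋯ ∧ vₙ ↦ ∑ i, (-1)ⁱ vᵢ ⊗ (v₀ ∧ ⋯ v̂ᵢ ⋯ ∧ vₙ)`. -/
def split (n : ℕ) : ⋀[R]^(n + 1) M →ₗ[R] M ⊗[R] (⋀[R]^n M) :=
  exteriorPower.alternatingMapLinearEquiv (AlternatingMap.alternatizeUncurryFin
    { toFun := fun x => (TensorProduct.mk R M (⋀[R]^n M) x).compAlternatingMap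
        (exteriorPower.ιMulti R n)
      map_add' := fun x y => AlternatingMap.ext fun v => by simp
      map_smul' := fun c x => AlternatingMap.ext fun v => by simp [TensorProduct.smul_tmul'] })

theorem split_ιMulti (n : ℕ) (v : Fin (n + 1) → M) :
    split n (exteriorPower.ιMulti R (n + 1) v)
      = ∑ j : Fin (n + 1), ((-1 : R) ^ (j : ℕ)) •
          (v j ⊗ₜ[R] exteriorPower.ιMulti R n (j.removeNth v)) := by
  refine (exteriorPower.alternatingMapLinearEquiv_apply_ιMulti _ v).trans ?_
  rw [AlternatingMap.alternatizeUncurryFin_apply]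
  refine Finset.sum_congr rfl fun j _ => ?_
  rcases Nat.even_or_odd (j : ℕ) with hj | hj <;> simp [hj.neg_one_pow]

/-- The contraction `⋀ᵐ⁺¹ N ⊗ ⋀ⁿ⁺¹ M → ⋀ᵐ N ⊗ ⋀ⁿ M` induced by a pairing of `N` and `M`
(see `contraction_ιMulti_tmul` for its values on decomposable tensors). -/
def contraction (B : N ⊗[R] M →ₗ[R] R) (m n : ℕ) :
    (⋀[R]^(m + 1) N) ⊗[R] (⋀[R]^(n + 1) M) →ₗ[R] (⋀[R]^m N) ⊗[R] (⋀[R]^n M) :=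
  (TensorProduct.lid R ((⋀[R]^m N) ⊗[R] (⋀[R]^n M))).toLinearMap ∘ₗ
    TensorProduct.map B LinearMap.id ∘ₗ
      (TensorProduct.tensorTensorTensorComm R N (⋀[R]^m N) M (⋀[R]^n M)).toLinearMap ∘ₗ
        TensorProduct.map (split m) (split n)

theorem contraction_ιMulti_tmul (B : N ⊗[R] M →ₗ[R] R) (m n : ℕ)
    (w : Fin (m + 1) → N) (v : Fin (n + 1) → M) :
    contraction B m n (exteriorPower.ιMulti R (m + 1) w ⊗ₜ exteriorPower.ιMulti R (n + 1) v)
      = ∑ i : Fin (m + 1), ∑ j : Fin (n + 1), ((-1) ^ ((i : ℕ) + (j : ℕ)) * B (w i ⊗ₜ v j)) •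
          (exteriorPower.ιMulti R m (i.removeNth w) ⊗ₜ[R]
            exteriorPower.ιMulti R n (j.removeNth v)) := by
  simp only [contraction, LinearMap.comp_apply, TensorProduct.map_tmul, split_ιMulti,
    TensorProduct.sum_tmul, TensorProduct.tmul_sum, map_sum]
  rw [Finset.sum_comm]
  refine Finset.sum_congr rfl fun i _ => Finset.sum_congr rfl fun j _ => ?_
  simp only [← TensorProduct.smul_tmul', TensorProduct.tmul_smul, map_smul, LinearEquiv.coe_coe,
    TensorProduct.tensorTensorTensorComm_tmul, TensorProduct.map_tmul, TensorProduct.lid_tmul,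
    LinearMap.id_apply, smul_smul, pow_add]
  rw [mul_comm ((-1 : R) ^ (j : ℕ))]

/-- The kernel of the contraction `⋀ᵐ N ⊗ ⋀ⁿ M → ⋀ᵐ⁻¹ N ⊗ ⋀ⁿ⁻¹ M`, where `⋀⁻¹ = 0`. -/
def contractionKer (B : N ⊗[R] M →ₗ[R] R) :
    (m n : ℕ) → Submodule R ((⋀[R]^m N) ⊗[R] (⋀[R]^n M))
  | 0, _ => ⊤
  | _ + 1, 0 => ⊤
  | m + 1, n + 1 => LinearMap.ker (contraction B m n)

end ExteriorLie

end

noncomputable section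

namespace FockTensor

/-! ### The Lie algebra `sl(∞)`, its natural module `V` and the module `V^∨` -/

section SlInf

attribute [local instance] LieRing.ofAssociativeRing

/-- The space `ℂ^ℤ` of countable dimension. -/
def V : Type := ℤ →₀ ℂ

instance : AddCommGroup V := inferInstanceAs (AddCommGroup (ℤ →₀ ℂ))

instance : Module ℂ V := inferInstanceAs (Module ℂ (ℤ →₀ ℂ))

/-- The basis `u i`, `i ∈ ℤ`, of `V`. -/
def u : Module.Basis ℤ ℂ V := Module.Basis.ofRepr (LinearEquiv.refl ℂ (ℤ →₀ ℂ))

/-- The matrix entries of an operator on `V`. -/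
def entry (x : Module.End ℂ V) (i j : ℤ) : ℂ := u.repr (x (u j)) i

theorem repr_apply_eq_finsum (x : Module.End ℂ V) (v : V) (i : ℤ) :
    u.repr (x v) i = ∑ᶠ k, u.repr v k * entry x i k := by
  rw [finsum_eq_sum_of_support_subset (s := (u.repr v).support)]
  · conv_lhs => rw [← u.linearCombination_repr v]
    rw [Finsupp.linearCombination_apply, Finsupp.sum, map_sum, map_sum, Finsupp.finsetSum_apply]
    refine Finset.sum_congr rfl fun k _ => ?_
    rw [map_smul, map_smul]
    rfl
  · intro k hk
    rw [Function.mem_support] at hk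
    exact Finsupp.mem_support_iff.2 (left_ne_zero_of_mul hk)

theorem entry_eq_zero {x : Module.End ℂ V} {j : ℤ} (h : x (u j) = 0) (i : ℤ) :
    entry x i j = 0 := by
  simp [entry, h]

theorem entry_add (x y : Module.End ℂ V) (i j : ℤ) :
    entry (x + y) i j = entry x i j + entry y i j := by
  simp [entry]

theorem entry_smul (c : ℂ) (x : Module.End ℂ V) (i j : ℤ) :
    entry (c • x) i j = c * entry x i j := by
  simp [entry]

theorem entry_sub (x y : Module.End ℂ V) (i j : ℤ) :
    entry (x - y) i j = entry x i j - entry y i j := by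
  simp [entry]

theorem entry_mul (x y : Module.End ℂ V) (i j : ℤ) :
    entry (x * y) i j = ∑ᶠ k, entry y k j * entry x i k :=
  repr_apply_eq_finsum x (y (u j)) i

theorem end_ext {x y : Module.End ℂ V} (h : ∀ i j, entry x i j = entry y i j) : x = y :=
  u.ext fun j => u.repr.injective (Finsupp.ext fun i => h i j)

theorem mul_finsum_eq (c : ℂ) (f : ℤ → ℂ) : c * ∑ᶠ i, f i = ∑ᶠ i, c * f i :=
  smul_finsum c f

/-- `x` annihilates almost all basis vectors. -/
def FiniteColumns (x : Module.End ℂ V) : Prop := {i : ℤ | x (u i) ≠ 0}.Finite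

/-- The trace `∑ i, x i i`, meaningful for `x` annihilating almost all basis vectors. -/
def trace (x : Module.End ℂ V) : ℂ := ∑ᶠ i, entry x i i

theorem FiniteColumns.add {x y : Module.End ℂ V} (hx : FiniteColumns x) (hy : FiniteColumns y) :
    FiniteColumns (x + y) := by
  refine (hx.union hy).subset fun i hi => ?_
  by_contra h
  simp only [Set.mem_union, Set.mem_ofPred_eq, not_or, not_not] at h
  exact hi (by simp [h.1, h.2])

theorem FiniteColumns.smul {x : Module.End ℂ V} (c : ℂ) (hx : FiniteColumns x) :
    FiniteColumns (c • x) :=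
  hx.subset fun i hi h => hi (by simp [h])

theorem FiniteColumns.mul {x y : Module.End ℂ V} (hy : FiniteColumns y) :
    FiniteColumns (x * y) :=
  hy.subset fun i hi h => hi (by simp [h])

theorem FiniteColumns.diag {x : Module.End ℂ V} (hx : FiniteColumns x) :
    (Function.support fun i => entry x i i).Finite :=
  hx.subset fun i hi h => hi (entry_eq_zero h i)

theorem trace_add {x y : Module.End ℂ V} (hx : FiniteColumns x) (hy : FiniteColumns y) :
    trace (x + y) = trace x + trace y := by
  rw [trace, trace, trace, ← finsum_add_distrib hx.diag hy.diag]
  simp only [entry_add]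

theorem trace_smul (c : ℂ) (x : Module.End ℂ V) : trace (c • x) = c * trace x := by
  rw [trace, trace, mul_finsum_eq]
  simp only [entry_smul]

theorem trace_mul_comm {x y : Module.End ℂ V} (hx : FiniteColumns x) (hy : FiniteColumns y) :
    trace (x * y) = trace (y * x) := by
  have key : ∀ {x y : Module.End ℂ V} (hx : FiniteColumns x) (hy : FiniteColumns y),
      trace (x * y) = ∑ i ∈ hy.toFinset, ∑ k ∈ hx.toFinset, entry y k i * entry x i k := by
    intro x y hx hy
    rw [trace, finsum_eq_sum_of_support_subset (s := hy.toFinset)]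
    · refine Finset.sum_congr rfl fun i _ => ?_
      rw [entry_mul, finsum_eq_sum_of_support_subset]
      intro k hk
      rw [Function.mem_support] at hk
      exact hx.mem_toFinset.2 fun h => hk (by rw [entry_eq_zero h, mul_zero])
    · intro i hi
      exact hy.mem_toFinset.2 fun h => hi (entry_eq_zero (by simp [h]) i)
  rw [key hx hy, key hy hx, Finset.sum_comm]
  simp only [mul_comm]

theorem commutator_eq (x y : Module.End ℂ V) : x * y - y * x = x * y + (-1 : ℂ) • (y * x) := by
  rw [neg_one_smul, sub_eq_add_neg]

theorem FiniteColumns.lie {x y : Module.End ℂ V} (hx : FiniteColumns x) (hy : FiniteColumns y) :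
    FiniteColumns (x * y - y * x) := by
  rw [commutator_eq]
  exact (FiniteColumns.mul (x := x) hy).add ((FiniteColumns.mul (x := y) hx).smul (-1))

theorem trace_lie {x y : Module.End ℂ V} (hx : FiniteColumns x) (hy : FiniteColumns y) :
    trace (x * y - y * x) = 0 := by
  rw [commutator_eq, trace_add (FiniteColumns.mul hy) ((FiniteColumns.mul hx).smul (-1)),
    trace_smul, trace_mul_comm hx hy]
  ring

/-- The Lie algebra `sl(∞)` of all traceless linear operators on `V` annihilating almost all
basis vectors, with the commutator as bracket. -/
def slInf : LieSubalgebra ℂ (Module.End ℂ V) where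
  carrier := {x | FiniteColumns x ∧ trace x = 0}
  add_mem' := fun hx hy => ⟨hx.1.add hy.1, by rw [trace_add hx.1 hy.1, hx.2, hy.2, add_zero]⟩
  zero_mem' := ⟨by simp [FiniteColumns], by simp [trace, entry]⟩
  smul_mem' := fun c x hx => ⟨hx.1.smul c, by rw [trace_smul, hx.2, mul_zero]⟩
  lie_mem' := fun hx hy => ⟨hx.1.lie hy.1, trace_lie hx.1 hy.1⟩

theorem slInf_lie_apply (x : slInf) (v : V) : ⁅x, v⁆ = x.1 v := rfl

/-- The operator whose matrix entry in position `(j, k)` is `-(-1)^(j + k) x k j`, where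
`x = (x i j)`. -/
def twistEnd (x : slInf) : Module.End ℂ V :=
  u.constr ℂ fun k => u.repr.symm (Finsupp.ofSupportFinite
    (fun j => -(-1 : ℂ) ^ (j + k) * entry x.1 k j)
    (x.2.1.subset fun j hj h => hj (by simp [entry, h])))

theorem entry_twistEnd (x : slInf) (j k : ℤ) :
    entry (twistEnd x) j k = -(-1 : ℂ) ^ (j + k) * entry x.1 k j := by
  rw [entry, twistEnd, Module.Basis.constr_basis, LinearEquiv.apply_symm_apply]
  rfl

theorem twistEnd_mem (x : slInf) : twistEnd x ∈ slInf := by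
  constructor
  · refine (x.2.1.biUnion fun j _ => (u.repr (x.1 (u j))).support.finite_toSet).subset
      fun k hk => ?_
    have h : u.repr (twistEnd x (u k)) ≠ 0 := fun h => hk (u.repr.map_eq_zero_iff.1 h)
    obtain ⟨j, hj⟩ := Finsupp.ne_iff.1 h
    change entry (twistEnd x) j k ≠ 0 at hj
    rw [entry_twistEnd] at hj
    have hj' : entry x.1 k j ≠ 0 := right_ne_zero_of_mul hj
    exact Set.mem_biUnion (x := j) (fun h => hj' (entry_eq_zero h k))
      (Finsupp.mem_support_iff.2 hj')
  · have h : ∀ i, entry (twistEnd x) i i = (-1) * entry x.1 i i := by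
      intro i
      rw [entry_twistEnd, Even.neg_one_zpow ⟨i, rfl⟩]
    have := x.2.2
    rw [trace] at this ⊢
    simp only [h]
    rw [← mul_finsum_eq, this, mul_zero]

/-- The automorphism of `sl(∞)` sending the matrix unit `E i j` to `-(-1)^(i + j) E j i`. It
interchanges the Chevalley generators `e a = E a (a + 1)` and `f a = E (a + 1) a`. -/
def twist : slInf →ₗ⁅ℂ⁆ slInf where
  toFun x := ⟨twistEnd x, twistEnd_mem x⟩
  map_add' x y := Subtype.ext <| end_ext fun j k => by
    change entry (twistEnd (x + y)) j k = entry (twistEnd x + twistEnd y) j k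
    rw [entry_add, entry_twistEnd, entry_twistEnd, entry_twistEnd]
    change _ * entry (x.1 + y.1) k j = _
    rw [entry_add]
    ring
  map_smul' c x := Subtype.ext <| end_ext fun j k => by
    change entry (twistEnd (c • x)) j k = entry (c • twistEnd x) j k
    rw [entry_smul, entry_twistEnd, entry_twistEnd]
    change _ * entry (c • x.1) k j = _
    rw [entry_smul]
    ring
  map_lie' := by
    intro x y
    refine Subtype.ext <| end_ext fun i k => ?_
    change entry (twistEnd ⁅x, y⁆) i k
      = entry (twistEnd x * twistEnd y - twistEnd y * twistEnd x) i k
    have key : ∀ x y : slInf, entry (twistEnd x * twistEnd y) i k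
        = (-1 : ℂ) ^ (i + k) * entry (y.1 * x.1) k i := by
      intro x y
      rw [entry_mul, entry_mul, mul_finsum_eq]
      refine finsum_congr fun j => ?_
      rw [entry_twistEnd, entry_twistEnd]
      have : (-1 : ℂ) ^ (j + k) * (-1) ^ (i + j) = (-1) ^ (i + k) := by
        rw [← zpow_add₀ (by norm_num), show j + k + (i + j) = i + k + (j + j) by ring,
          zpow_add₀ (by norm_num), Even.neg_one_zpow ⟨j, rfl⟩, mul_one]
      rw [← this]
      ring
    rw [entry_sub, key, key, entry_twistEnd]
    change -(-1 : ℂ) ^ (i + k) * entry (x.1 * y.1 - y.1 * x.1) k i = _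
    rw [entry_sub]
    ring

end SlInf

/-- The `sl(∞)`-module with the same underlying space as `M`, on which `x` acts as
`twist x` acts on `M`. -/
def Twist (M : Type*) : Type _ := M

section Twist

variable (M : Type*) [AddCommGroup M] [Module ℂ M] [LieRingModule slInf M] [LieModule ℂ slInf M]

instance : AddCommGroup (Twist M) := inferInstanceAs (AddCommGroup M)

instance : Module ℂ (Twist M) := inferInstanceAs (Module ℂ M)

instance : LieRingModule slInf (Twist M) := LieRingModule.compLieHom M twist

instance : LieModule ℂ slInf (Twist M) := LieModule.compLieHom M twist

end Twist

/-- The module `V^∨`: it has a basis `w i`, `i ∈ ℤ`, with `E i j (w i) = -(-1)^(i + j) w j`, so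
`e a (w a) = w (a + 1)` and `f a (w (a + 1)) = w a`. -/
abbrev VDual : Type := Twist V

/-- The basis `w i`, `i ∈ ℤ`, of `V^∨`. -/
def w : Module.Basis ℤ ℂ VDual := u

/-- The invariant pairing `V^∨ ⊗ V → ℂ`, `w i ⊗ u j ↦ (-1)^j δ i j`. -/
def pairing : VDual ⊗[ℂ] V →ₗ[ℂ] ℂ :=
  TensorProduct.lift (w.constr ℂ fun i => (-1 : ℂ) ^ i • u.coord i)

theorem pairing_w_tmul_u (i j : ℤ) :
    pairing (w i ⊗ₜ u j) = if i = j then (-1 : ℂ) ^ j else 0 := by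
  rw [pairing, TensorProduct.lift.tmul, Module.Basis.constr_basis]
  by_cases h : i = j
  · subst h; simp
  · simp [h]

/-! ### The Fock spaces -/

/-- A semi-infinite subset of `ℤ`: it contains only finitely many `i ≥ 0` and all but finitely
many `i < 0`. These are the sets of the form `{i₁ > i₂ > i₃ > ⋯}` for which there is `t` with
`i k = t - k` for all sufficiently large `k`. -/
@[ext]
structure SemiInfinite where
  /-- The underlying set. -/
  carrier : Set ℤ
  finite_nonneg : (carrier ∩ Set.Ici 0).Finite
  finite_compl : (Set.Iio 0 \ carrier).Finite

/-- The charge of `{i₁ > i₂ > i₃ > ⋯}`, that is, the integer `t` such that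
`i k = t - k` for all sufficiently large `k`. -/
def charge (S : SemiInfinite) : ℤ :=
  ((S.carrier ∩ Set.Ici 0).ncard : ℤ) - ((Set.Iio 0 \ S.carrier).ncard : ℤ)

/-- The space of semi-infinite wedges of all charges. -/
def FockAll : Type := SemiInfinite →₀ ℂ

instance : AddCommGroup FockAll := inferInstanceAs (AddCommGroup (SemiInfinite →₀ ℂ))

instance : Module ℂ FockAll := inferInstanceAs (Module ℂ (SemiInfinite →₀ ℂ))

/-- The basis vector `semiWedge S` is the formal expression `u i₁ ∧ u i₂ ∧ u i₃ ∧ ⋯`, where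
`S = {i₁ > i₂ > i₃ > ⋯}`. -/
def semiWedge : Module.Basis SemiInfinite ℂ FockAll :=
  Module.Basis.ofRepr (LinearEquiv.refl ℂ (SemiInfinite →₀ ℂ))

/-- The number of elements of `S` greater than `a`. -/
def countAbove (a : ℤ) (S : SemiInfinite) : ℕ := (S.carrier ∩ Set.Ioi a).ncard

theorem SemiInfinite.finite_above (S : SemiInfinite) (a : ℤ) :
    (S.carrier ∩ Set.Ioi a).Finite := by
  refine (S.finite_nonneg.union (Set.finite_Ioo a 0)).subset fun i hi => ?_
  rcases lt_or_ge i 0 with h | h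
  · exact Or.inr ⟨hi.2, h⟩
  · exact Or.inl ⟨hi.1, h⟩

/-- `S ∪ {a}`. -/
def SemiInfinite.insert (a : ℤ) (S : SemiInfinite) : SemiInfinite where
  carrier := Insert.insert a S.carrier
  finite_nonneg := (S.finite_nonneg.insert a).subset fun i hi => by
    rcases hi.1 with h | h
    · exact Or.inl h
    · exact Or.inr ⟨h, hi.2⟩
  finite_compl := S.finite_compl.subset fun i hi => ⟨hi.1, fun h => hi.2 (Or.inr h)⟩

/-- `S \ {a}`. -/
def SemiInfinite.erase (a : ℤ) (S : SemiInfinite) : SemiInfinite where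
  carrier := S.carrier \ {a}
  finite_nonneg := S.finite_nonneg.subset fun i hi => ⟨hi.1.1, hi.2⟩
  finite_compl := (S.finite_compl.insert a).subset fun i hi => by
    by_cases h : i = a
    · exact Or.inl h
    · exact Or.inr ⟨hi.1, fun h' => hi.2 ⟨h', h⟩⟩

open scoped Classical in
/-- Left exterior multiplication by `u a`:
`u i₁ ∧ u i₂ ∧ ⋯ ↦ u a ∧ u i₁ ∧ u i₂ ∧ ⋯ = (-1)^k u i₁ ∧ ⋯ ∧ u i_k ∧ u a ∧ u i_(k+1) ∧ ⋯` with
`i_k > a > i_(k+1)`, and zero if `a` is one of the indices. -/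
def create (a : ℤ) : Module.End ℂ FockAll :=
  semiWedge.constr ℂ fun S =>
    if a ∈ S.carrier then 0 else (-1 : ℂ) ^ countAbove a S • semiWedge (S.insert a)

open scoped Classical in
/-- Contraction with the dual basis vector of `u a`:
`u i₁ ∧ u i₂ ∧ ⋯ ↦ (-1)^k u i₁ ∧ ⋯ ∧ u i_k ∧ u i_(k+2) ∧ ⋯` if `a = i_(k+1)`, and zero if `a` is
none of the indices. -/
def annihilate (a : ℤ) : Module.End ℂ FockAll :=
  semiWedge.constr ℂ fun S =>
    if a ∈ S.carrier then (-1 : ℂ) ^ countAbove a S • semiWedge (S.erase a) else 0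

/-- Left exterior multiplication by an arbitrary vector. -/
def wedge : V →ₗ[ℂ] Module.End ℂ FockAll := u.constr ℂ create

/-- The action of `x` on semi-infinite wedges as a derivation,
`x (u i₁ ∧ u i₂ ∧ ⋯) = x (u i₁) ∧ u i₂ ∧ ⋯ + u i₁ ∧ x (u i₂) ∧ ⋯ + ⋯`: the contraction with the
dual of `u b` followed by the multiplication by `x (u b)` replaces a factor `u b` by `x (u b)`. -/
def fockEnd (x : slInf) : Module.End ℂ FockAll := ∑ᶠ b : ℤ, wedge (x.1 (u b)) * annihilate b

theorem neg_one_pow_countAbove_insert {a b : ℤ} {S : SemiInfinite} (hb : b ∉ S.carrier) :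
    (-1 : ℂ) ^ countAbove a (S.insert b)
      = (if a < b then -1 else 1) * (-1 : ℂ) ^ countAbove a S := by
  have h : (S.insert b).carrier = Insert.insert b S.carrier := rfl
  rw [countAbove, countAbove, h]
  split_ifs with hab
  · rw [Set.insert_inter_of_mem (by exact hab),
      Set.ncard_insert_of_notMem (fun h => hb h.1) (S.finite_above a), pow_succ]
    ring
  · rw [Set.insert_inter_of_notMem (by exact hab), one_mul]

theorem neg_one_pow_countAbove_erase {a b : ℤ} {S : SemiInfinite} (hb : b ∈ S.carrier) :
    (-1 : ℂ) ^ countAbove a (S.erase b)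
      = (if a < b then -1 else 1) * (-1 : ℂ) ^ countAbove a S := by
  have hb' : b ∉ (S.erase b).carrier := fun h => h.2 rfl
  have hS : (S.erase b).insert b = S := by
    refine SemiInfinite.ext ?_
    change Insert.insert b (S.carrier \ {b}) = S.carrier
    simp [hb]
  have h := neg_one_pow_countAbove_insert (a := a) hb'
  rw [hS] at h
  rw [h]
  split_ifs <;> ring

theorem create_of_mem {a : ℤ} {S : SemiInfinite} (ha : a ∈ S.carrier) :
    create a (semiWedge S) = 0 := by
  rw [create, Module.Basis.constr_basis, if_pos ha]

theorem create_of_notMem {a : ℤ} {S : SemiInfinite} (ha : a ∉ S.carrier) :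
    create a (semiWedge S) = (-1 : ℂ) ^ countAbove a S • semiWedge (S.insert a) := by
  rw [create, Module.Basis.constr_basis, if_neg ha]

theorem annihilate_of_mem {a : ℤ} {S : SemiInfinite} (ha : a ∈ S.carrier) :
    annihilate a (semiWedge S) = (-1 : ℂ) ^ countAbove a S • semiWedge (S.erase a) := by
  rw [annihilate, Module.Basis.constr_basis, if_pos ha]

theorem annihilate_of_notMem {a : ℤ} {S : SemiInfinite} (ha : a ∉ S.carrier) :
    annihilate a (semiWedge S) = 0 := by
  rw [annihilate, Module.Basis.constr_basis, if_neg ha]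

theorem SemiInfinite.mem_insert {a b : ℤ} {S : SemiInfinite} :
    a ∈ (S.insert b).carrier ↔ a = b ∨ a ∈ S.carrier := Iff.rfl

theorem SemiInfinite.mem_erase {a b : ℤ} {S : SemiInfinite} :
    a ∈ (S.erase b).carrier ↔ a ∈ S.carrier ∧ a ≠ b := Iff.rfl

theorem SemiInfinite.insert_erase {a : ℤ} {S : SemiInfinite} (ha : a ∈ S.carrier) :
    (S.erase a).insert a = S := by
  refine SemiInfinite.ext ?_
  change Insert.insert a (S.carrier \ {a}) = S.carrier
  simp [ha]

theorem SemiInfinite.erase_insert {a : ℤ} {S : SemiInfinite} (ha : a ∉ S.carrier) :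
    (S.insert a).erase a = S := by
  refine SemiInfinite.ext ?_
  change Insert.insert a S.carrier \ {a} = S.carrier
  simp [ha]

theorem sign_mul_sign {a b : ℤ} (hab : a ≠ b) (c d : ℂ) :
    d * ((if a < b then -1 else 1) * c) = -(c * ((if b < a then -1 else 1) * d)) := by
  rcases lt_or_gt_of_ne hab with h | h
  · rw [if_pos h, if_neg h.le.not_gt]; ring
  · rw [if_pos h, if_neg h.le.not_gt]; ring

theorem create_mul_create (a b : ℤ) : create a * create b = -(create b * create a) := by
  refine semiWedge.ext fun S => ?_
  rw [LinearMap.neg_apply, Module.End.mul_apply, Module.End.mul_apply]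
  by_cases ha : a ∈ S.carrier
  · rw [create_of_mem ha, map_zero, neg_zero]
    by_cases hb : b ∈ S.carrier
    · rw [create_of_mem hb, map_zero]
    · rw [create_of_notMem hb, map_smul,
        create_of_mem (SemiInfinite.mem_insert.2 (Or.inr ha)), smul_zero]
  by_cases hb : b ∈ S.carrier
  · rw [create_of_mem hb, map_zero, create_of_notMem ha, map_smul,
      create_of_mem (SemiInfinite.mem_insert.2 (Or.inr hb)), smul_zero, neg_zero]
  rw [create_of_notMem ha, create_of_notMem hb, map_smul, map_smul]
  rcases eq_or_ne a b with rfl | hab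
  · rw [create_of_mem (SemiInfinite.mem_insert.2 (Or.inl rfl)), smul_zero, neg_zero]
  · have h : (S.insert b).insert a = (S.insert a).insert b :=
      SemiInfinite.ext (Set.insert_comm a b S.carrier)
    rw [create_of_notMem (fun h => (SemiInfinite.mem_insert.1 h).elim hab ha),
      create_of_notMem (fun h => (SemiInfinite.mem_insert.1 h).elim hab.symm hb),
      neg_one_pow_countAbove_insert ha, neg_one_pow_countAbove_insert hb, h, smul_smul,
      smul_smul, ← neg_smul, sign_mul_sign hab]

theorem annihilate_mul_annihilate (a b : ℤ) :
    annihilate a * annihilate b = -(annihilate b * annihilate a) := by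
  refine semiWedge.ext fun S => ?_
  rw [LinearMap.neg_apply, Module.End.mul_apply, Module.End.mul_apply]
  by_cases ha : a ∈ S.carrier
  swap
  · rw [annihilate_of_notMem ha, map_zero, neg_zero]
    by_cases hb : b ∈ S.carrier
    · rw [annihilate_of_mem hb, map_smul,
        annihilate_of_notMem (fun h => ha (SemiInfinite.mem_erase.1 h).1), smul_zero]
    · rw [annihilate_of_notMem hb, map_zero]
  by_cases hb : b ∈ S.carrier
  swap
  · rw [annihilate_of_notMem hb, map_zero, annihilate_of_mem ha, map_smul,
      annihilate_of_notMem (fun h => hb (SemiInfinite.mem_erase.1 h).1), smul_zero, neg_zero]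
  rw [annihilate_of_mem ha, annihilate_of_mem hb, map_smul, map_smul]
  rcases eq_or_ne a b with rfl | hab
  · rw [annihilate_of_notMem (fun h => (SemiInfinite.mem_erase.1 h).2 rfl), smul_zero, neg_zero]
  · have h : (S.erase b).erase a = (S.erase a).erase b :=
      SemiInfinite.ext Set.sdiff_sdiff_comm
    rw [annihilate_of_mem (SemiInfinite.mem_erase.2 ⟨ha, hab⟩),
      annihilate_of_mem (SemiInfinite.mem_erase.2 ⟨hb, hab.symm⟩),
      neg_one_pow_countAbove_erase ha, neg_one_pow_countAbove_erase hb, h, smul_smul,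
      smul_smul, ← neg_smul, sign_mul_sign hab]

theorem annihilate_mul_create (a b : ℤ) :
    annihilate b * create a = (if a = b then 1 else 0) - create a * annihilate b := by
  have sq : ∀ n : ℕ, (-1 : ℂ) ^ n * (-1) ^ n = 1 := fun n => by rw [← mul_pow]; simp
  refine semiWedge.ext fun S => ?_
  rw [LinearMap.sub_apply, Module.End.mul_apply, Module.End.mul_apply]
  rcases eq_or_ne a b with rfl | hab
  · rw [if_pos rfl, Module.End.one_apply]
    by_cases ha : a ∈ S.carrier
    · have ha' : a ∉ (S.erase a).carrier := fun h => (SemiInfinite.mem_erase.1 h).2 rfl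
      rw [create_of_mem ha, annihilate_of_mem ha, map_zero, map_smul, create_of_notMem ha',
        neg_one_pow_countAbove_erase ha, SemiInfinite.insert_erase ha, smul_smul,
        if_neg (lt_irrefl a), one_mul, sq, one_smul, sub_self]
    · have ha' : a ∈ (S.insert a).carrier := SemiInfinite.mem_insert.2 (Or.inl rfl)
      rw [create_of_notMem ha, annihilate_of_notMem ha, map_zero, map_smul,
        annihilate_of_mem ha', neg_one_pow_countAbove_insert ha, SemiInfinite.erase_insert ha,
        smul_smul, if_neg (lt_irrefl a), one_mul, sq, one_smul, sub_zero]
  · rw [if_neg hab, LinearMap.zero_apply, zero_sub]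
    by_cases ha : a ∈ S.carrier
    · rw [create_of_mem ha, map_zero]
      by_cases hb : b ∈ S.carrier
      · rw [annihilate_of_mem hb, map_smul,
          create_of_mem (SemiInfinite.mem_erase.2 ⟨ha, hab⟩), smul_zero, neg_zero]
      · rw [annihilate_of_notMem hb, map_zero, neg_zero]
    · by_cases hb : b ∈ S.carrier
      · have h : (S.insert a).erase b = (S.erase b).insert a :=
          SemiInfinite.ext (Set.insert_sdiff_of_notMem S.carrier (by simpa using hab))
        rw [create_of_notMem ha, annihilate_of_mem hb, map_smul, map_smul,
          annihilate_of_mem (SemiInfinite.mem_insert.2 (Or.inr hb)),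
          create_of_notMem (fun h => ha (SemiInfinite.mem_erase.1 h).1),
          neg_one_pow_countAbove_erase hb, neg_one_pow_countAbove_insert ha, h,
          smul_smul, smul_smul, ← neg_smul, sign_mul_sign hab.symm]
      · rw [annihilate_of_notMem hb, map_zero, neg_zero, create_of_notMem ha, map_smul,
          annihilate_of_notMem (fun h => (SemiInfinite.mem_insert.1 h).elim hab.symm hb),
          smul_zero]

theorem wedge_mul_wedge (v v' : V) : wedge v * wedge v' = -(wedge v' * wedge v) := by
  have h : ∀ a, create a * wedge v' = -(wedge v' * create a) := by
    intro a
    have : (LinearMap.mulLeft ℂ (create a)) ∘ₗ wedge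
        = -((LinearMap.mulRight ℂ (create a)) ∘ₗ wedge) := by
      refine u.ext fun b => ?_
      simp [wedge, create_mul_create a b]
    simpa using LinearMap.congr_fun this v'
  have : (LinearMap.mulRight ℂ (wedge v')) ∘ₗ wedge
      = -((LinearMap.mulLeft ℂ (wedge v')) ∘ₗ wedge) := by
    refine u.ext fun b => ?_
    have := h b
    simpa [wedge] using this
  simpa using LinearMap.congr_fun this v

theorem annihilate_mul_wedge (b : ℤ) (v : V) :
    annihilate b * wedge v = u.repr v b • 1 - wedge v * annihilate b := by
  have : (LinearMap.mulLeft ℂ (annihilate b)) ∘ₗ wedge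
      = (u.coord b).smulRight 1 - (LinearMap.mulRight ℂ (annihilate b)) ∘ₗ wedge := by
    refine u.ext fun a => ?_
    rcases eq_or_ne a b with rfl | h
    · simp [wedge, annihilate_mul_create]
    · simp [wedge, annihilate_mul_create a b, h]
  simpa using LinearMap.congr_fun this v

/-- A finite set containing the indices of the basis vectors not annihilated by `x`. -/
def supp (x : slInf) : Finset ℤ := x.2.1.toFinset

theorem fockEnd_eq_sum (x : slInf) {A : Finset ℤ} (hA : supp x ⊆ A) :
    fockEnd x = ∑ b ∈ A, wedge (x.1 (u b)) * annihilate b := by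
  rw [fockEnd, finsum_eq_sum_of_support_subset]
  intro b hb
  refine hA (x.2.1.mem_toFinset.2 fun h => hb ?_)
  simp [h]

theorem apply_eq_sum (x : slInf) {A : Finset ℤ} (hA : supp x ⊆ A) (v : V) :
    x.1 v = ∑ b ∈ A, u.repr v b • x.1 (u b) := by
  refine u.repr.injective (Finsupp.ext fun i => ?_)
  rw [repr_apply_eq_finsum, finsum_eq_sum_of_support_subset (s := A)]
  · simp [Finsupp.finsetSum_apply, entry]
  · intro b hb
    refine hA (x.2.1.mem_toFinset.2 fun h => hb ?_)
    simp [entry_eq_zero h]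

theorem fockEnd_mul_wedge (x : slInf) (v : V) :
    fockEnd x * wedge v = wedge (x.1 v) + wedge v * fockEnd x := by
  rw [fockEnd_eq_sum x subset_rfl, apply_eq_sum x subset_rfl v, map_sum, Finset.sum_mul,
    Finset.mul_sum, ← Finset.sum_add_distrib]
  refine Finset.sum_congr rfl fun b _ => ?_
  rw [mul_assoc, annihilate_mul_wedge, mul_sub, ← mul_assoc, wedge_mul_wedge, map_smul]
  simp [mul_assoc]

theorem fockEnd_mul_annihilate (x : slInf) (b : ℤ) {A : Finset ℤ} (hA : supp x ⊆ A) :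
    fockEnd x * annihilate b
      = annihilate b * fockEnd x - ∑ c ∈ A, entry x.1 b c • annihilate c := by
  rw [fockEnd_eq_sum x hA, Finset.sum_mul, Finset.mul_sum, ← Finset.sum_sub_distrib]
  refine Finset.sum_congr rfl fun c _ => ?_
  rw [← mul_assoc, annihilate_mul_wedge, mul_assoc, annihilate_mul_annihilate, sub_mul]
  simp [mul_assoc, entry]

theorem fockEnd_add (x y : slInf) : fockEnd (x + y) = fockEnd x + fockEnd y := by
  classical
  have h1 : supp x ⊆ supp x ∪ supp y ∪ supp (x + y) := fun i hi => by simp [hi]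
  have h2 : supp y ⊆ supp x ∪ supp y ∪ supp (x + y) := fun i hi => by simp [hi]
  have h3 : supp (x + y) ⊆ supp x ∪ supp y ∪ supp (x + y) := fun i hi => by simp [hi]
  rw [fockEnd_eq_sum _ h1, fockEnd_eq_sum _ h2, fockEnd_eq_sum _ h3, ← Finset.sum_add_distrib]
  refine Finset.sum_congr rfl fun b _ => ?_
  rw [← add_mul, ← map_add]
  rfl

theorem fockEnd_smul (c : ℂ) (x : slInf) : fockEnd (c • x) = c • fockEnd x := by
  classical
  have h1 : supp x ⊆ supp x ∪ supp (c • x) := fun i hi => by simp [hi]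
  have h2 : supp (c • x) ⊆ supp x ∪ supp (c • x) := fun i hi => by simp [hi]
  rw [fockEnd_eq_sum _ h1, fockEnd_eq_sum _ h2, Finset.smul_sum]
  refine Finset.sum_congr rfl fun b _ => ?_
  rw [← smul_mul_assoc, ← map_smul]
  rfl

theorem fockEnd_lie (x y : slInf) :
    fockEnd ⁅x, y⁆ = fockEnd x * fockEnd y - fockEnd y * fockEnd x := by
  classical
  obtain ⟨A, hx, hy, hxy⟩ : ∃ A : Finset ℤ, supp x ⊆ A ∧ supp y ⊆ A ∧ supp ⁅x, y⁆ ⊆ A :=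
    ⟨supp x ∪ supp y ∪ supp ⁅x, y⁆, fun i hi => by simp [hi], fun i hi => by simp [hi],
      fun i hi => by simp [hi]⟩
  have h1 : fockEnd x * fockEnd y - fockEnd y * fockEnd x
      = ∑ b ∈ A, (wedge (x.1 (y.1 (u b))) * annihilate b
          - wedge (y.1 (u b)) * ∑ c ∈ A, entry x.1 b c • annihilate c) := by
    conv_lhs => rw [fockEnd_eq_sum y hy]
    rw [Finset.mul_sum, Finset.sum_mul, ← Finset.sum_sub_distrib]
    refine Finset.sum_congr rfl fun b _ => ?_
    rw [← mul_assoc, fockEnd_mul_wedge, add_mul, mul_assoc (wedge _) (fockEnd x),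
      fockEnd_mul_annihilate x b hx, mul_sub, mul_assoc]
    abel
  have h2 : ∑ b ∈ A, wedge (y.1 (u b)) * ∑ c ∈ A, entry x.1 b c • annihilate c
      = ∑ c ∈ A, wedge (y.1 (x.1 (u c))) * annihilate c := by
    simp only [Finset.mul_sum]
    rw [Finset.sum_comm]
    refine Finset.sum_congr rfl fun c _ => ?_
    rw [apply_eq_sum y hy (x.1 (u c)), map_sum, Finset.sum_mul]
    refine Finset.sum_congr rfl fun b _ => ?_
    rw [map_smul, smul_mul_assoc, mul_smul_comm, entry]
  rw [h1, Finset.sum_sub_distrib, h2, ← Finset.sum_sub_distrib, fockEnd_eq_sum _ hxy]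
  refine Finset.sum_congr rfl fun b _ => ?_
  rw [← sub_mul, ← map_sub]
  rfl

instance : LieRingModule slInf FockAll where
  bracket x f := fockEnd x f
  add_lie x y f := by rw [fockEnd_add]; rfl
  lie_add x f g := map_add _ f g
  leibniz_lie x y f := by
    change fockEnd x (fockEnd y f) = fockEnd ⁅x, y⁆ f + fockEnd y (fockEnd x f)
    rw [fockEnd_lie]
    simp

instance : LieModule ℂ slInf FockAll where
  smul_lie c x f := by
    change fockEnd (c • x) f = c • fockEnd x f
    rw [fockEnd_smul]
    rfl
  lie_smul c x f := map_smul _ c f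

theorem lie_fock (x : slInf) (f : FockAll) :
    ⁅x, f⁆ = ∑ b ∈ supp x, wedge (x.1 (u b)) (annihilate b f) := by
  change fockEnd x f = _
  rw [fockEnd_eq_sum x subset_rfl, LinearMap.sum_apply]
  rfl

theorem charge_insert {a : ℤ} {S : SemiInfinite} (ha : a ∉ S.carrier) :
    charge (S.insert a) = charge S + 1 := by
  have h : (S.insert a).carrier = Insert.insert a S.carrier := rfl
  rw [charge, charge, h]
  rcases lt_or_ge a 0 with h0 | h0
  · have h1 : Insert.insert a S.carrier ∩ Set.Ici 0 = S.carrier ∩ Set.Ici 0 :=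
      Set.insert_inter_of_notMem (by simpa using h0)
    have h2 : Set.Iio 0 \ S.carrier = Insert.insert a (Set.Iio 0 \ Insert.insert a S.carrier) := by
      ext i
      by_cases hi : i = a
      · subst hi; simp [h0, ha]
      · simp [hi]
    have h3 : (Set.Iio 0 \ Insert.insert a S.carrier).Finite := (S.insert a).finite_compl
    rw [h1, h2, Set.ncard_insert_of_notMem (by simp) h3]
    push_cast
    ring
  · have h1 : Set.Iio 0 \ Insert.insert a S.carrier = Set.Iio 0 \ S.carrier := by
      ext i
      by_cases hi : i = a
      · subst hi; simp [h0]
      · simp [hi]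
    rw [h1, Set.insert_inter_of_mem (by simpa using h0),
      Set.ncard_insert_of_notMem (fun h => ha h.1) S.finite_nonneg]
    push_cast
    ring

theorem charge_erase {a : ℤ} {S : SemiInfinite} (ha : a ∈ S.carrier) :
    charge (S.erase a) = charge S - 1 := by
  have ha' : a ∉ (S.erase a).carrier := fun h => h.2 rfl
  have h := charge_insert ha'
  have hS : (S.erase a).insert a = S := by
    refine SemiInfinite.ext ?_
    change Insert.insert a (S.carrier \ {a}) = S.carrier
    simp [ha]
  rw [hS] at h
  linarith

/-- The span of the basis vectors of charge `t`. -/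
def chargeSpace (t : ℤ) : Submodule ℂ FockAll :=
  Submodule.span ℂ (semiWedge '' {S | charge S = t})

theorem semiWedge_mem_chargeSpace {S : SemiInfinite} {t : ℤ} (h : charge S = t) :
    semiWedge S ∈ chargeSpace t :=
  Submodule.subset_span ⟨S, h, rfl⟩

theorem map_mem_chargeSpace (φ : Module.End ℂ FockAll) {t t' : ℤ}
    (h : ∀ S : SemiInfinite, charge S = t → φ (semiWedge S) ∈ chargeSpace t')
    {f : FockAll} (hf : f ∈ chargeSpace t) : φ f ∈ chargeSpace t' := by
  have : chargeSpace t ≤ (chargeSpace t').comap φ := by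
    refine Submodule.span_le.2 ?_
    rintro _ ⟨S, hS, rfl⟩
    exact h S hS
  exact this hf

theorem annihilate_mem_chargeSpace (a : ℤ) {t : ℤ} {f : FockAll} (hf : f ∈ chargeSpace t) :
    annihilate a f ∈ chargeSpace (t - 1) := by
  refine map_mem_chargeSpace _ (fun S hS => ?_) hf
  by_cases ha : a ∈ S.carrier
  · rw [annihilate_of_mem ha]
    exact Submodule.smul_mem _ _ (semiWedge_mem_chargeSpace (by rw [charge_erase ha, hS]))
  · rw [annihilate_of_notMem ha]
    exact Submodule.zero_mem _

theorem wedge_mem_chargeSpace (v : V) {t : ℤ} {f : FockAll} (hf : f ∈ chargeSpace t) :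
    wedge v f ∈ chargeSpace (t + 1) := by
  rw [wedge, Module.Basis.constr_apply, Finsupp.sum, LinearMap.sum_apply]
  refine Submodule.sum_mem _ fun a _ => Submodule.smul_mem _ _ ?_
  refine map_mem_chargeSpace _ (fun S hS => ?_) hf
  by_cases ha : a ∈ S.carrier
  · rw [create_of_mem ha]
    exact Submodule.zero_mem _
  · rw [create_of_notMem ha]
    exact Submodule.smul_mem _ _ (semiWedge_mem_chargeSpace (by rw [charge_insert ha, hS]))

/-- The span of the semi-infinite wedges `u i₁ ∧ u i₂ ∧ ⋯` with `i₁ > i₂ > ⋯` and `i k = t - k`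
for all sufficiently large `k`. -/
def fock (t : ℤ) : LieSubmodule ℂ slInf FockAll where
  toSubmodule := chargeSpace t
  lie_mem := by
    intro x f hf
    rw [lie_fock]
    refine Submodule.sum_mem _ fun b _ => ?_
    have := wedge_mem_chargeSpace (x.1 (u b)) (annihilate_mem_chargeSpace b hf)
    rwa [sub_add_cancel] at this

/-- The Fock space `𝔉`, spanned by the `u i₁ ∧ u i₂ ∧ ⋯` with `i₁ > i₂ > ⋯` and `i k = -k` for
all sufficiently large `k`. -/
abbrev Fock : Type := fock 0

/-- The dual Fock space `𝔉^∨_t`, spanned by the `w i₁ ∧ w i₂ ∧ ⋯` with `i₁ > i₂ > ⋯` and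
`i k = t - k` for all sufficiently large `k`; here the `w i` are the basis vectors of
`V^∨ = Twist V`, so the action is the twisted one. -/
abbrev FockDual (t : ℤ) : Type := Twist (fock t)

/-! ### Socles and the modules `S m n` -/

/-- The sum of all simple submodules. -/
def socle (L M : Type*) [LieRing L] [LieAlgebra ℂ L] [AddCommGroup M] [Module ℂ M]
    [LieRingModule L M] [LieModule ℂ L M] : LieSubmodule ℂ L M :=
  sSup {N : LieSubmodule ℂ L M | LieModule.IsIrreducible ℂ L N}

/-- The module `Λ^m V^∨ ⊗ Λ^n V`. -/
abbrev MixedWedge (m n : ℕ) : Type := (⋀[ℂ]^m VDual) ⊗[ℂ] (⋀[ℂ]^n V)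

/-- The socle of `Λ^m V^∨ ⊗ Λ^n V`. -/
abbrev S (m n : ℕ) : LieSubmodule ℂ slInf (MixedWedge m n) := socle slInf (MixedWedge m n)

end FockTensor

end

noncomputable section

namespace FockTensor

/-! ### Commuting pairs of fermions -/

/-! On the tensor product of the two Fock spaces let `ψ a`, `ψd a` be creation and annihilation on
the second factor and `χ a`, `χd a` those on the first, rescaled by (-1)^a. The matrix unit `E a b`
then acts as ψ_a ψd_b - χ_b χd_a. The same formula describes Λ(V^∨) ⊗ Λ(V), so the argument is
carried out once, for a `FermionPair`.

Both spaces carry a functional τ with τψ_a = τχd_a and τχ_a = τψd_a (`IsInvariant`); hence τ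
vanishes on the image of every `E a b`. Call τ(χd_{p_1}⋯χd_{p_c} ψd_{q_1}⋯ψd_{q_s} v) a contraction
of v of type (c, s). The subspaces `vanish`, on which all contractions of a given type are zero, are
stable under the matrix units. The term R^k consists of the v whose contractions of type (j +
max(t,0), j + max(-t,0)) vanish for all j < k. The operator Σ χd_q ψd_q is no finite sum on Fock
space, and these numbers replace it; on a mixed exterior power the analogous conditions cut out the
kernel of the contraction map (`mem_contractionKer_iff`).

The core is `StableOn.mem_of_notMem_vanish`: a stable subspace containing some y with a non-zero
contraction of type (c, r) contains every v of the same level whose contractions with fewer than r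
operators ψd vanish. Its engine is `numψ_eq_of_new`: for an index p not occurring in v, the number
operator equals χ_p ψ_p (Σ χd_q ψd_q) plus Σ E_{qp} ψ_p ψd_q on v. This moves fermions of v to new
indices, and pairs to new pairs. `IsProd.mem` uses it to pass from y to all products of creation
operators with new indices and at least r unpaired ψ's; `StableOn.mem_of_isProd` uses it backwards
to recover v from such products. To apply this to Fock space, finitely many semi-infinite wedges are
regarded as finite wedges over the vacuum filled below -M, with M large.

Consequently a submodule not contained in R^{k+1} contains R^k (`fockFilt_le`), and since the
intersection of the R^k is zero, every non-zero submodule is some R^r. In a mixed exterior power the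
same statement makes the contraction kernel the smallest non-zero submodule, hence simple and equal
to the socle.

The layers are identified by a relation (`layerRel`): v in R^j is related to y in the contraction
kernel when their contractions of the critical type agree. It is invariant, since the difference of
the two functionals is invariant on the product. One explicit related pair makes both projections
surjective, by the two minimality statements, and the relation is the graph of a map with kernel
R^{j+1}. -/

/-- Two commuting families of fermionic creation operators `ψ a`, `χ a` and annihilation
operators `ψd a`, `χd a` on a vector space. -/
structure FermionPair (T : Type*) [AddCommGroup T] [Module ℂ T] where
  /-- creation operators of the first kind -/
  ψ : ℤ → Module.End ℂ T
  /-- annihilation operators of the first kind -/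
  ψd : ℤ → Module.End ℂ T
  /-- creation operators of the second kind -/
  χ : ℤ → Module.End ℂ T
  /-- annihilation operators of the second kind -/
  χd : ℤ → Module.End ℂ T
  ψ_ψ : ∀ a b v, ψ a (ψ b v) = -ψ b (ψ a v)
  ψd_ψd : ∀ a b v, ψd a (ψd b v) = -ψd b (ψd a v)
  ψd_ψ : ∀ a b v, ψd a (ψ b v) = (if a = b then v else 0) - ψ b (ψd a v)
  χ_χ : ∀ a b v, χ a (χ b v) = -χ b (χ a v)
  χd_χd : ∀ a b v, χd a (χd b v) = -χd b (χd a v)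
  χd_χ : ∀ a b v, χd a (χ b v) = (if a = b then v else 0) - χ b (χd a v)
  ψ_χ : ∀ a b v, ψ a (χ b v) = χ b (ψ a v)
  ψ_χd : ∀ a b v, ψ a (χd b v) = χd b (ψ a v)
  ψd_χ : ∀ a b v, ψd a (χ b v) = χ b (ψd a v)
  ψd_χd : ∀ a b v, ψd a (χd b v) = χd b (ψd a v)

namespace FermionPair

variable {T : Type*} [AddCommGroup T] [Module ℂ T] (A : FermionPair T)

/-- The matrix unit in position `(a, b)`, acting on the first kind through the natural and on the
second kind through the dual representation. -/
def E (a b : ℤ) : Module.End ℂ T := A.ψ a * A.ψd b - A.χ b * A.χd a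

theorem E_apply (a b : ℤ) (v : T) : A.E a b v = A.ψ a (A.ψd b v) - A.χ b (A.χd a v) := rfl

/-- The creation of a pair. -/
def pair (p : ℤ) : Module.End ℂ T := A.χ p * A.ψ p

theorem pair_apply (p : ℤ) (v : T) : A.pair p v = A.χ p (A.ψ p v) := rfl

/-- The annihilation of pairs with indices in `F`. -/
def contr (F : Finset ℤ) : Module.End ℂ T := ∑ q ∈ F, A.χd q * A.ψd q

theorem contr_apply (F : Finset ℤ) (v : T) : A.contr F v = ∑ q ∈ F, A.χd q (A.ψd q v) := by
  simp [contr]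

/-- The number of fermions of the first kind with indices in `F`. -/
def numψ (F : Finset ℤ) : Module.End ℂ T := ∑ q ∈ F, A.ψ q * A.ψd q

theorem numψ_apply (F : Finset ℤ) (v : T) : A.numψ F v = ∑ q ∈ F, A.ψ q (A.ψd q v) := by
  simp [numψ]

/-- The number of fermions of the second kind with indices in `F`. -/
def numχ (F : Finset ℤ) : Module.End ℂ T := ∑ q ∈ F, A.χ q * A.χd q

theorem numχ_apply (F : Finset ℤ) (v : T) : A.numχ F v = ∑ q ∈ F, A.χ q (A.χd q v) := by
  simp [numχ]

/-! ### Commutation relations of matrix units, contractions and number operators -/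

theorem ψ_E {a b p : ℤ} (hb : p ≠ b) (v : T) : A.ψ p (A.E a b v) = A.E a b (A.ψ p v) := by
  simp only [E_apply, map_sub, A.ψ_χ, A.ψ_χd, A.ψd_ψ, if_neg hb.symm, zero_sub, map_neg]
  rw [A.ψ_ψ p a]

theorem χ_E {a b p : ℤ} (ha : p ≠ a) (v : T) : A.χ p (A.E a b v) = A.E a b (A.χ p v) := by
  simp only [E_apply, map_sub, A.ψ_χ, A.ψd_χ, A.χd_χ, if_neg ha.symm, zero_sub, map_neg]
  rw [A.χ_χ p b]

theorem pair_E {a b p : ℤ} (ha : p ≠ a) (hb : p ≠ b) (v : T) :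
    A.pair p (A.E a b v) = A.E a b (A.pair p v) := by
  rw [pair_apply, pair_apply, A.ψ_E hb, A.χ_E ha]

/-- The annihilation operators span a representation: the commutator with a matrix unit is again an
annihilation operator or zero. This is what makes `vanish` stable. -/
theorem ψd_E (q a b : ℤ) (v : T) :
    A.ψd q (A.E a b v) = A.E a b (A.ψd q v) + if q = a then A.ψd b v else 0 := by
  simp only [E_apply, map_sub, A.ψd_χ, A.ψd_χd, A.ψd_ψ]
  rw [A.ψd_ψd q b, map_neg]
  abel

theorem χd_E (q a b : ℤ) (v : T) :
    A.χd q (A.E a b v) = A.E a b (A.χd q v) - if q = b then A.χd a v else 0 := by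
  simp only [E_apply, map_sub, ← A.ψ_χd, ← A.ψd_χd, A.χd_χ]
  rw [A.χd_χd q a, map_neg]
  abel

theorem ψd_contr (q : ℤ) (F : Finset ℤ) (v : T) :
    A.ψd q (A.contr F v) = -A.contr F (A.ψd q v) := by
  simp only [contr_apply, map_sum, ← Finset.sum_neg_distrib]
  exact Finset.sum_congr rfl fun a _ => by rw [A.ψd_χd, A.ψd_ψd, map_neg]

theorem χd_contr (q : ℤ) (F : Finset ℤ) (v : T) :
    A.χd q (A.contr F v) = -A.contr F (A.χd q v) := by
  simp only [contr_apply, map_sum, ← Finset.sum_neg_distrib]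
  exact Finset.sum_congr rfl fun a _ => by rw [A.χd_χd, A.ψd_χd]

theorem numψ_ψd {q : ℤ} {F : Finset ℤ} (hq : q ∈ F) (v : T) :
    A.numψ F (A.ψd q v) = A.ψd q (A.numψ F v) - A.ψd q v := by
  have : ∀ a, A.ψd q (A.ψ a (A.ψd a v))
      = (if q = a then A.ψd a v else 0) + A.ψ a (A.ψd a (A.ψd q v)) := fun a => by
    rw [A.ψd_ψ, A.ψd_ψd q a, map_neg, sub_neg_eq_add]
  simp only [numψ_apply, map_sum, this, Finset.sum_add_distrib, Finset.sum_ite_eq, if_pos hq]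
  abel

theorem numψ_χd (q : ℤ) (F : Finset ℤ) (v : T) :
    A.numψ F (A.χd q v) = A.χd q (A.numψ F v) := by
  simp only [numψ_apply, map_sum, A.ψd_χd, A.ψ_χd]

theorem numχ_χd {q : ℤ} {F : Finset ℤ} (hq : q ∈ F) (v : T) :
    A.numχ F (A.χd q v) = A.χd q (A.numχ F v) - A.χd q v := by
  have : ∀ a, A.χd q (A.χ a (A.χd a v))
      = (if q = a then A.χd a v else 0) + A.χ a (A.χd a (A.χd q v)) := fun a => by
    rw [A.χd_χ, A.χd_χd q a, map_neg, sub_neg_eq_add]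
  simp only [numχ_apply, map_sum, this, Finset.sum_add_distrib, Finset.sum_ite_eq, if_pos hq]
  abel

theorem numχ_ψd (q : ℤ) (F : Finset ℤ) (v : T) :
    A.numχ F (A.ψd q v) = A.ψd q (A.numχ F v) := by
  simp only [numχ_apply, map_sum, A.ψd_χd, A.ψd_χ]

/-! #### Subspaces stable under matrix units -/

/-- Stability under the off-diagonal matrix units with indices in `Z`. -/
def StableOn (Z : Set ℤ) (N : Submodule ℂ T) : Prop :=
  ∀ a ∈ Z, ∀ b ∈ Z, a ≠ b → ∀ v ∈ N, A.E a b v ∈ N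

variable {A}

/-- Creation at p commutes with the matrix units that avoid p. Passing to the preimage trades one
fermion for one forbidden index, and this drives all the inductions over products. -/
theorem StableOn.comap_ψ {Z : Set ℤ} {N : Submodule ℂ T} (h : A.StableOn Z N) (p : ℤ) :
    A.StableOn (Z \ {p}) (N.comap (A.ψ p)) := fun a ha b hb hab v hv => by
  rw [Submodule.mem_comap, A.ψ_E (Ne.symm hb.2)]
  exact h a ha.1 b hb.1 hab _ hv

theorem StableOn.comap_χ {Z : Set ℤ} {N : Submodule ℂ T} (h : A.StableOn Z N) (p : ℤ) :
    A.StableOn (Z \ {p}) (N.comap (A.χ p)) := fun a ha b hb hab v hv => by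
  rw [Submodule.mem_comap, A.χ_E (Ne.symm ha.2)]
  exact h a ha.1 b hb.1 hab _ hv

theorem StableOn.comap_pair {Z : Set ℤ} {N : Submodule ℂ T} (h : A.StableOn Z N) (p : ℤ) :
    A.StableOn (Z \ {p}) (N.comap (A.pair p)) := fun a ha b hb hab v hv => by
  rw [Submodule.mem_comap, A.pair_E (Ne.symm ha.2) (Ne.symm hb.2)]
  exact h a ha.1 b hb.1 hab _ hv

variable (A)

/-! #### Invariant functionals and the vanishing of their contractions -/

/-- A functional with respect to which the two kinds of fermions are dual to each other. -/
structure IsInvariant (τ : T →ₗ[ℂ] ℂ) : Prop where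
  ψ : ∀ a v, τ (A.ψ a v) = τ (A.χd a v)
  χ : ∀ a v, τ (A.χ a v) = τ (A.ψd a v)

-- Both terms of `E a b` turn into the same double contraction under τ, because the two kinds of
-- fermions commute.
variable {A} in
theorem IsInvariant.E {τ : T →ₗ[ℂ] ℂ} (h : A.IsInvariant τ) (a b : ℤ) (v : T) :
    τ (A.E a b v) = 0 := by
  rw [E_apply, map_sub, h.ψ, h.χ, A.ψd_χd, sub_self]

/-- The vectors all of whose contractions by `c` annihilation operators of the second kind and `s`
of the first kind, with indices in `Z`, are killed by `τ`. -/
def vanish (τ : T →ₗ[ℂ] ℂ) (Z : Set ℤ) : ℕ → ℕ → Submodule ℂ T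
  | 0, 0 => LinearMap.ker τ
  | c + 1, 0 => ⨅ p ∈ Z, (vanish τ Z c 0).comap (A.χd p)
  | c, s + 1 => ⨅ q ∈ Z, (vanish τ Z c s).comap (A.ψd q)

variable {τ : T →ₗ[ℂ] ℂ} {Z : Set ℤ}

theorem mem_vanish_zero {v : T} : v ∈ A.vanish τ Z 0 0 ↔ τ v = 0 := by
  rw [vanish, LinearMap.mem_ker]

theorem mem_vanish_succ_right {c s : ℕ} {v : T} :
    v ∈ A.vanish τ Z c (s + 1) ↔ ∀ q ∈ Z, A.ψd q v ∈ A.vanish τ Z c s := by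
  cases c <;> simp [vanish]

/-- The definition of `vanish` strips the ψd's before the χd's; since the two kinds commute, a χd
may be stripped at any moment. -/
theorem mem_vanish_succ_left {c s : ℕ} {v : T} :
    v ∈ A.vanish τ Z (c + 1) s ↔ ∀ p ∈ Z, A.χd p v ∈ A.vanish τ Z c s := by
  induction s generalizing v with
  | zero => simp [vanish]
  | succ s ih =>
    simp only [mem_vanish_succ_right, ih, A.ψd_χd]
    exact ⟨fun h p hp q hq => h q hq p hp, fun h p hp q hq => h q hq p hp⟩

theorem vanish_anti {Z' : Set ℤ} (h : Z ⊆ Z') (c s : ℕ) :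
    A.vanish τ Z' c s ≤ A.vanish τ Z c s := by
  intro v
  induction s generalizing v with
  | succ s ih =>
    simp only [mem_vanish_succ_right]
    exact fun hv q hq => ih (hv q (h hq))
  | zero =>
    induction c generalizing v with
    | zero => simp only [mem_vanish_zero, imp_self]
    | succ c ih =>
      simp only [mem_vanish_succ_left]
      exact fun hv q hq => ih (hv q (h hq))

/-- Non-vanishing is detected by finitely many indices. -/
theorem exists_finset_notMem_vanish {c s : ℕ} {v : T} (h : v ∉ A.vanish τ Z c s) :
    ∃ F : Finset ℤ, (F : Set ℤ) ⊆ Z ∧ v ∉ A.vanish τ F c s := by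
  classical
  induction s generalizing v with
  | succ s ih =>
    simp only [mem_vanish_succ_right, not_forall] at h
    obtain ⟨q, hq, h⟩ := h
    obtain ⟨F, hF, h⟩ := ih h
    refine ⟨insert q F, by simp [Set.insert_subset_iff, hq, hF], fun hv => h ?_⟩
    exact A.vanish_anti (by simp) c s (A.mem_vanish_succ_right.1 hv q (by simp))
  | zero =>
    induction c generalizing v with
    | zero => exact ⟨∅, by simp, by simpa only [mem_vanish_zero] using h⟩
    | succ c ih =>
      simp only [mem_vanish_succ_left, not_forall] at h
      obtain ⟨q, hq, h⟩ := h
      obtain ⟨F, hF, h⟩ := ih h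
      refine ⟨insert q F, by simp [Set.insert_subset_iff, hq, hF], fun hv => h ?_⟩
      exact A.vanish_anti (by simp) c 0 (A.mem_vanish_succ_left.1 hv q (by simp))

variable {A}

theorem IsInvariant.E_mem_vanish (h : A.IsInvariant τ) {a b : ℤ} (ha : a ∈ Z) (hb : b ∈ Z)
    {c s : ℕ} {v : T} (hv : v ∈ A.vanish τ Z c s) : A.E a b v ∈ A.vanish τ Z c s := by
  induction s generalizing v with
  | succ s ih =>
    simp only [mem_vanish_succ_right] at hv ⊢
    intro q hq
    rw [A.ψd_E]
    refine Submodule.add_mem _ (ih (hv q hq)) ?_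
    split_ifs
    exacts [hv b hb, Submodule.zero_mem _]
  | zero =>
    induction c generalizing v with
    | zero => rw [mem_vanish_zero, h.E]
    | succ c ih =>
      simp only [mem_vanish_succ_left] at hv ⊢
      intro q hq
      rw [A.χd_E]
      refine Submodule.sub_mem _ (ih (hv q hq)) ?_
      split_ifs
      exacts [hv a ha, Submodule.zero_mem _]

/-- Contracting a pair does not affect vanishing. -/
theorem IsInvariant.contr_mem_vanish (h : A.IsInvariant τ) {F : Finset ℤ} {c s : ℕ} {v : T}
    {ν : ℂ} (hν : A.numψ F v = ν • v) (hs : ν ≠ s) :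
    A.contr F v ∈ A.vanish τ F c s ↔ v ∈ A.vanish τ F c s := by
  induction s generalizing v ν with
  | succ s ih =>
    simp only [mem_vanish_succ_right]
    refine forall₂_congr fun q hq => ?_
    rw [A.ψd_contr, Submodule.neg_mem_iff]
    refine ih (ν := ν - 1) ?_ fun h => hs ?_
    · rw [A.numψ_ψd hq, hν, map_smul, sub_smul, one_smul]
    · rw [sub_eq_iff_eq_add.1 h]; push_cast; ring
  | zero =>
    induction c generalizing v with
    | zero =>
      -- Invariance of τ turns each χd_q into ψ_q, so the pair contraction becomes the number
      -- operator. By then the s contractions have lowered the eigenvalue to the original one minus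
      -- s, which is non-zero.
      have key : τ (A.contr F v) = ν * τ v := by
        rw [← smul_eq_mul, ← map_smul, ← hν, contr_apply, numψ_apply, map_sum, map_sum]
        exact Finset.sum_congr rfl fun a _ => (h.ψ _ _).symm
      rw [mem_vanish_zero, mem_vanish_zero, key, mul_eq_zero]
      exact or_iff_right (by simpa using hs)
    | succ c ih =>
      simp only [mem_vanish_succ_left]
      refine forall₂_congr fun q hq => ?_
      rw [A.χd_contr, Submodule.neg_mem_iff]
      exact ih (by rw [A.numψ_χd, hν, map_smul])

/-- Contractions leaving different numbers of fermions of the two kinds vanish. -/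
theorem IsInvariant.mem_vanish_of_charge_ne (h : A.IsInvariant τ) {F : Finset ℤ} {c s : ℕ} {v : T}
    {μ ν : ℂ} (hμ : A.numχ F v = μ • v) (hν : A.numψ F v = ν • v) (hs : μ + s ≠ ν + c) :
    v ∈ A.vanish τ F c s := by
  induction s generalizing v ν with
  | succ s ih =>
    simp only [mem_vanish_succ_right]
    refine fun q hq => ih (ν := ν - 1) ?_ ?_ fun h => hs ?_
    · rw [A.numχ_ψd, hμ, map_smul]
    · rw [A.numψ_ψd hq, hν, map_smul, sub_smul, one_smul]
    · push_cast; linear_combination h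
  | zero =>
    induction c generalizing v μ with
    | zero =>
      -- Under τ both number operators become the sum of τ(χd_q ψd_q v).
      have h1 : τ (A.numψ F v) = τ (A.numχ F v) := by
        rw [numχ_apply, numψ_apply, map_sum, map_sum]
        exact Finset.sum_congr rfl fun a _ => by rw [h.ψ, h.χ, A.ψd_χd]
      rw [hμ, hν, map_smul, map_smul, smul_eq_mul, smul_eq_mul] at h1
      rw [mem_vanish_zero]
      by_contra h0
      exact hs (by simpa using (mul_right_cancel₀ h0 h1).symm)
    | succ c ih =>
      simp only [mem_vanish_succ_left]
      refine fun q hq => ih (μ := μ - 1) ?_ ?_ fun h => hs ?_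
      · rw [A.numχ_χd hq, hμ, map_smul, sub_smul, one_smul]
      · rw [A.numψ_χd, hν, map_smul]
      · push_cast at h ⊢; linear_combination h

/-- No ψd is available to remove ψ_q, so ψ_q survives up to τ, where it turns into χd_q and kills
the vector. -/
theorem IsInvariant.ψ_mem_vanish_zero (h : A.IsInvariant τ) {q : ℤ} {c : ℕ} {v : T}
    (hq : A.χd q v = 0) : A.ψ q v ∈ A.vanish τ Z c 0 := by
  induction c generalizing v with
  | zero => rw [mem_vanish_zero, h.ψ, hq, map_zero]
  | succ c ih =>
    rw [mem_vanish_succ_left]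
    intro p _
    rw [← A.ψ_χd]
    exact ih (by rw [A.χd_χd, hq, map_zero, neg_zero])

theorem IsInvariant.χ_mem_vanish_zero (h : A.IsInvariant τ) {q : ℤ} {s : ℕ} {v : T}
    (hq : A.ψd q v = 0) : A.χ q v ∈ A.vanish τ Z 0 s := by
  induction s generalizing v with
  | zero => rw [mem_vanish_zero, h.χ, hq, map_zero]
  | succ c ih =>
    rw [mem_vanish_succ_right]
    intro p _
    rw [A.ψd_χ]
    exact ih (by rw [A.ψd_ψd, hq, map_zero, neg_zero])

/-- Either one of the s + 1 operators ψd removes ψ_q, leaving a contraction of v of type (c, s), or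
ψ_q survives and `ψ_mem_vanish_zero` applies. -/
theorem IsInvariant.ψ_mem_vanish (h : A.IsInvariant τ) {q : ℤ} {c s : ℕ} {v : T}
    (hq : A.χd q v = 0) (hv : v ∈ A.vanish τ Z c s) : A.ψ q v ∈ A.vanish τ Z c (s + 1) := by
  induction s generalizing v with
  | zero =>
    rw [mem_vanish_succ_right]
    intro p _
    rw [A.ψd_ψ]
    refine Submodule.sub_mem _ ?_ (h.ψ_mem_vanish_zero (by rw [← A.ψd_χd, hq, map_zero]))
    split_ifs
    exacts [hv, Submodule.zero_mem _]
  | succ s ih =>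
    rw [mem_vanish_succ_right]
    intro p hp
    rw [A.ψd_ψ]
    refine Submodule.sub_mem _ ?_
      (ih (by rw [← A.ψd_χd, hq, map_zero]) (A.mem_vanish_succ_right.1 hv p hp))
    split_ifs
    exacts [hv, Submodule.zero_mem _]

theorem IsInvariant.χ_mem_vanish (h : A.IsInvariant τ) {q : ℤ} {c s : ℕ} {v : T}
    (hq : A.ψd q v = 0) (hv : v ∈ A.vanish τ Z c s) : A.χ q v ∈ A.vanish τ Z (c + 1) s := by
  induction c generalizing v with
  | zero =>
    rw [mem_vanish_succ_left]
    intro p _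
    rw [A.χd_χ]
    refine Submodule.sub_mem _ ?_ (h.χ_mem_vanish_zero (by rw [A.ψd_χd, hq, map_zero]))
    split_ifs
    exacts [hv, Submodule.zero_mem _]
  | succ s ih =>
    rw [mem_vanish_succ_left]
    intro p hp
    rw [A.χd_χ]
    refine Submodule.sub_mem _ ?_
      (ih (by rw [A.ψd_χd, hq, map_zero]) (A.mem_vanish_succ_left.1 hv p hp))
    split_ifs
    exacts [hv, Submodule.zero_mem _]

end FermionPair

namespace FermionPair

variable {T : Type*} [AddCommGroup T] [Module ℂ T] (A : FermionPair T)

/-! #### Vectors with a given number of fermions -/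

/-- A vector annihilated by all annihilation operators with indices in `Z`. -/
structure IsVacuum (Z : Set ℤ) (v₀ : T) : Prop where
  ψd : ∀ a ∈ Z, A.ψd a v₀ = 0
  χd : ∀ a ∈ Z, A.χd a v₀ = 0

/-- The linear combinations of vectors obtained from `v₀` by creating `m` fermions of the second
kind and `n` of the first kind, with indices in `Z`. -/
inductive Level (v₀ : T) (Z : Set ℤ) : ℕ → ℕ → T → Prop
  | vac : Level v₀ Z 0 0 v₀
  | ψ {m n : ℕ} {v : T} {a : ℤ} (ha : a ∈ Z) (hv : Level v₀ Z m n v) :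
    Level v₀ Z m (n + 1) (A.ψ a v)
  | χ {m n : ℕ} {v : T} {a : ℤ} (ha : a ∈ Z) (hv : Level v₀ Z m n v) :
    Level v₀ Z (m + 1) n (A.χ a v)
  | zero (m n : ℕ) : Level v₀ Z m n 0
  | add {m n : ℕ} {v w : T} (hv : Level v₀ Z m n v) (hw : Level v₀ Z m n w) : Level v₀ Z m n (v + w)
  | smul {m n : ℕ} {v : T} (c : ℂ) (hv : Level v₀ Z m n v) : Level v₀ Z m n (c • v)

variable {A} {v₀ : T} {Z Z' : Set ℤ} {m n : ℕ} {v : T}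

theorem Level.mono (hZ : Z ⊆ Z') (h : A.Level v₀ Z m n v) : A.Level v₀ Z' m n v := by
  induction h with
  | vac => exact .vac
  | ψ ha _ ih => exact .ψ (hZ ha) ih
  | χ ha _ ih => exact .χ (hZ ha) ih
  | zero => exact .zero _ _
  | add _ _ ih ih' => exact .add ih ih'
  | smul c _ ih => exact .smul c ih

theorem Level.neg (h : A.Level v₀ Z m n v) : A.Level v₀ Z m n (-v) := by
  rw [← neg_one_smul ℂ]
  exact h.smul _

theorem Level.sub {w : T} (h : A.Level v₀ Z m n v) (h' : A.Level v₀ Z m n w) :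
    A.Level v₀ Z m n (v - w) := by
  rw [sub_eq_add_neg]
  exact h.add h'.neg

theorem Level.sum {ι : Type*} {s : Finset ι} {f : ι → T} (h : ∀ i ∈ s, A.Level v₀ Z m n (f i)) :
    A.Level v₀ Z m n (∑ i ∈ s, f i) := by
  classical
  induction s using Finset.induction_on with
  | empty => exact .zero _ _
  | insert i s hi ih =>
    rw [Finset.sum_insert hi]
    exact .add (h i (by simp)) (ih fun j hj => h j (by simp [hj]))

theorem Level.exists_finset (h : A.Level v₀ Z m n v) :
    ∃ F : Finset ℤ, (F : Set ℤ) ⊆ Z ∧ A.Level v₀ F m n v := by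
  classical
  induction h with
  | vac => exact ⟨∅, by simp, .vac⟩
  | @ψ _ _ _ a ha _ ih =>
    obtain ⟨F, hF, h⟩ := ih
    exact ⟨insert a F, by simp [Set.insert_subset_iff, ha, hF], .ψ (by simp) (h.mono (by simp))⟩
  | @χ _ _ _ a ha _ ih =>
    obtain ⟨F, hF, h⟩ := ih
    exact ⟨insert a F, by simp [Set.insert_subset_iff, ha, hF], .χ (by simp) (h.mono (by simp))⟩
  | zero => exact ⟨∅, by simp, .zero _ _⟩
  | add _ _ ih ih' =>
    obtain ⟨F, hF, h⟩ := ih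
    obtain ⟨F', hF', h'⟩ := ih'
    exact ⟨F ∪ F', by simp [hF, hF'], .add (h.mono (by simp)) (h'.mono (by simp))⟩
  | smul c _ ih =>
    obtain ⟨F, hF, h⟩ := ih
    exact ⟨F, hF, .smul c h⟩

theorem Level.eq_smul (h : A.Level v₀ Z m n v) (hm : m = 0) (hn : n = 0) :
    ∃ c : ℂ, v = c • v₀ := by
  induction h with
  | vac => exact ⟨1, (one_smul _ _).symm⟩
  | ψ => simp at hn
  | χ => simp at hm
  | zero => exact ⟨0, (zero_smul _ _).symm⟩
  | add _ _ ih ih' =>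
    obtain ⟨c, rfl⟩ := ih hm hn
    obtain ⟨c', rfl⟩ := ih' hm hn
    exact ⟨c + c', (add_smul _ _ _).symm⟩
  | smul c _ ih =>
    obtain ⟨c', rfl⟩ := ih hm hn
    exact ⟨c * c', smul_smul _ _ _⟩

/-- The two assertions are proved together: when ψd_q passes the only ψ of a vector, the remaining
term vanishes by the second one. -/
theorem Level.ψd_and (h : A.Level v₀ Z m n v) {q : ℤ} (hq : A.ψd q v₀ = 0) :
    (∀ k, n = k + 1 → A.Level v₀ Z m k (A.ψd q v)) ∧ (n = 0 → A.ψd q v = 0) := by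
  induction h with
  | vac => exact ⟨fun k hk => by simp at hk, fun _ => hq⟩
  | @ψ m n v a ha hv ih =>
    refine ⟨fun k hk => ?_, fun h => by simp at h⟩
    obtain rfl : n = k := by simpa using hk
    rw [A.ψd_ψ]
    refine .sub ?_ ?_
    · split_ifs
      exacts [hv, .zero _ _]
    · rcases n with - | n
      · rw [ih.2 rfl, map_zero]
        exact .zero _ _
      · exact .ψ ha (ih.1 n rfl)
  | χ ha hv ih =>
    refine ⟨fun k hk => ?_, fun h => ?_⟩
    · rw [A.ψd_χ]
      exact .χ ha (ih.1 k hk)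
    · rw [A.ψd_χ, ih.2 h, map_zero]
  | zero => exact ⟨fun k hk => by rw [map_zero]; exact .zero _ _, fun _ => map_zero _⟩
  | add _ _ ih ih' =>
    exact ⟨fun k hk => by rw [map_add]; exact .add (ih.1 k hk) (ih'.1 k hk),
      fun h => by rw [map_add, ih.2 h, ih'.2 h, add_zero]⟩
  | smul c _ ih =>
    exact ⟨fun k hk => by rw [map_smul]; exact .smul c (ih.1 k hk),
      fun h => by rw [map_smul, ih.2 h, smul_zero]⟩

theorem Level.χd_and (h : A.Level v₀ Z m n v) {q : ℤ} (hq : A.χd q v₀ = 0) :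
    (∀ k, m = k + 1 → A.Level v₀ Z k n (A.χd q v)) ∧ (m = 0 → A.χd q v = 0) := by
  induction h with
  | vac => exact ⟨fun k hk => by simp at hk, fun _ => hq⟩
  | @χ n _ v a ha hv ih =>
    refine ⟨fun k hk => ?_, fun h => by simp at h⟩
    obtain rfl : n = k := by simpa using hk
    rw [A.χd_χ]
    refine .sub ?_ ?_
    · split_ifs
      exacts [hv, .zero _ _]
    · rcases n with - | n
      · rw [ih.2 rfl, map_zero]
        exact .zero _ _
      · exact .χ ha (ih.1 n rfl)
  | ψ ha hv ih =>
    refine ⟨fun k hk => ?_, fun h => ?_⟩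
    · rw [← A.ψ_χd]
      exact .ψ ha (ih.1 k hk)
    · rw [← A.ψ_χd, ih.2 h, map_zero]
  | zero => exact ⟨fun k hk => by rw [map_zero]; exact .zero _ _, fun _ => map_zero _⟩
  | add _ _ ih ih' =>
    exact ⟨fun k hk => by rw [map_add]; exact .add (ih.1 k hk) (ih'.1 k hk),
      fun h => by rw [map_add, ih.2 h, ih'.2 h, add_zero]⟩
  | smul c _ ih =>
    exact ⟨fun k hk => by rw [map_smul]; exact .smul c (ih.1 k hk),
      fun h => by rw [map_smul, ih.2 h, smul_zero]⟩

theorem Level.ψd_eq_zero (h : A.Level v₀ Z m n v) {q : ℤ} (hq : A.ψd q v₀ = 0) (hZ : q ∉ Z) :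
    A.ψd q v = 0 := by
  induction h with
  | vac => exact hq
  | @ψ _ _ _ a ha _ ih =>
    rw [A.ψd_ψ, if_neg (ne_of_mem_of_not_mem ha hZ).symm, ih, map_zero, sub_zero]
  | χ _ _ ih => rw [A.ψd_χ, ih, map_zero]
  | zero => exact map_zero _
  | add _ _ ih ih' => rw [map_add, ih, ih', add_zero]
  | smul c _ ih => rw [map_smul, ih, smul_zero]

theorem Level.χd_eq_zero (h : A.Level v₀ Z m n v) {q : ℤ} (hq : A.χd q v₀ = 0) (hZ : q ∉ Z) :
    A.χd q v = 0 := by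
  induction h with
  | vac => exact hq
  | @χ _ _ _ a ha _ ih =>
    rw [A.χd_χ, if_neg (ne_of_mem_of_not_mem ha hZ).symm, ih, map_zero, sub_zero]
  | ψ _ _ ih => rw [← A.ψ_χd, ih, map_zero]
  | zero => exact map_zero _
  | add _ _ ih ih' => rw [map_add, ih, ih', add_zero]
  | smul c _ ih => rw [map_smul, ih, smul_zero]

variable {F : Finset ℤ}

/-- Every index that occurs lies in F, so the finite number operator counts all the ψ's; those
hidden in the vacuum are not seen, since it is annihilated on F. -/
theorem Level.numψ (hv₀ : A.IsVacuum F v₀) (h : A.Level v₀ F m n v) :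
    A.numψ F v = (n : ℂ) • v := by
  induction h with
  | vac =>
    rw [numψ_apply, Nat.cast_zero, zero_smul]
    exact Finset.sum_eq_zero fun q hq => by rw [hv₀.ψd q hq, map_zero]
  | @ψ m n v a ha hv ih =>
    have : ∀ q, A.ψ q (A.ψd q (A.ψ a v)) = (if q = a then A.ψ a v else 0)
        + A.ψ a (A.ψ q (A.ψd q v)) := fun q => by
      rw [A.ψd_ψ, map_sub, A.ψ_ψ q a (A.ψd q v), sub_neg_eq_add]
      split_ifs with h
      · rw [h]
      · rw [map_zero]
    rw [numψ_apply] at ih ⊢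
    rw [Finset.sum_congr rfl fun q _ => this q, Finset.sum_add_distrib, Finset.sum_ite_eq',
      if_pos (by exact ha), ← map_sum, ih, map_smul]
    push_cast
    rw [add_smul, one_smul, add_comm]
  | χ ha hv ih =>
    rw [numψ_apply] at ih ⊢
    simp only [A.ψd_χ, A.ψ_χ, ← map_sum, ih, map_smul]
  | zero => rw [map_zero, smul_zero]
  | add _ _ ih ih' => rw [map_add, ih, ih', smul_add]
  | smul c _ ih => rw [map_smul, ih, smul_comm]

theorem Level.numχ (hv₀ : A.IsVacuum F v₀) (h : A.Level v₀ F m n v) :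
    A.numχ F v = (m : ℂ) • v := by
  induction h with
  | vac =>
    rw [numχ_apply, Nat.cast_zero, zero_smul]
    exact Finset.sum_eq_zero fun q hq => by rw [hv₀.χd q hq, map_zero]
  | @χ m n v a ha hv ih =>
    have : ∀ q, A.χ q (A.χd q (A.χ a v)) = (if q = a then A.χ a v else 0)
        + A.χ a (A.χ q (A.χd q v)) := fun q => by
      rw [A.χd_χ, map_sub, A.χ_χ q a (A.χd q v), sub_neg_eq_add]
      split_ifs with h
      · rw [h]
      · rw [map_zero]
    rw [numχ_apply] at ih ⊢
    rw [Finset.sum_congr rfl fun q _ => this q, Finset.sum_add_distrib, Finset.sum_ite_eq',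
      if_pos (by exact ha), ← map_sum, ih, map_smul]
    push_cast
    rw [add_smul, one_smul, add_comm]
  | ψ ha hv ih =>
    rw [numχ_apply] at ih ⊢
    simp only [← A.ψ_χd, ← A.ψ_χ, ← map_sum, ih, map_smul]
  | zero => rw [map_zero, smul_zero]
  | add _ _ ih ih' => rw [map_add, ih, ih', smul_add]
  | smul c _ ih => rw [map_smul, ih, smul_comm]

theorem Level.contr (hv₀ : A.IsVacuum F v₀) (h : A.Level v₀ F (m + 1) (n + 1) v) :
    A.Level v₀ F m n (A.contr F v) := by
  rw [contr_apply]
  exact .sum fun q hq => (((h.ψd_and (hv₀.ψd q hq)).1 n rfl).χd_and (hv₀.χd q hq)).1 m rfl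

theorem Level.contr_of_right (hv₀ : A.IsVacuum F v₀) (h : A.Level v₀ F m 0 v) :
    A.contr F v = 0 := by
  rw [contr_apply]
  exact Finset.sum_eq_zero fun q hq => by rw [(h.ψd_and (hv₀.ψd q hq)).2 rfl, map_zero]

theorem Level.contr_of_left (hv₀ : A.IsVacuum F v₀) (h : A.Level v₀ F 0 n v) :
    A.contr F v = 0 := by
  rw [contr_apply]
  exact Finset.sum_eq_zero fun q hq => by
    rw [← A.ψd_χd, (h.χd_and (hv₀.χd q hq)).2 rfl, map_zero]

/-- A vector is determined by its complete contractions. -/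
theorem Level.eq_zero {τ : T →ₗ[ℂ] ℂ} (hτ : τ v₀ ≠ 0) (hv₀ : A.IsVacuum F v₀)
    (h : A.Level v₀ F m n v) (hv : v ∈ A.vanish τ F m n) : v = 0 := by
  induction n generalizing v with
  | succ n ih =>
    -- The vector is recovered from its annihilations by the number operator, whose eigenvalue n + 1
    -- is invertible.
    have h1 : ((n + 1 : ℕ) : ℂ) • v = 0 := by
      rw [← h.numψ hv₀, numψ_apply]
      refine Finset.sum_eq_zero fun q hq => ?_
      rw [ih ((h.ψd_and (hv₀.ψd q hq)).1 n rfl) (A.mem_vanish_succ_right.1 hv q hq), map_zero]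
    exact (smul_eq_zero.1 h1).resolve_left (Nat.cast_ne_zero.2 n.succ_ne_zero)
  | zero =>
    induction m generalizing v with
    | succ m ih =>
      have h1 : ((m + 1 : ℕ) : ℂ) • v = 0 := by
        rw [← h.numχ hv₀, numχ_apply]
        refine Finset.sum_eq_zero fun q hq => ?_
        rw [ih ((h.χd_and (hv₀.χd q hq)).1 m rfl) (A.mem_vanish_succ_left.1 hv q hq), map_zero]
      exact (smul_eq_zero.1 h1).resolve_left (Nat.cast_ne_zero.2 m.succ_ne_zero)
    | zero =>
      obtain ⟨c, rfl⟩ := h.eq_smul rfl rfl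
      rw [mem_vanish_zero, map_smul, smul_eq_mul, mul_eq_zero] at hv
      rw [hv.resolve_right hτ, zero_smul]

/-! #### Replacing an index by a new one -/

theorem E_eq_of_χd {p q : ℤ} (h : A.χd p v = 0) : A.E p q v = A.ψ p (A.ψd q v) := by
  rw [E_apply, h, map_zero, sub_zero]

theorem E_eq_of_ψd {p q : ℤ} (h : A.ψd p v = 0) : A.E q p v = -A.χ p (A.χd q v) := by
  rw [E_apply, h, map_zero, zero_sub]

/-- Expanding E_{qp} ψ_p ψd_q v with ψd_p v = 0 leaves ψ_q ψd_q v - χ_p ψ_p χd_q ψd_q v. Read in one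
direction this puts the new pair at p into a stable subspace; read in the other it rebuilds v from
vectors containing the new index p. -/
theorem numψ_eq_of_new {p : ℤ} (h : A.ψd p v = 0) :
    A.numψ F v = A.pair p (A.contr F v) + ∑ q ∈ F, A.E q p (A.ψ p (A.ψd q v)) := by
  rw [numψ_apply, contr_apply, map_sum, ← Finset.sum_add_distrib]
  refine Finset.sum_congr rfl fun q _ => ?_
  rw [E_apply, A.ψd_ψ, if_pos rfl, A.ψd_ψd, h, map_zero, neg_zero, map_zero, sub_zero,
    pair_apply, A.ψ_χd]
  abel

theorem numχ_eq_of_new {p : ℤ} (h : A.χd p v = 0) :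
    A.numχ F v = A.pair p (A.contr F v) - ∑ q ∈ F, A.E p q (A.χ p (A.χd q v)) := by
  rw [numχ_apply, contr_apply, map_sum, ← Finset.sum_sub_distrib]
  refine Finset.sum_congr rfl fun q _ => ?_
  rw [E_apply, A.χd_χ, if_pos rfl, A.χd_χd, h, map_zero, neg_zero, map_zero, sub_zero,
    pair_apply, A.ψd_χ, A.ψ_χ, A.ψd_χd]
  abel

/-- As χd_p v = 0, the vector ψ_p ψd_q v is just E_{pq} v. So `numψ_eq_of_new` expresses the new
pair through v and the vectors E_{qp} E_{pq} v. -/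
theorem pair_contr_mem {N : Submodule ℂ T} (hN : A.StableOn Z N) (hF : (F : Set ℤ) ⊆ Z) {p : ℤ}
    (hpZ : p ∈ Z) (hpF : p ∉ F) (hψ : A.ψd p v = 0) (hχ : A.χd p v = 0) {ν : ℂ}
    (hν : A.numψ F v = ν • v) (hv : v ∈ N) : A.pair p (A.contr F v) ∈ N := by
  rw [← sub_eq_of_eq_add (numψ_eq_of_new (F := F) hψ), hν]
  refine N.sub_mem (N.smul_mem _ hv) (N.sum_mem fun q hq => ?_)
  have hpq : p ≠ q := (ne_of_mem_of_not_mem hq hpF).symm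
  rw [← E_eq_of_χd hχ]
  exact hN q (hF hq) p hpZ hpq.symm _ (hN p hpZ q (hF hq) hpq v hv)

/-! #### Products of distinct factors -/

variable (A) in
/-- The vectors obtained from `v₀` by applying, in some order, `c` operators `χ p`, `s` operators
`ψ p` and `k` operators `pair p`, with distinct indices in `Z`. -/
inductive IsProd (v₀ : T) : Set ℤ → ℕ → ℕ → ℕ → T → Prop
  | vac (Z : Set ℤ) : IsProd v₀ Z 0 0 0 v₀
  | ψ {Z : Set ℤ} {c s k : ℕ} {x : T} {p : ℤ} (hp : p ∈ Z) (hx : IsProd v₀ (Z \ {p}) c s k x) :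
    IsProd v₀ Z c (s + 1) k (A.ψ p x)
  | χ {Z : Set ℤ} {c s k : ℕ} {x : T} {p : ℤ} (hp : p ∈ Z) (hx : IsProd v₀ (Z \ {p}) c s k x) :
    IsProd v₀ Z (c + 1) s k (A.χ p x)
  | pair {Z : Set ℤ} {c s k : ℕ} {x : T} {p : ℤ} (hp : p ∈ Z)
    (hx : IsProd v₀ (Z \ {p}) c s k x) : IsProd v₀ Z c s (k + 1) (A.pair p x)

variable {τ : T →ₗ[ℂ] ℂ} {N : Submodule ℂ T}

theorem exists_ψd_notMem_vanish {c s : ℕ} (h : v ∉ A.vanish τ F c (s + 1)) :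
    ∃ q ∈ F, A.ψd q v ∉ A.vanish τ F c s := by
  simpa only [mem_vanish_succ_right, not_forall, exists_prop,
    Finset.mem_coe] using h

theorem exists_χd_notMem_vanish {c s : ℕ} (h : v ∉ A.vanish τ F (c + 1) s) :
    ∃ q ∈ F, A.χd q v ∉ A.vanish τ F c s := by
  simpa only [mem_vanish_succ_left, not_forall, exists_prop,
    Finset.mem_coe] using h

/-- A non-zero contraction remains non-zero after a pair contraction, so some summand of the pair
contraction detects it. This raises the type of the contraction when no operator of the required
kind is left in it. -/
theorem IsInvariant.exists_notMem_vanish (h : A.IsInvariant τ) {c s : ℕ} {ν : ℂ}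
    (hν : A.numψ F v = ν • v) (hs : ν ≠ s) (hv : v ∉ A.vanish τ F c s) :
    ∃ q ∈ F, A.χd q (A.ψd q v) ∉ A.vanish τ F c s := by
  by_contra! h'
  refine hv ((h.contr_mem_vanish hν hs).1 ?_)
  rw [contr_apply]
  exact Submodule.sum_mem _ h'

/-- A stable subspace containing a vector with non-zero contraction contains all products with
new indices. -/
theorem IsProd.mem {Zp : Set ℤ} {c s k : ℕ} {x : T} (hx : A.IsProd v₀ Zp c s k x)
    (hτ : A.IsInvariant τ) (hv₀ : A.IsVacuum Z' v₀) (hZ : Z ⊆ Z') (hN : A.StableOn Z N)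
    (hF : (F : Set ℤ) ⊆ Z) (hZp : Zp ⊆ Z) (hdisj : Disjoint Zp F)
    (hm : m = c + k) (hn : n = s + k) (hL : A.Level v₀ F m n v) (hv : v ∈ N)
    {c' s' : ℕ} (hs : s' ≤ s) (hc : c' + s = c + s') (hvan : v ∉ A.vanish τ F c' s') : x ∈ N := by
  have hv₀F : A.IsVacuum F v₀ :=
    ⟨fun a ha => hv₀.ψd a (hZ (hF ha)), fun a ha => hv₀.χd a (hZ (hF ha))⟩
  induction hx generalizing Z N v m n c' s' with
  | vac Zp =>
    obtain rfl : s' = 0 := by omega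
    obtain rfl : c' = 0 := by omega
    obtain rfl : m = 0 := by omega
    obtain rfl : n = 0 := by omega
    obtain ⟨a, rfl⟩ := hL.eq_smul rfl rfl
    have ha : a ≠ 0 := by
      rintro rfl
      exact hvan (by rw [zero_smul]; exact Submodule.zero_mem _)
    exact (Submodule.smul_mem_iff _ ha).1 hv
  | @ψ Zp c s k x p hp hx ih =>
    have hpF : p ∉ F := Set.disjoint_left.1 hdisj hp
    have hχp := hL.χd_eq_zero (hv₀.χd p (hZ (hZp hp))) hpF
    -- The matrix unit E_{pq} replaces the index q of v by the new index p. So ψd_q v lies in the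
    -- preimage under ψ_p, and the task is to choose q keeping some contraction non-zero.
    have key : ∀ q ∈ F, A.ψd q v ∈ N.comap (A.ψ p) := fun q hq => by
      rw [Submodule.mem_comap, ← E_eq_of_χd hχp]
      exact hN p (hZp hp) q (hF hq) (ne_of_mem_of_not_mem hq hpF).symm v hv
    have hF' : (F : Set ℤ) ⊆ Z \ {p} := Set.subset_sdiff_singleton hF hpF
    have hZp' : Zp \ {p} ⊆ Z \ {p} := Set.sdiff_subset_sdiff_left hZp
    have hd' : Disjoint (Zp \ {p}) F := hdisj.mono_left Set.sdiff_subset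
    have hL' : ∀ q ∈ F, A.Level v₀ F m (s + k) (A.ψd q v) := fun q hq =>
      (hL.ψd_and (hv₀F.ψd q hq)).1 _ (by omega)
    rcases s' with - | s'
    -- The given contraction contains no ψd to spend. One is borrowed from a contracted pair, whose
    -- χd joins the type, so c' grows by one.
    · obtain ⟨q, hq, hq'⟩ := hτ.exists_notMem_vanish (hL.numψ hv₀F)
        (by rw [hn]; exact_mod_cast (by omega : s + 1 + k ≠ 0)) hvan
      exact ih (Set.sdiff_subset.trans hZ) (hN.comap_ψ p) hF' hZp' hd' hm rfl (hL' q hq)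
        (key q hq) (c' := c' + 1) (s' := 0) (Nat.zero_le _) (by omega)
        fun h => hq' (A.mem_vanish_succ_left.1 h q hq)
    · obtain ⟨q, hq, hq'⟩ := exists_ψd_notMem_vanish hvan
      exact ih (Set.sdiff_subset.trans hZ) (hN.comap_ψ p) hF' hZp' hd' hm rfl (hL' q hq)
        (key q hq) (by omega) (by omega) hq'
  | @χ Zp c s k x p hp hx ih =>
    have hpF : p ∉ F := Set.disjoint_left.1 hdisj hp
    have hψp := hL.ψd_eq_zero (hv₀.ψd p (hZ (hZp hp))) hpF
    have key : ∀ q ∈ F, A.χd q v ∈ N.comap (A.χ p) := fun q hq => by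
      rw [Submodule.mem_comap, ← N.neg_mem_iff, ← E_eq_of_ψd hψp]
      exact hN q (hF hq) p (hZp hp) (ne_of_mem_of_not_mem hq hpF) v hv
    have hF' : (F : Set ℤ) ⊆ Z \ {p} := Set.subset_sdiff_singleton hF hpF
    have hZp' : Zp \ {p} ⊆ Z \ {p} := Set.sdiff_subset_sdiff_left hZp
    have hd' : Disjoint (Zp \ {p}) F := hdisj.mono_left Set.sdiff_subset
    have hL' : ∀ q ∈ F, A.Level v₀ F (c + k) n (A.χd q v) := fun q hq =>
      (hL.χd_and (hv₀F.χd q hq)).1 _ (by omega)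
    rcases c' with - | c'
    -- With c' = 0 there is no χd to spend; it comes from a pair, whose ψd joins the type. The
    -- charge condition makes s' smaller than s, so the new s' is still allowed.
    · obtain ⟨q, hq, hq'⟩ := hτ.exists_notMem_vanish (hL.numψ hv₀F)
        (by rw [hn]; exact_mod_cast (by omega : s + k ≠ s')) hvan
      rw [← A.ψd_χd] at hq'
      exact ih (Set.sdiff_subset.trans hZ) (hN.comap_χ p) hF' hZp' hd' rfl hn (hL' q hq)
        (key q hq) (c' := 0) (s' := s' + 1) (by omega) (by omega)
        fun h => hq' (A.mem_vanish_succ_right.1 h q hq)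
    · obtain ⟨q, hq, hq'⟩ := exists_χd_notMem_vanish hvan
      exact ih (Set.sdiff_subset.trans hZ) (hN.comap_χ p) hF' hZp' hd' rfl hn (hL' q hq)
        (key q hq) (by omega) (by omega) hq'
  | @pair Zp c s k x p hp hx ih =>
    have hpF : p ∉ F := Set.disjoint_left.1 hdisj hp
    have hF' : (F : Set ℤ) ⊆ Z \ {p} := Set.subset_sdiff_singleton hF hpF
    have hZp' : Zp \ {p} ⊆ Z \ {p} := Set.sdiff_subset_sdiff_left hZp
    have hd' : Disjoint (Zp \ {p}) F := hdisj.mono_left Set.sdiff_subset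
    -- A pair factor of the product is matched by contracting a pair in v and creating a new one at
    -- p; the type of the non-zero contraction is unchanged.
    have hmem := pair_contr_mem hN hF (hZp hp) hpF
      (hL.ψd_eq_zero (hv₀.ψd p (hZ (hZp hp))) hpF) (hL.χd_eq_zero (hv₀.χd p (hZ (hZp hp))) hpF)
      (hL.numψ hv₀F) hv
    subst hm hn
    exact ih (Set.sdiff_subset.trans hZ) (hN.comap_pair p) hF' hZp' hd' rfl rfl (hL.contr hv₀F)
      hmem hs hc fun h => hvan ((hτ.contr_mem_vanish (hL.numψ hv₀F)
        (by exact_mod_cast (by omega : s + (k + 1) ≠ s'))).1 h)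

/-- A stable subspace containing the products with new indices and at least `r` unpaired factors of
the first kind contains all vectors whose contractions by fewer than `r` annihilation operators of
the first kind vanish. -/
theorem StableOn.mem_of_isProd {Zp : Set ℤ} (hN : A.StableOn Z N) (hτ : A.IsInvariant τ)
    (hτ₀ : τ v₀ ≠ 0) (hv₀ : A.IsVacuum Z v₀) (hZp : Zp ⊆ Z) (hinf : Zp.Infinite) {r : ℕ}
    (hprod : ∀ c s k x, c + k = m → s + k = n → r ≤ s → A.IsProd v₀ Zp c s k x → x ∈ N)
    (hF : (F : Set ℤ) ⊆ Z) (hL : A.Level v₀ F m n v)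
    (hvan : ∀ c, ∀ s < r, v ∈ A.vanish τ F c s) : v ∈ N := by
  induction n generalizing m Z Zp N v r with
  | succ n ih =>
    have hv₀F : A.IsVacuum F v₀ := ⟨fun a ha => hv₀.ψd a (hF ha), fun a ha => hv₀.χd a (hF ha)⟩
    rcases lt_or_ge (n + 1) r with hr | hr
    -- If r exceeds the number of ψ's, the complete contractions themselves are among those assumed
    -- zero.
    · rw [hL.eq_zero hτ₀ hv₀F (hvan _ _ hr)]
      exact N.zero_mem
    obtain ⟨p, hp, hpF⟩ := hinf.exists_notMem_finset F
    have hF' : (F : Set ℤ) ⊆ Z \ {p} := Set.subset_sdiff_singleton hF hpF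
    have hZp' : Zp \ {p} ⊆ Z \ {p} := Set.sdiff_subset_sdiff_left hZp
    have hinf' : (Zp \ {p}).Infinite := hinf.sdiff (Set.finite_singleton p)
    have hvac' : A.IsVacuum (Z \ {p}) v₀ :=
      ⟨fun a ha => hv₀.ψd a ha.1, fun a ha => hv₀.χd a ha.1⟩
    -- A positive multiple of v is the sum of a vector with a new pair at p and of images under
    -- E_{qp} of vectors with a new ψ at p; both have fewer old fermions of the first kind.
    have hsum := numψ_eq_of_new (F := F) (hL.ψd_eq_zero (hv₀.ψd p (hZp hp)) hpF)
    rw [hL.numψ hv₀F] at hsum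
    rw [← Submodule.smul_mem_iff N (Nat.cast_ne_zero (R := ℂ).2 n.succ_ne_zero), hsum]
    refine N.add_mem ?_ (N.sum_mem fun q hq => hN q (hF hq) p (hZp hp)
      (ne_of_mem_of_not_mem hq hpF) _ ?_)
    · rcases m with - | m
      · rw [hL.contr_of_left hv₀F, map_zero]
        exact N.zero_mem
      · rw [← Submodule.mem_comap]
        refine ih (hN.comap_pair p) hvac' hZp' hinf' (r := r) (m := m)
          (fun c s k x hc hs hr hx => ?_) hF' (hL.contr hv₀F) fun c s hs => ?_
        · exact hprod c s (k + 1) _ (by omega) (by omega) hr (.pair hp hx)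
        · exact (hτ.contr_mem_vanish (hL.numψ hv₀F)
            (by exact_mod_cast (by omega : n + 1 ≠ s))).2 (hvan c s hs)
    · rw [← Submodule.mem_comap]
      -- The ψ created at p counts as one of the r unpaired factors, and ψd_q uses up one of the
      -- contractions. The truncated value at r = 0 is harmless, there being no condition left.
      refine ih (hN.comap_ψ p) hvac' hZp' hinf' (r := r - 1) (m := m)
          (fun c s k x hc hs hr hx => ?_) hF' ((hL.ψd_and (hv₀F.ψd q hq)).1 n rfl)
          fun c s hs => ?_
      · exact hprod c (s + 1) k _ (by omega) (by omega) (by omega) (.ψ hp hx)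
      · exact A.mem_vanish_succ_right.1 (hvan c (s + 1) (by omega)) q hq
  | zero =>
    rcases r.eq_zero_or_pos with rfl | hr
    swap
    · rw [hL.eq_zero hτ₀ ⟨fun a ha => hv₀.ψd a (hF ha), fun a ha => hv₀.χd a (hF ha)⟩
        (hvan _ _ hr)]
      exact N.zero_mem
    clear hvan
    induction m generalizing Z Zp N v with
    | zero =>
      obtain ⟨a, rfl⟩ := hL.eq_smul rfl rfl
      exact N.smul_mem _ (hprod 0 0 0 _ rfl rfl le_rfl (.vac _))
    | succ m ih =>
      have hv₀F : A.IsVacuum F v₀ :=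
        ⟨fun a ha => hv₀.ψd a (hF ha), fun a ha => hv₀.χd a (hF ha)⟩
      obtain ⟨p, hp, hpF⟩ := hinf.exists_notMem_finset F
      have hF' : (F : Set ℤ) ⊆ Z \ {p} := Set.subset_sdiff_singleton hF hpF
      have hZp' : Zp \ {p} ⊆ Z \ {p} := Set.sdiff_subset_sdiff_left hZp
      have hinf' : (Zp \ {p}).Infinite := hinf.sdiff (Set.finite_singleton p)
      have hvac' : A.IsVacuum (Z \ {p}) v₀ :=
        ⟨fun a ha => hv₀.ψd a ha.1, fun a ha => hv₀.χd a ha.1⟩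
      -- With no ψ left, the pair term is zero and only the fermions of the second kind have to be
      -- moved.
      have hsum := numχ_eq_of_new (F := F) (hL.χd_eq_zero (hv₀.χd p (hZp hp)) hpF)
      rw [hL.numχ hv₀F, hL.contr_of_right hv₀F, map_zero, zero_sub] at hsum
      rw [← Submodule.smul_mem_iff N (Nat.cast_ne_zero (R := ℂ).2 m.succ_ne_zero), hsum]
      refine N.neg_mem (N.sum_mem fun q hq => hN p (hZp hp) q (hF hq)
        (ne_of_mem_of_not_mem hq hpF).symm _ ?_)
      rw [← Submodule.mem_comap]
      exact ih (hN.comap_χ p) hvac' hZp' hinf' hF' ((hL.χd_and (hv₀F.χd q hq)).1 m rfl)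
        fun c s k x hc hs hr hx => hprod (c + 1) s k _ (by omega) hs hr (.χ hp hx)

/-- A stable subspace containing a vector with a non-zero contraction by `r` annihilation operators
of the first kind contains all vectors of the same level whose contractions by fewer than `r`
such operators vanish. -/
theorem StableOn.mem_of_notMem_vanish (hN : A.StableOn Z N) (hτ : A.IsInvariant τ)
    (hτ₀ : τ v₀ ≠ 0) (hv₀ : A.IsVacuum Z v₀) (hinf : Z.Infinite) {c r : ℕ} {y : T}
    (hy : A.Level v₀ Z m n y) (hyN : y ∈ N) (hyv : y ∉ A.vanish τ Z c r) (hc : m + r = n + c)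
    (hL : A.Level v₀ Z m n v)
    (hvan : ∀ c', ∀ s < r, m + s = n + c' → v ∈ A.vanish τ Z c' s) : v ∈ N := by
  classical
  obtain ⟨F₁, hF₁, hy₁⟩ := hy.exists_finset
  obtain ⟨F₂, hF₂, hy₂⟩ := A.exists_finset_notMem_vanish hyv
  obtain ⟨F, hF, hLF⟩ := hL.exists_finset
  have hsub : ((F₁ ∪ F₂ : Finset ℤ) : Set ℤ) ⊆ Z := by simp [hF₁, hF₂]
  -- The new indices must avoid both the indices of y and those detecting its non-zero contraction.
  refine hN.mem_of_isProd hτ hτ₀ hv₀ Set.sdiff_subset (hinf.sdiff (F₁ ∪ F₂).finite_toSet) (r := r)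
    (fun c' s k x hm hn hs hx => ?_) hF hLF fun c' s hs => ?_
  · exact hx.mem hτ hv₀ subset_rfl hN hsub Set.sdiff_subset Set.disjoint_sdiff_left hm.symm hn.symm
      (hy₁.mono (by simp)) hyN hs (by omega) fun h => hy₂ (A.vanish_anti (by simp) c r h)
  · have hv₀F : A.IsVacuum F v₀ := ⟨fun a ha => hv₀.ψd a (hF ha), fun a ha => hv₀.χd a (hF ha)⟩
    by_cases h : m + s = n + c'
    · exact A.vanish_anti hF _ _ (hvan c' s hs h)
    · exact hτ.mem_vanish_of_charge_ne (hLF.numχ hv₀F) (hLF.numψ hv₀F) (by exact_mod_cast h)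

end FermionPair

/-! ### Constructions of commuting pairs of fermions -/

namespace FermionPair

variable {T T' : Type*} [AddCommGroup T] [Module ℂ T] [AddCommGroup T'] [Module ℂ T']

/-- Only the annihilation operators and the functionals enter `vanish`, so compatibility with
creation is not needed. This compares contractions on a product with those on its factors. -/
theorem mem_vanish_map_iff {A : FermionPair T} {A' : FermionPair T'} (f : T →ₗ[ℂ] T')
    (hψ : ∀ a v, f (A.ψd a v) = A'.ψd a (f v)) (hχ : ∀ a v, f (A.χd a v) = A'.χd a (f v))
    {τ : T →ₗ[ℂ] ℂ} {τ' : T' →ₗ[ℂ] ℂ} (hτ : ∀ v, τ' (f v) = 0 ↔ τ v = 0) {Z : Set ℤ} {c s : ℕ}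
    {v : T} : f v ∈ A'.vanish τ' Z c s ↔ v ∈ A.vanish τ Z c s := by
  induction s generalizing v with
  | succ s ih =>
    simp only [mem_vanish_succ_right]
    exact forall₂_congr fun q _ => by rw [← hψ, ih]
  | zero =>
    induction c generalizing v with
    | succ c ih =>
      simp only [mem_vanish_succ_left]
      exact forall₂_congr fun q _ => by rw [← hχ, ih]
    | zero => simp only [mem_vanish_zero, hτ]

/-- The diagonal pair of fermions on a product. -/
def prod (A : FermionPair T) (A' : FermionPair T') : FermionPair (T × T') where
  ψ a := (A.ψ a).prodMap (A'.ψ a)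
  ψd a := (A.ψd a).prodMap (A'.ψd a)
  χ a := (A.χ a).prodMap (A'.χ a)
  χd a := (A.χd a).prodMap (A'.χd a)
  ψ_ψ a b v := Prod.ext (A.ψ_ψ a b v.1) (A'.ψ_ψ a b v.2)
  ψd_ψd a b v := Prod.ext (A.ψd_ψd a b v.1) (A'.ψd_ψd a b v.2)
  ψd_ψ a b v := Prod.ext ((A.ψd_ψ a b v.1).trans (by split_ifs <;> rfl))
    ((A'.ψd_ψ a b v.2).trans (by split_ifs <;> rfl))
  χ_χ a b v := Prod.ext (A.χ_χ a b v.1) (A'.χ_χ a b v.2)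
  χd_χd a b v := Prod.ext (A.χd_χd a b v.1) (A'.χd_χd a b v.2)
  χd_χ a b v := Prod.ext ((A.χd_χ a b v.1).trans (by split_ifs <;> rfl))
    ((A'.χd_χ a b v.2).trans (by split_ifs <;> rfl))
  ψ_χ a b v := Prod.ext (A.ψ_χ a b v.1) (A'.ψ_χ a b v.2)
  ψ_χd a b v := Prod.ext (A.ψ_χd a b v.1) (A'.ψ_χd a b v.2)
  ψd_χ a b v := Prod.ext (A.ψd_χ a b v.1) (A'.ψd_χ a b v.2)
  ψd_χd a b v := Prod.ext (A.ψd_χd a b v.1) (A'.ψd_χd a b v.2)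

/-- The difference is taken so that a pair (v, y) has vanishing contractions exactly when those of v
and y agree. -/
theorem IsInvariant.prod {A : FermionPair T} {A' : FermionPair T'} {τ : T →ₗ[ℂ] ℂ}
    {τ' : T' →ₗ[ℂ] ℂ} (h : A.IsInvariant τ) (h' : A'.IsInvariant τ') :
    (A.prod A').IsInvariant (τ ∘ₗ LinearMap.fst ℂ T T' - τ' ∘ₗ LinearMap.snd ℂ T T') where
  ψ a v := congrArg₂ (· - ·) (h.ψ a v.1) (h'.ψ a v.2)
  χ a v := congrArg₂ (· - ·) (h.χ a v.1) (h'.χ a v.2)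

end FermionPair

/-- Fermionic creation operators `c a` and annihilation operators `d a`. -/
structure Fermion (X : Type*) [AddCommGroup X] [Module ℂ X] where
  /-- creation operators -/
  c : ℤ → Module.End ℂ X
  /-- annihilation operators -/
  d : ℤ → Module.End ℂ X
  c_c : ∀ a b v, c a (c b v) = -c b (c a v)
  d_d : ∀ a b v, d a (d b v) = -d b (d a v)
  d_c : ∀ a b v, d a (c b v) = (if a = b then v else 0) - c b (d a v)

section Tensor

variable {X Y : Type*} [AddCommGroup X] [Module ℂ X] [AddCommGroup Y] [Module ℂ Y]

/-- The operators of `F` on the first factor, with signs, and those of `G` on the second. -/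
def Fermion.tensor (F : Fermion X) (G : Fermion Y) : FermionPair (X ⊗[ℂ] Y) where
  ψ a := (G.c a).lTensor X
  ψd a := (G.d a).lTensor X
  χ a := (-1 : ℂ) ^ a • (F.c a).rTensor Y
  χd a := (-1 : ℂ) ^ a • (F.d a).rTensor Y
  ψ_ψ a b v := by
    induction v using TensorProduct.induction_on with
    | zero => simp
    | tmul x y => simp [G.c_c a b, TensorProduct.tmul_neg]
    | add v w hv hw => simp only [map_add, hv, hw, neg_add]
  ψd_ψd a b v := by
    induction v using TensorProduct.induction_on with
    | zero => simp
    | tmul x y => simp [G.d_d a b, TensorProduct.tmul_neg]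
    | add v w hv hw => simp only [map_add, hv, hw, neg_add]
  ψd_ψ a b v := by
    induction v using TensorProduct.induction_on with
    | zero => simp
    | tmul x y =>
      simp only [LinearMap.lTensor_tmul, G.d_c, TensorProduct.tmul_sub]
      split_ifs <;> simp
    | add v w hv hw =>
      simp only [map_add, hv, hw]
      split_ifs <;> abel
  χ_χ a b v := by
    induction v using TensorProduct.induction_on with
    | zero => simp
    | tmul x y => simp [F.c_c a b, TensorProduct.neg_tmul, smul_comm ((-1 : ℂ) ^ a)]
    | add v w hv hw => simp only [map_add, hv, hw, neg_add]
  χd_χd a b v := by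
    induction v using TensorProduct.induction_on with
    | zero => simp
    | tmul x y => simp [F.d_d a b, TensorProduct.neg_tmul, smul_comm ((-1 : ℂ) ^ a)]
    | add v w hv hw => simp only [map_add, hv, hw, neg_add]
  χd_χ a b v := by
    induction v using TensorProduct.induction_on with
    | zero => simp
    | tmul x y =>
      simp only [LinearMap.smul_apply, map_smul, LinearMap.rTensor_tmul, F.d_c,
        TensorProduct.sub_tmul, smul_sub]
      split_ifs with h
      · subst h
        rw [smul_smul, ← mul_zpow, neg_one_mul, neg_neg, one_zpow, one_smul,
          smul_comm]
      · rw [TensorProduct.zero_tmul, smul_zero, smul_zero, smul_comm]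
    | add v w hv hw =>
      simp only [map_add, hv, hw]
      split_ifs <;> abel
  ψ_χ a b v := by
    induction v using TensorProduct.induction_on with
    | zero => simp
    | tmul x y => simp
    | add v w hv hw => simp only [map_add, hv, hw]
  ψ_χd a b v := by
    induction v using TensorProduct.induction_on with
    | zero => simp
    | tmul x y => simp
    | add v w hv hw => simp only [map_add, hv, hw]
  ψd_χ a b v := by
    induction v using TensorProduct.induction_on with
    | zero => simp
    | tmul x y => simp
    | add v w hv hw => simp only [map_add, hv, hw]
  ψd_χd a b v := by
    induction v using TensorProduct.induction_on with
    | zero => simp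
    | tmul x y => simp
    | add v w hv hw => simp only [map_add, hv, hw]

variable (F : Fermion X) (G : Fermion Y)

theorem Fermion.tensor_ψ_tmul (a : ℤ) (x : X) (y : Y) :
    (F.tensor G).ψ a (x ⊗ₜ y) = x ⊗ₜ G.c a y := rfl

theorem Fermion.tensor_ψd_tmul (a : ℤ) (x : X) (y : Y) :
    (F.tensor G).ψd a (x ⊗ₜ y) = x ⊗ₜ G.d a y := rfl

theorem Fermion.tensor_χ_tmul (a : ℤ) (x : X) (y : Y) :
    (F.tensor G).χ a (x ⊗ₜ y) = (-1 : ℂ) ^ a • F.c a x ⊗ₜ y := rfl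

theorem Fermion.tensor_χd_tmul (a : ℤ) (x : X) (y : Y) :
    (F.tensor G).χd a (x ⊗ₜ y) = (-1 : ℂ) ^ a • F.d a x ⊗ₜ y := rfl

/-- The signs (-1)^a in `χ` and `χd` combine to the factor in the definition of V^∨, so `E a b` is
the matrix unit on the tensor product. -/
theorem Fermion.tensor_E_tmul (a b : ℤ) (x : X) (y : Y) :
    (F.tensor G).E a b (x ⊗ₜ y)
      = (-(-1 : ℂ) ^ (a + b) • F.c b (F.d a x)) ⊗ₜ y + x ⊗ₜ G.c a (G.d b y) := by
  rw [FermionPair.E_apply, tensor_ψd_tmul, tensor_ψ_tmul, tensor_χd_tmul,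
    map_smul, tensor_χ_tmul, smul_smul, ← zpow_add₀ (by norm_num), TensorProduct.smul_tmul',
    neg_smul, TensorProduct.neg_tmul]
  abel

theorem Fermion.isInvariant_tensor {β : X →ₗ[ℂ] Y →ₗ[ℂ] ℂ}
    (h : ∀ a x y, β x (G.c a y) = (-1 : ℂ) ^ a * β (F.d a x) y)
    (h' : ∀ a x y, β (F.c a x) y = (-1 : ℂ) ^ a * β x (G.d a y)) :
    (F.tensor G).IsInvariant (TensorProduct.lift β) where
  ψ a v := by
    induction v using TensorProduct.induction_on with
    | zero => simp
    | tmul x y => simp [tensor_ψ_tmul, tensor_χd_tmul, h]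
    | add v w hv hw => simp only [map_add, hv, hw]
  χ a v := by
    induction v using TensorProduct.induction_on with
    | zero => simp
    | tmul x y =>
      rw [tensor_χ_tmul, tensor_ψd_tmul, map_smul, TensorProduct.lift.tmul,
        TensorProduct.lift.tmul, h', smul_eq_mul, ← mul_assoc, ← mul_zpow, neg_one_mul, neg_neg,
        one_zpow, one_mul]
    | add v w hv hw => simp only [map_add, hv, hw]

theorem Fermion.isVacuum_tensor {Z : Set ℤ} {x : X} {y : Y} (hx : ∀ a ∈ Z, F.d a x = 0)
    (hy : ∀ a ∈ Z, G.d a y = 0) : (F.tensor G).IsVacuum Z (x ⊗ₜ y) where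
  ψd a ha := by rw [tensor_ψd_tmul, hy a ha, TensorProduct.tmul_zero]
  χd a ha := by rw [tensor_χd_tmul, hx a ha, TensorProduct.zero_tmul, smul_zero]

end Tensor

/-! ### Matrix units -/

section MatrixUnits

attribute [local instance] LieRing.ofAssociativeRing

/-- The matrix unit in position `(a, b)`. -/
def matEnd (a b : ℤ) : Module.End ℂ V := u.constr ℂ fun k => if k = b then u a else 0

theorem matEnd_u (a b k : ℤ) : matEnd a b (u k) = if k = b then u a else 0 := by
  rw [matEnd, Module.Basis.constr_basis]

theorem matEnd_apply (a b : ℤ) (v : V) : matEnd a b v = u.repr v b • u a := by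
  have : matEnd a b = (u.coord b).smulRight (u a) := u.ext fun k => by
    rw [matEnd_u]
    simp [Finsupp.single_apply]
  rw [this]
  rfl

theorem entry_matEnd (a b i j : ℤ) : entry (matEnd a b) i j = if i = a ∧ j = b then 1 else 0 := by
  rw [entry, matEnd_u]
  by_cases hj : j = b <;> by_cases hi : i = a <;> simp [hi, hj]

/-- The off-diagonal matrix units, as elements of `sl(∞)`. -/
def matUnit {a b : ℤ} (h : a ≠ b) : slInf :=
  ⟨matEnd a b, (Set.finite_singleton b).subset fun k hk => by
    by_contra h'
    exact hk (by rw [matEnd_u, if_neg (by exact h')]), by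
    rw [trace]
    exact finsum_eq_zero_of_forall_eq_zero fun i => by
      rw [entry_matEnd, if_neg]
      rintro ⟨rfl, h'⟩
      exact h h'⟩

theorem coe_matUnit {a b : ℤ} (h : a ≠ b) : (matUnit h : slInf).1 = matEnd a b := rfl

theorem matEnd_commutator (a b : ℤ) :
    matEnd a b * matEnd b a - matEnd b a * matEnd a b = matEnd a a - matEnd b b := by
  refine u.ext fun k => ?_
  simp only [LinearMap.sub_apply, Module.End.mul_apply, matEnd_u]
  split_ifs <;> simp_all [matEnd_u]

/-- The off-diagonal matrix units generate `sl(∞)`. -/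
theorem eq_top_of_matUnit_mem {K : LieSubalgebra ℂ slInf}
    (h : ∀ a b (hab : a ≠ b), matUnit hab ∈ K) : K = ⊤ := by
  classical
  refine eq_top_iff.2 fun x _ => ?_
  let P : Submodule ℂ (Module.End ℂ V) := K.toSubmodule.map slInf.toSubmodule.subtype
  have hP : ∀ {y : slInf}, y.1 ∈ P → y ∈ K := by
    rintro y ⟨z, hz, hzy⟩
    obtain rfl : z = y := Subtype.ext hzy
    exact hz
  have hoff : ∀ a b, a ≠ b → matEnd a b ∈ P := fun a b hab => ⟨_, h a b hab, rfl⟩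
  have hdiag : ∀ a b, matEnd a a - matEnd b b ∈ P := fun a b => by
    by_cases hab : a = b
    · rw [hab, sub_self]
      exact P.zero_mem
    · exact ⟨_, K.lie_mem (h a b hab) (h b a (Ne.symm hab)), matEnd_commutator a b⟩
  apply hP
  -- Finitely many columns are non-zero and each has finite support, so all non-zero entries lie in
  -- the square A × A.
  let A : Finset ℤ := supp x ∪ (supp x).biUnion fun j => (u.repr (x.1 (u j))).support
  have hcol : ∀ i j, j ∉ A → entry x.1 i j = 0 := fun i j hj => entry_eq_zero (by
    by_contra h'
    exact hj (Finset.mem_union_left _ (x.2.1.mem_toFinset.2 h'))) i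
  have hrow : ∀ i j, i ∉ A → entry x.1 i j = 0 := fun i j hi => by
    by_contra h'
    refine hi (Finset.mem_union_right _ (Finset.mem_biUnion.2 ⟨j, ?_, ?_⟩))
    · exact x.2.1.mem_toFinset.2 fun h => h' (entry_eq_zero h i)
    · exact Finsupp.mem_support_iff.2 h'
  have htr : ∑ i ∈ A, entry x.1 i i = 0 := by
    rw [← x.2.2, trace, finsum_eq_sum_of_support_subset]
    intro i hi
    by_contra h'
    exact hi (hcol i i h')
  -- The reference index 0 is arbitrary: subtracting it on the diagonal changes the sum by the trace
  -- times one matrix unit, that is, by zero.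
  have hx : x.1 = ∑ i ∈ A, ∑ j ∈ A, entry x.1 i j •
      (if i = j then matEnd i i - matEnd 0 0 else matEnd i j) := by
    have h1 : ∀ i ∈ A, ∑ j ∈ A, entry x.1 i j •
        (if i = j then matEnd i i - matEnd 0 0 else matEnd i j)
        = ∑ j ∈ A, entry x.1 i j • matEnd i j - entry x.1 i i • matEnd 0 0 := fun i hi => by
      rw [← Finset.add_sum_erase _ _ hi, ← Finset.add_sum_erase _ _ hi, if_pos rfl, smul_sub]
      rw [Finset.sum_congr rfl fun j hj => by rw [if_neg (Finset.ne_of_mem_erase hj).symm]]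
      abel
    rw [Finset.sum_congr rfl h1, Finset.sum_sub_distrib, ← Finset.sum_smul, htr, zero_smul,
      sub_zero]
    refine u.ext fun k => u.repr.injective (Finsupp.ext fun l => ?_)
    simp only [LinearMap.sum_apply, LinearMap.smul_apply, map_sum, map_smul,
      Finsupp.finsetSum_apply, Finsupp.smul_apply]
    change entry x.1 l k = ∑ i ∈ A, ∑ j ∈ A, entry x.1 i j * entry (matEnd i j) l k
    simp only [entry_matEnd, mul_ite, mul_one, mul_zero, ite_and]
    by_cases hl : l ∈ A
    · by_cases hk : k ∈ A
      · simp [hl, hk]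
      · simp [hk, hcol]
    · simp [hl, hrow]
  rw [hx]
  refine P.sum_mem fun i _ => P.sum_mem fun j _ => P.smul_mem _ ?_
  split_ifs with hij
  exacts [hdiag i 0, hoff i j hij]

theorem twist_matUnit {a b : ℤ} (h : a ≠ b) :
    twist (matUnit h) = (-(-1 : ℂ) ^ (a + b)) • matUnit h.symm := by
  refine Subtype.ext (end_ext fun i j => ?_)
  change entry (twistEnd (matUnit h)) i j = entry ((-(-1 : ℂ) ^ (a + b)) • matEnd b a) i j
  rw [entry_twistEnd, entry_smul, coe_matUnit, entry_matEnd, entry_matEnd]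
  by_cases h' : i = b ∧ j = a
  · rw [if_pos h', if_pos h'.symm, h'.1, h'.2, add_comm b]
  · rw [if_neg h', if_neg fun h => h' h.symm, mul_zero, mul_zero]

variable {M : Type*} [AddCommGroup M] [Module ℂ M] [LieRingModule slInf M] [LieModule ℂ slInf M]

/-- A relation between vectors compatible with the off-diagonal matrix units is compatible with
`sl(∞)`. -/
theorem lie_rel_of_matUnit {M' : Type*} [AddCommGroup M'] [Module ℂ M'] [LieRingModule slInf M']
    [LieModule ℂ slInf M'] (P : Submodule ℂ (M × M'))
    (hP : ∀ a b (hab : a ≠ b) v, v ∈ P → (⁅(matUnit hab : slInf), v.1⁆, ⁅matUnit hab, v.2⁆) ∈ P)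
    (x : slInf) {v : M × M'} (hv : v ∈ P) : (⁅x, v.1⁆, ⁅x, v.2⁆) ∈ P := by
  -- The elements preserving the relation form a Lie subalgebra, so only generators have to be
  -- tested.
  let K : LieSubalgebra ℂ slInf :=
    { carrier := {x | ∀ v ∈ P, (⁅x, v.1⁆, ⁅x, v.2⁆) ∈ P}
      add_mem' := fun {x y} hx hy v hv => by
        rw [add_lie, add_lie]
        exact P.add_mem (hx v hv) (hy v hv)
      zero_mem' := fun v _ => by
        rw [zero_lie, zero_lie]
        exact P.zero_mem
      smul_mem' := fun c x hx v hv => by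
        rw [smul_lie, smul_lie]
        exact P.smul_mem c (hx v hv)
      lie_mem' := fun {x y} hx hy v hv => by
        rw [lie_lie, lie_lie]
        exact P.sub_mem (hx _ (hy v hv)) (hy _ (hx v hv)) }
  have hK : K = ⊤ := eq_top_of_matUnit_mem fun a b hab v hv => hP a b hab v hv
  have hx : x ∈ K := hK ▸ LieSubalgebra.mem_top x
  exact hx v hv

/-- A subspace stable under the off-diagonal matrix units is a submodule. -/
def lieSubmoduleOfMatUnit (P : Submodule ℂ M)
    (hP : ∀ a b (hab : a ≠ b), ∀ v ∈ P, ⁅(matUnit hab : slInf), v⁆ ∈ P) :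
    LieSubmodule ℂ slInf M where
  toSubmodule := P
  lie_mem {x v} hv := (lie_rel_of_matUnit (P.prod P)
    (fun a b hab _ hv => ⟨hP a b hab _ hv.1, hP a b hab _ hv.2⟩) x (v := (v, v)) ⟨hv, hv⟩).1

end MatrixUnits

/-! ### The pair of fermions on the tensor square of the space of semi-infinite wedges -/

/-- The fermions on the space of semi-infinite wedges. -/
def fockFermion : Fermion FockAll where
  c := create
  d := annihilate
  c_c a b v := LinearMap.congr_fun (create_mul_create a b) v
  d_d a b v := LinearMap.congr_fun (annihilate_mul_annihilate a b) v
  d_c a b v := by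
    have h := LinearMap.congr_fun (annihilate_mul_create b a) v
    rw [Module.End.mul_apply, LinearMap.sub_apply, Module.End.mul_apply] at h
    rw [h]
    by_cases hab : a = b
    · simp [hab]
    · simp [hab, Ne.symm hab]

/-- The pair of fermions on the tensor square of the space of semi-infinite wedges. -/
abbrev fockPair : FermionPair (FockAll ⊗[ℂ] FockAll) := fockFermion.tensor fockFermion

/-! ### Invariant form on semi-infinite wedges -/

/-- The sum of the indices, normalised by removing those of the vacuum. -/
def indexSum (S : SemiInfinite) : ℤ :=
  ∑ᶠ i ∈ S.carrier ∩ Set.Ici 0, i - ∑ᶠ i ∈ Set.Iio 0 \ S.carrier, i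

theorem indexSum_insert {a : ℤ} {S : SemiInfinite} (ha : a ∉ S.carrier) :
    indexSum (S.insert a) = indexSum S + a := by
  have h : (S.insert a).carrier = Insert.insert a S.carrier := rfl
  rw [indexSum, indexSum, h]
  rcases lt_or_ge a 0 with h0 | h0
  · have h1 : Insert.insert a S.carrier ∩ Set.Ici 0 = S.carrier ∩ Set.Ici 0 :=
      Set.insert_inter_of_notMem (by simpa using h0)
    have h2 : Set.Iio 0 \ S.carrier = Insert.insert a (Set.Iio 0 \ Insert.insert a S.carrier) := by
      ext i
      by_cases hi : i = a
      · subst hi; simp [h0, ha]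
      · simp [hi]
    have h3 : (Set.Iio 0 \ Insert.insert a S.carrier).Finite := (S.insert a).finite_compl
    rw [h1, h2, finsum_mem_insert _ (by simp) h3]
    ring
  · have h1 : Set.Iio 0 \ Insert.insert a S.carrier = Set.Iio 0 \ S.carrier := by
      ext i
      by_cases hi : i = a
      · subst hi; simp [h0]
      · simp [hi]
    rw [h1, Set.insert_inter_of_mem (by simpa using h0),
      finsum_mem_insert _ (fun h => ha h.1) S.finite_nonneg]
    ring

open scoped Classical in
/-- The invariant bilinear form on semi-infinite wedges. -/
def fockForm : FockAll →ₗ[ℂ] FockAll →ₗ[ℂ] ℂ :=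
  semiWedge.constr ℂ fun I => semiWedge.constr ℂ fun J =>
    if I = J then (-1 : ℂ) ^ indexSum J else 0

open scoped Classical in
theorem fockForm_semiWedge (I J : SemiInfinite) :
    fockForm (semiWedge I) (semiWedge J) = if I = J then (-1 : ℂ) ^ indexSum J else 0 := by
  rw [fockForm, Module.Basis.constr_basis, Module.Basis.constr_basis]

theorem fockForm_comm (x y : FockAll) : fockForm x y = fockForm y x := by
  have : fockForm = fockForm.flip := semiWedge.ext fun I => semiWedge.ext fun J => by
    rw [LinearMap.flip_apply, fockForm_semiWedge, fockForm_semiWedge]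
    by_cases h : I = J
    · rw [h]
    · rw [if_neg h, if_neg (Ne.symm h)]
  rw [this, LinearMap.flip_apply, ← this]

/-- On basis vectors both sides live on I = J ∪ {a}. The reordering signs agree, since a is not
greater than itself, and the index sum of J ∪ {a} contributes the extra (-1)^a. -/
theorem fockForm_create_right (a : ℤ) (x y : FockAll) :
    fockForm x (create a y) = (-1 : ℂ) ^ a * fockForm (annihilate a x) y := by
  have : (fockForm.compl₂ (create a) : FockAll →ₗ[ℂ] FockAll →ₗ[ℂ] ℂ)
      = (-1 : ℂ) ^ a • (fockForm ∘ₗ annihilate a) :=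
    semiWedge.ext fun I => semiWedge.ext fun J => by
    change fockForm (semiWedge I) (create a (semiWedge J))
      = (-1 : ℂ) ^ a * fockForm (annihilate a (semiWedge I)) (semiWedge J)
    by_cases hJ : a ∈ J.carrier
    · rw [create_of_mem hJ, map_zero]
      by_cases hI : a ∈ I.carrier
      · rw [annihilate_of_mem hI, map_smul, LinearMap.smul_apply, fockForm_semiWedge, if_neg,
          smul_zero, mul_zero]
        rintro rfl
        exact hJ.2 rfl
      · rw [annihilate_of_notMem hI, map_zero, LinearMap.zero_apply, mul_zero]
    · rw [create_of_notMem hJ, map_smul, fockForm_semiWedge, indexSum_insert hJ]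
      by_cases hI : a ∈ I.carrier
      · rw [annihilate_of_mem hI, map_smul, LinearMap.smul_apply, fockForm_semiWedge]
        by_cases hIJ : I = J.insert a
        · subst hIJ
          rw [if_pos rfl, if_pos (SemiInfinite.erase_insert hJ), neg_one_pow_countAbove_insert hJ,
            if_neg (lt_irrefl a), zpow_add₀ (by norm_num)]
          simp only [smul_eq_mul]
          ring
        · rw [if_neg hIJ, if_neg, smul_zero, smul_zero, mul_zero]
          rintro rfl
          exact hIJ (SemiInfinite.insert_erase hI).symm
      · rw [annihilate_of_notMem hI, map_zero, LinearMap.zero_apply, mul_zero, if_neg, smul_zero]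
        rintro rfl
        exact hI (SemiInfinite.mem_insert.2 (Or.inl rfl))
  exact LinearMap.congr_fun (LinearMap.congr_fun this x) y

/-- The invariant functional on the tensor square of the space of semi-infinite wedges. -/
abbrev fockTrace : FockAll ⊗[ℂ] FockAll →ₗ[ℂ] ℂ := TensorProduct.lift fockForm

theorem isInvariant_fockTrace : fockPair.IsInvariant fockTrace :=
  Fermion.isInvariant_tensor _ _ fockForm_create_right fun a x y => by
    rw [fockForm_comm, fockForm_comm x]
    exact fockForm_create_right a y x

/-! ### Truncation of semi-infinite wedges at a finite depth -/

/-- The semi-infinite set of all integers less than `-M`. -/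
def deep (M : ℕ) : SemiInfinite where
  carrier := Set.Iio (-M)
  finite_nonneg := (Set.finite_empty).subset fun i hi => by
    have h1 : i < -M := hi.1
    have h2 : 0 ≤ i := hi.2
    omega
  finite_compl := (Set.finite_Ico (-M : ℤ) 0).subset fun i hi => ⟨not_lt.1 hi.2, hi.1⟩

theorem charge_deep (M : ℕ) : charge (deep M) = -M := by
  have h1 : (deep M).carrier ∩ Set.Ici 0 = ∅ := by
    refine Set.eq_empty_of_forall_notMem fun i hi => ?_
    have h1 : i < -M := hi.1
    have h2 : 0 ≤ i := hi.2
    omega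
  have h2 : Set.Iio 0 \ (deep M).carrier = Finset.Ico (-M : ℤ) 0 := by
    ext i
    simp only [deep, Set.mem_sdiff, Set.mem_Iio, Finset.coe_Ico, Set.mem_Ico]
    omega
  rw [charge, h1, h2, Set.ncard_empty, Set.ncard_coe_finset]
  simp

/-- The tensor square of the semi-infinite wedge with all indices less than `-M`. -/
def fockVac (M : ℕ) : FockAll ⊗[ℂ] FockAll := semiWedge (deep M) ⊗ₜ semiWedge (deep M)

theorem annihilate_deep (M : ℕ) {a : ℤ} (ha : a ∈ Set.Ici (-M : ℤ)) :
    annihilate a (semiWedge (deep M)) = 0 :=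
  annihilate_of_notMem fun h => not_lt.2 (Set.mem_Ici.1 ha) (Set.mem_Iio.1 h)

theorem isVacuum_fockVac (M : ℕ) : fockPair.IsVacuum (Set.Ici (-M : ℤ)) (fockVac M) :=
  Fermion.isVacuum_tensor _ _ (fun _ ha => annihilate_deep M ha) fun _ ha => annihilate_deep M ha

theorem fockTrace_fockVac (M : ℕ) : fockTrace (fockVac M) ≠ 0 := by
  rw [fockVac, TensorProduct.lift.tmul, fockForm_semiWedge, if_pos rfl]
  exact zpow_ne_zero _ (by norm_num)

theorem exists_finset_of_deep (S : SemiInfinite) :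
    ∃ M₀ : ℕ, ∀ M ≥ M₀, Set.Iio (-M : ℤ) ⊆ S.carrier := by
  obtain ⟨b, hb⟩ := S.finite_compl.bddBelow
  refine ⟨b.natAbs, fun M hM i hi => ?_⟩
  by_contra h
  have h1 : i < -M := hi
  have := hb ⟨by change i < 0; omega, h⟩
  omega

/-- Induction on semi-infinite sets containing all integers less than `-M`. -/
theorem SemiInfinite.deep_induction {M : ℕ} {p : SemiInfinite → ℕ → Prop} (h0 : p (deep M) 0)
    (h1 : ∀ S n, ∀ a ∈ Set.Ici (-M : ℤ), a ∉ S.carrier → p S n → p (S.insert a) (n + 1))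
    {S : SemiInfinite} (hS : Set.Iio (-M : ℤ) ⊆ S.carrier) {n : ℕ} (hn : (n : ℤ) = charge S + M) :
    p S n := by
  have hfin : (S.carrier ∩ Set.Ici (-M : ℤ)).Finite :=
    (S.finite_above (-M - 1)).subset fun i hi => ⟨hi.1, by
      have : -(M : ℤ) ≤ i := hi.2
      change -(M : ℤ) - 1 < i
      omega⟩
  obtain ⟨B, hB⟩ := hfin.exists_finset_coe
  induction B using Finset.strongInduction generalizing S n with
  | H B ih =>
  rcases B.eq_empty_or_nonempty with rfl | ⟨a, ha⟩
  · have hS' : S = deep M := SemiInfinite.ext (by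
      refine Set.Subset.antisymm (fun i hi => ?_) hS
      by_contra h
      have : i ∈ S.carrier ∩ Set.Ici (-M : ℤ) := ⟨hi, Set.mem_Ici.2 (not_lt.1 h)⟩
      rw [← hB] at this
      simp at this)
    subst hS'
    rw [charge_deep] at hn
    obtain rfl : n = 0 := by omega
    exact h0
  · have haS : a ∈ S.carrier ∩ Set.Ici (-M : ℤ) := hB ▸ Finset.mem_coe.2 ha
    have hsub : Set.Iio (-M : ℤ) ⊆ (S.erase a).carrier := fun i hi =>
      ⟨hS hi, fun h => not_lt.2 (Set.mem_Ici.1 haS.2)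
        (Set.mem_Iio.1 (Set.mem_singleton_iff.1 h ▸ hi))⟩
    have hB' : ((B.erase a : Finset ℤ) : Set ℤ) = (S.erase a).carrier ∩ Set.Ici (-M : ℤ) := by
      rw [Finset.coe_erase, hB]
      ext i
      simp only [SemiInfinite.erase, Set.mem_sdiff, Set.mem_inter_iff]
      tauto
    -- The missing negative integers lie in [-M, 0), so the charge is at least -M. Applied to S with
    -- a removed, this shows that n is positive.
    have hcard : ∀ {S : SemiInfinite} {B : Finset ℤ}, Set.Iio (-M : ℤ) ⊆ S.carrier →
        (B : Set ℤ) = S.carrier ∩ Set.Ici (-M : ℤ) → 0 ≤ charge S + M := by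
      intro S B hS hB
      have h1 : Set.Iio 0 \ S.carrier ⊆ Finset.Ico (-M : ℤ) 0 := fun i hi => by
        rw [Finset.coe_Ico]
        exact ⟨not_lt.1 fun h => hi.2 (hS h), hi.1⟩
      have h2 := Set.ncard_le_ncard h1 (Finset.finite_toSet _)
      rw [Set.ncard_coe_finset] at h2
      simp only [Int.card_Ico] at h2
      rw [charge]
      omega
    have h0 := hcard hsub hB'
    rw [charge_erase haS.1] at h0
    obtain ⟨k, rfl⟩ : ∃ k, n = k + 1 := ⟨n - 1, by omega⟩
    have := h1 (S.erase a) k a haS.2 (fun h => h.2 rfl)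
      (ih _ (Finset.erase_ssubset ha) hsub (by rw [charge_erase haS.1]; push_cast at hn; omega)
        ((hfin.subset (Set.inter_subset_inter_left _ Set.sdiff_subset))) hB')
    rwa [SemiInfinite.insert_erase haS.1] at this

theorem semiWedge_insert {a : ℤ} {S : SemiInfinite} (ha : a ∉ S.carrier) :
    semiWedge (S.insert a) = (-1 : ℂ) ^ countAbove a S • create a (semiWedge S) := by
  rw [create_of_notMem ha, smul_smul, ← mul_pow, neg_one_mul, neg_neg, one_pow, one_smul]

theorem level_semiWedge_tmul {M m n : ℕ} {I J : SemiInfinite} (hI : Set.Iio (-M : ℤ) ⊆ I.carrier)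
    (hJ : Set.Iio (-M : ℤ) ⊆ J.carrier) (hm : (m : ℤ) = charge I + M)
    (hn : (n : ℤ) = charge J + M) :
    fockPair.Level (fockVac M) (Set.Ici (-M : ℤ)) m n (semiWedge I ⊗ₜ semiWedge J) := by
  refine SemiInfinite.deep_induction (p := fun J n => fockPair.Level (fockVac M)
    (Set.Ici (-M : ℤ)) m n (semiWedge I ⊗ₜ semiWedge J)) ?_ (fun S n a ha haS hS => ?_) hJ hn
  · refine SemiInfinite.deep_induction (p := fun I m => fockPair.Level (fockVac M)
      (Set.Ici (-M : ℤ)) m 0 (semiWedge I ⊗ₜ semiWedge (deep M))) .vac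
      (fun S n a ha haS hS => ?_) hI hm
    have h := (FermionPair.Level.χ ha hS).smul ((-1 : ℂ) ^ countAbove a S * (-1) ^ a)
    rw [Fermion.tensor_χ_tmul, smul_smul, mul_assoc, ← mul_zpow, neg_one_mul, neg_neg, one_zpow,
      mul_one, TensorProduct.smul_tmul'] at h
    rw [semiWedge_insert haS]
    exact h
  · have h := (FermionPair.Level.ψ ha hS).smul ((-1 : ℂ) ^ countAbove a S)
    rw [Fermion.tensor_ψ_tmul, ← TensorProduct.tmul_smul] at h
    rw [semiWedge_insert haS]
    exact h

/-- Only finitely many wedges occur, and each contains all integers below some bound; beyond it,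
charge t means t + M creations over the vacuum of depth M. -/
theorem exists_level_tmul {t t' : ℤ} {x y : FockAll} (hx : x ∈ chargeSpace t)
    (hy : y ∈ chargeSpace t') : ∃ M₀ : ℕ, ∀ M ≥ M₀, ∀ m n : ℕ, (m : ℤ) = t + M → (n : ℤ) = t' + M →
      fockPair.Level (fockVac M) (Set.Ici (-M : ℤ)) m n (x ⊗ₜ y) := by
  induction hx using Submodule.span_induction with
  | mem x hx =>
    obtain ⟨I, rfl, rfl⟩ := hx
    induction hy using Submodule.span_induction with
    | mem y hy =>
      obtain ⟨J, rfl, rfl⟩ := hy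
      obtain ⟨M₁, h₁⟩ := exists_finset_of_deep I
      obtain ⟨M₂, h₂⟩ := exists_finset_of_deep J
      exact ⟨max M₁ M₂, fun M hM m n hm hn => level_semiWedge_tmul
        (h₁ M (le_trans (le_max_left _ _) hM)) (h₂ M (le_trans (le_max_right _ _) hM)) hm hn⟩
    | zero => exact ⟨0, fun M _ m n _ _ => by rw [TensorProduct.tmul_zero]; exact .zero _ _⟩
    | add y z _ _ ihy ihz =>
      obtain ⟨M₁, h₁⟩ := ihy
      obtain ⟨M₂, h₂⟩ := ihz
      refine ⟨max M₁ M₂, fun M hM m n hm hn => ?_⟩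
      rw [TensorProduct.tmul_add]
      exact (h₁ M (le_trans (le_max_left _ _) hM) m n hm hn).add
        (h₂ M (le_trans (le_max_right _ _) hM) m n hm hn)
    | smul c y _ ih =>
      obtain ⟨M₁, h₁⟩ := ih
      refine ⟨M₁, fun M hM m n hm hn => ?_⟩
      rw [TensorProduct.tmul_smul]
      exact (h₁ M hM m n hm hn).smul c
  | zero => exact ⟨0, fun M _ m n _ _ => by rw [TensorProduct.zero_tmul]; exact .zero _ _⟩
  | add y z _ _ ihy ihz =>
    obtain ⟨M₁, h₁⟩ := ihy
    obtain ⟨M₂, h₂⟩ := ihz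
    refine ⟨max M₁ M₂, fun M hM m n hm hn => ?_⟩
    rw [TensorProduct.add_tmul]
    exact (h₁ M (le_trans (le_max_left _ _) hM) m n hm hn).add
      (h₂ M (le_trans (le_max_right _ _) hM) m n hm hn)
  | smul c y _ ih =>
    obtain ⟨M₁, h₁⟩ := ih
    refine ⟨M₁, fun M hM m n hm hn => ?_⟩
    rw [← TensorProduct.smul_tmul']
    exact (h₁ M hM m n hm hn).smul c

/-! ### The inclusion of the tensor product of Fock spaces -/

theorem lie_fock_matUnit {a b : ℤ} (hab : a ≠ b) (f : FockAll) :
    ⁅(matUnit hab : slInf), f⁆ = create a (annihilate b f) := by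
  have h : supp (matUnit hab) ⊆ {b} := fun k hk => by
    rw [Finset.mem_singleton]
    by_contra h'
    exact (matUnit hab).2.1.mem_toFinset.1 hk (by rw [coe_matUnit, matEnd_u, if_neg h'])
  change fockEnd _ f = _
  rw [fockEnd_eq_sum _ h, Finset.sum_singleton, coe_matUnit, matEnd_u, if_pos rfl, wedge,
    Module.Basis.constr_basis]
  rfl

/-- The tensor product of the dual Fock space and the Fock space. -/
abbrev FockProd (t : ℤ) : Type := FockDual t ⊗[ℂ] Fock

/-- The inclusion of the dual Fock space into the space of semi-infinite wedges. -/
def fockDualIncl (t : ℤ) : FockDual t →ₗ[ℂ] FockAll := (chargeSpace t).subtype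

/-- The inclusion of the Fock space into the space of semi-infinite wedges. -/
def fockIncl : Fock →ₗ[ℂ] FockAll := (chargeSpace 0).subtype

/-- The inclusion of `FockProd t` into the tensor square of the space of semi-infinite wedges. -/
def fockProdIncl (t : ℤ) : FockProd t →ₗ[ℂ] FockAll ⊗[ℂ] FockAll :=
  TensorProduct.map (fockDualIncl t) fockIncl

theorem fockProdIncl_injective (t : ℤ) : Function.Injective (fockProdIncl t) :=
  TensorProduct.map_injective_of_flat_flat _ _ Subtype.val_injective Subtype.val_injective

/-- The twisted action of a matrix unit on the first factor is exactly the χ-part of `E a b`, by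
`tensor_E_tmul`. -/
theorem fockProdIncl_lie (t : ℤ) {a b : ℤ} (hab : a ≠ b) (v : FockProd t) :
    fockProdIncl t ⁅(matUnit hab : slInf), v⁆ = fockPair.E a b (fockProdIncl t v) := by
  induction v using TensorProduct.induction_on with
  | zero => rw [lie_zero, map_zero, map_zero]
  | add v w hv hw => rw [lie_add, map_add, hv, hw, map_add, map_add]
  | tmul x y =>
    rw [TensorProduct.LieModule.lie_tmul_right, map_add, fockProdIncl, TensorProduct.map_tmul,
      TensorProduct.map_tmul, TensorProduct.map_tmul, Fermion.tensor_E_tmul]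
    congr 2
    · change ⁅twist (matUnit hab), (fockDualIncl t x : FockAll)⁆ = _
      rw [twist_matUnit, smul_lie, lie_fock_matUnit]
      rfl
    · exact lie_fock_matUnit hab _

theorem exists_level_fockProdIncl (t : ℤ) (v : FockProd t) :
    ∃ M₀ : ℕ, ∀ M ≥ M₀, ∀ m n : ℕ, (m : ℤ) = t + M → n = M →
      fockPair.Level (fockVac M) (Set.Ici (-M : ℤ)) m n (fockProdIncl t v) := by
  induction v using TensorProduct.induction_on with
  | zero => exact ⟨0, fun M _ m n _ _ => by rw [map_zero]; exact .zero _ _⟩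
  | add v w hv hw =>
    obtain ⟨M₁, h₁⟩ := hv
    obtain ⟨M₂, h₂⟩ := hw
    refine ⟨max M₁ M₂, fun M hM m n hm hn => ?_⟩
    rw [map_add]
    exact (h₁ M (le_trans (le_max_left _ _) hM) m n hm hn).add
      (h₂ M (le_trans (le_max_right _ _) hM) m n hm hn)
  | tmul x y =>
    obtain ⟨M₀, h⟩ := exists_level_tmul (t := t) (t' := 0) (x := fockDualIncl t x)
      (y := fockIncl y) x.2 y.2
    exact ⟨M₀, fun M hM m n hm hn => h M hM m n hm (by rw [hn, zero_add])⟩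

/-! ### The filtration -/

/-- The subspace on which all contractions by `j + max t 0` annihilation operators of the second
and `j + max (-t) 0` of the first kind vanish. -/
def layerKer (t : ℤ) (j : ℕ) : Submodule ℂ (FockProd t) :=
  (fockPair.vanish fockTrace Set.univ (j + t.toNat) (j + (-t).toNat)).comap (fockProdIncl t)

theorem mem_layerKer {t : ℤ} {j : ℕ} {v : FockProd t} : v ∈ layerKer t j ↔
    fockProdIncl t v ∈ fockPair.vanish fockTrace Set.univ (j + t.toNat) (j + (-t).toNat) := Iff.rfl

/-- The filtration of the tensor product of Fock spaces. -/
def fockFilt (t : ℤ) (k : ℕ) : LieSubmodule ℂ slInf (FockProd t) :=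
  lieSubmoduleOfMatUnit (⨅ j, ⨅ (_ : j < k), layerKer t j) fun a b hab v hv => by
    simp only [Submodule.mem_iInf, mem_layerKer] at hv ⊢
    intro j hj
    rw [fockProdIncl_lie]
    exact isInvariant_fockTrace.E_mem_vanish (Set.mem_univ _) (Set.mem_univ _) (hv j hj)

theorem mem_fockFilt {t : ℤ} {k : ℕ} {v : FockProd t} :
    v ∈ fockFilt t k ↔ ∀ j < k, v ∈ layerKer t j := by
  change v ∈ (⨅ j, ⨅ (_ : j < k), layerKer t j) ↔ _
  simp only [Submodule.mem_iInf]

theorem fockFilt_zero (t : ℤ) : fockFilt t 0 = ⊤ :=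
  eq_top_iff.2 fun _ _ => mem_fockFilt.2 fun _ hj => absurd hj (Nat.not_lt_zero _)

theorem fockFilt_antitone (t : ℤ) : Antitone (fockFilt t) := fun _ _ h _ hv =>
  mem_fockFilt.2 fun j hj => mem_fockFilt.1 hv j (hj.trans_le h)

theorem mem_fockFilt_succ {t : ℤ} {k : ℕ} {v : FockProd t} :
    v ∈ fockFilt t (k + 1) ↔ v ∈ fockFilt t k ∧ v ∈ layerKer t k := by
  simp only [mem_fockFilt, Nat.forall_lt_succ_right]

/-- A vector is a finite wedge of some level (m, n) over a deep vacuum, and its contractions of type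
(m, n) determine it; for j large enough these are of the type defining `layerKer t j`. -/
theorem iInf_fockFilt (t : ℤ) : ⨅ k, fockFilt t k = ⊥ := by
  rw [eq_bot_iff]
  intro v hv
  rw [LieSubmodule.mem_bot]
  obtain ⟨M₀, hM⟩ := exists_level_fockProdIncl t v
  -- The level is written in the shape (j + max(t,0), j + max(-t,0)) with j = M - max(-t,0); adding
  -- |t| to the depth makes the truncated subtraction exact.
  have hL := hM (M₀ + t.natAbs) (by omega) (M₀ + t.natAbs - (-t).toNat + t.toNat)
    (M₀ + t.natAbs - (-t).toNat + (-t).toNat) (by omega) (by omega)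
  obtain ⟨F, hF, hLF⟩ := hL.exists_finset
  refine fockProdIncl_injective t ?_
  rw [map_zero]
  have hv' : v ∈ fockFilt t (M₀ + t.natAbs - (-t).toNat + 1) :=
    (iInf_le (fockFilt t) _ : _ ≤ _) hv
  have hvac := isVacuum_fockVac (M₀ + t.natAbs)
  exact hLF.eq_zero (fockTrace_fockVac _) ⟨fun a ha => hvac.ψd a (hF ha),
    fun a ha => hvac.χd a (hF ha)⟩
    (fockPair.vanish_anti (Set.subset_univ _) _ _ (mem_fockFilt_succ.1 hv').2)

/-- Truncating v and w at a common depth reduces this to `StableOn.mem_of_notMem_vanish`. -/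
theorem fockFilt_le_of_notMem {t : ℤ} {j : ℕ} {N : LieSubmodule ℂ slInf (FockProd t)}
    {v : FockProd t} (hv : v ∈ N) (hj : v ∉ layerKer t j) : fockFilt t j ≤ N := by
  intro w hw
  have hN : ∀ Z, fockPair.StableOn Z (N.toSubmodule.map (fockProdIncl t)) := by
    rintro Z a - b - hab _ ⟨x, hx, rfl⟩
    exact ⟨_, N.lie_mem hx, fockProdIncl_lie t hab x⟩
  obtain ⟨F, -, hF⟩ := fockPair.exists_finset_notMem_vanish hj
  obtain ⟨b, hb⟩ := F.bddBelow
  obtain ⟨M₁, h₁⟩ := exists_level_fockProdIncl t v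
  obtain ⟨M₂, h₂⟩ := exists_level_fockProdIncl t w
  -- Deep enough for both vectors, for t + M to be non-negative, and for the indices detecting the
  -- non-zero contraction of v to lie above the vacuum.
  let M := M₁ + M₂ + t.natAbs + b.natAbs
  have hFM : (F : Set ℤ) ⊆ Set.Ici (-M : ℤ) := fun a ha => by
    have := hb ha
    change -(M : ℤ) ≤ a
    omega
  obtain ⟨m, hm⟩ : ∃ m : ℕ, (m : ℤ) = t + M := ⟨(t + M).toNat, by omega⟩
  have key := (hN (Set.Ici (-M : ℤ))).mem_of_notMem_vanish isInvariant_fockTrace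
    (fockTrace_fockVac M) (isVacuum_fockVac M) (Set.Ici_infinite _)
    (h₁ M (by omega) m M hm rfl) ⟨v, hv, rfl⟩
    (fun h => hF (fockPair.vanish_anti hFM _ _ h)) (by omega) (h₂ M (by omega) m M hm rfl)
    fun c s hs hc => ?_
  · obtain ⟨x, hx, hxw⟩ := key
    rwa [← fockProdIncl_injective t hxw]
  -- The charge condition says c - s = t, so the type (c, s) belongs to the layer s - max(-t,0),
  -- which is smaller than j; no truncation occurs in the subtraction.
  · have := mem_fockFilt.1 hw (s - (-t).toNat) (by omega)
    rw [mem_layerKer, show s - (-t).toNat + t.toNat = c by omega,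
      show s - (-t).toNat + (-t).toNat = s by omega] at this
    exact fockPair.vanish_anti (Set.subset_univ _) _ _ this

/-- Some vector of N violates a layer condition with index j ≤ k, so N contains the j-th term and
with it the k-th. -/
theorem fockFilt_le {t : ℤ} {k : ℕ} {N : LieSubmodule ℂ slInf (FockProd t)}
    (h : ¬N ≤ fockFilt t (k + 1)) : fockFilt t k ≤ N := by
  obtain ⟨v, hv, hvk⟩ := SetLike.not_le_iff_exists.1 h
  rw [mem_fockFilt] at hvk
  push Not at hvk
  obtain ⟨j, hj, hvj⟩ := hvk
  exact (fockFilt_antitone t (by omega)).trans (fockFilt_le_of_notMem hv hvj)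

/-- The non-zero submodules are the terms of the filtration. -/
theorem exists_eq_fockFilt {t : ℤ} {N : LieSubmodule ℂ slInf (FockProd t)} (h : N ≠ ⊥) :
    ∃ r, N = fockFilt t r := by
  classical
  -- The terms intersect in zero, so N leaves the filtration at some first index r + 1; it is then
  -- contained in the r-th term and contains it.
  have hex : ∃ k, ¬N ≤ fockFilt t k := by
    by_contra! h'
    exact h (eq_bot_iff.2 ((le_iInf h').trans_eq (iInf_fockFilt t)))
  obtain ⟨r, hr⟩ : ∃ r, Nat.find hex = r + 1 := Nat.exists_eq_add_one_of_ne_zero fun h0 =>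
    Nat.find_spec hex (by rw [h0, fockFilt_zero]; exact le_top)
  refine ⟨r, le_antisymm ?_ (fockFilt_le (hr ▸ Nat.find_spec hex))⟩
  by_contra h'
  exact Nat.find_min hex (by omega) h'

/-! ### Fermions on exterior algebras -/

section Exterior

variable {X : Type*} [AddCommGroup X] [Module ℂ X]

/-- Contraction with a linear form on the exterior algebra. -/
def contractForm : Module.Dual ℂ X →ₗ[ℂ] Module.End ℂ (ExteriorAlgebra ℂ X) :=
  CliffordAlgebra.contractLeft

theorem contractForm_ι_mul (l : Module.Dual ℂ X) (v : X) (x : ExteriorAlgebra ℂ X) :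
    contractForm l (ExteriorAlgebra.ι ℂ v * x)
      = l v • x - ExteriorAlgebra.ι ℂ v * contractForm l x :=
  CliffordAlgebra.contractLeft_ι_mul _ _ _

theorem contractForm_algebraMap (l : Module.Dual ℂ X) (r : ℂ) :
    contractForm l (algebraMap ℂ (ExteriorAlgebra ℂ X) r) = 0 :=
  CliffordAlgebra.contractLeft_algebraMap _ _ r

theorem contractForm_one (l : Module.Dual ℂ X) :
    contractForm l (1 : ExteriorAlgebra ℂ X) = 0 :=
  CliffordAlgebra.contractLeft_one _ _

/-- The fermions on the exterior algebra determined by a basis. -/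
def extFermion (b : Module.Basis ℤ ℂ X) : Fermion (ExteriorAlgebra ℂ X) where
  c a := LinearMap.mulLeft ℂ (ExteriorAlgebra.ι ℂ (b a))
  d a := contractForm (b.coord a)
  c_c i j x := by
    simp only [LinearMap.mulLeft_apply, ← mul_assoc]
    rw [eq_neg_of_add_eq_zero_left (ExteriorAlgebra.ι_add_mul_swap (R := ℂ) (b i) (b j)), neg_mul]
  d_d i j x := CliffordAlgebra.contractLeft_comm _ _ _
  d_c i j x := by
    rw [LinearMap.mulLeft_apply, contractForm_ι_mul, Module.Basis.coord_apply, b.repr_self,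
      Finsupp.single_apply, LinearMap.mulLeft_apply]
    by_cases h : i = j
    · simp [h]
    · simp [h, Ne.symm h]

theorem extFermion_c (b : Module.Basis ℤ ℂ X) (a : ℤ) (x : ExteriorAlgebra ℂ X) :
    (extFermion b).c a x = ExteriorAlgebra.ι ℂ (b a) * x := rfl

theorem extFermion_d (b : Module.Basis ℤ ℂ X) (a : ℤ) (x : ExteriorAlgebra ℂ X) :
    (extFermion b).d a x = contractForm (b.coord a) x := rfl

/-- The derivation extending a rank one operator is contraction followed by multiplication; the sign
from moving e past the first factor cancels the one in the contraction rule. -/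
theorem sum_ιMulti_update (l : Module.Dual ℂ X) (e : X) (n : ℕ) (v : Fin n → X) :
    ∑ i, ExteriorAlgebra.ιMulti ℂ n (Function.update v i (l (v i) • e))
      = ExteriorAlgebra.ι ℂ e * contractForm l (ExteriorAlgebra.ιMulti ℂ n v) := by
  induction n with
  | zero => simp [contractForm_one]
  | succ n ih =>
    have h : ∀ i : Fin n, Matrix.vecTail (Function.update v i.succ (l (v i.succ) • e))
        = Function.update (Matrix.vecTail v) i (l (Matrix.vecTail v i) • e) := fun i => by
      ext1 j
      by_cases hj : j = i
      · subst hj; simp [Matrix.vecTail]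
      · simp [Matrix.vecTail, hj]
    have h0 : Matrix.vecTail (Function.update v 0 (l (v 0) • e)) = Matrix.vecTail v := by
      ext1 j
      simp [Matrix.vecTail]
    rw [Fin.sum_univ_succ]
    simp only [ExteriorAlgebra.ιMulti_succ_apply, h, h0, Function.update_self]
    simp only [ne_eq, (Fin.succ_ne_zero _).symm, not_false_eq_true, Function.update_of_ne]
    rw [← Finset.mul_sum, ih, contractForm_ι_mul, map_smul, mul_sub, mul_smul_comm, smul_mul_assoc,
      ← mul_assoc, ← mul_assoc,
      eq_neg_of_add_eq_zero_left (ExteriorAlgebra.ι_add_mul_swap (R := ℂ) (v 0) e), neg_mul,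
      sub_eq_add_neg]

theorem contractForm_ιMulti (l : Module.Dual ℂ X) (n : ℕ) (v : Fin (n + 1) → X) :
    contractForm l (ExteriorAlgebra.ιMulti ℂ (n + 1) v)
      = ∑ j : Fin (n + 1), ((-1 : ℂ) ^ (j : ℕ) * l (v j)) •
          ExteriorAlgebra.ιMulti ℂ n (j.removeNth v) := by
  induction n with
  | zero =>
    rw [ExteriorAlgebra.ιMulti_succ_apply, contractForm_ι_mul]
    simp [contractForm_one]
  | succ n ih =>
    rw [ExteriorAlgebra.ιMulti_succ_apply, contractForm_ι_mul, ih,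
      Fin.sum_univ_succ (n := n + 1),
      sub_eq_add_neg, Finset.mul_sum, ← Finset.sum_neg_distrib]
    congr 1
    · simp only [Fin.val_zero, pow_zero, one_mul]
      rfl
    · refine Finset.sum_congr rfl fun j _ => ?_
      rw [ExteriorAlgebra.ιMulti_succ_apply, mul_smul_comm, ← neg_smul, Fin.val_succ, pow_succ]
      have h1 : Fin.removeNth j.succ v 0 = v 0 := by simp [Fin.removeNth]
      have h2 : Matrix.vecTail (Fin.removeNth j.succ v) = Fin.removeNth j (Matrix.vecTail v) := by
        ext1 i
        simp [Fin.removeNth, Matrix.vecTail]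
      rw [h1, h2]
      congr 1
      simp only [Matrix.vecTail, Function.comp_apply]
      ring

end Exterior

/-! ### The dual pair of exterior algebras and its invariant form -/

/-- The pair of fermions on the tensor product of the exterior algebras of `V^∨` and `V`. -/
abbrev extPair : FermionPair (ExteriorAlgebra ℂ VDual ⊗[ℂ] ExteriorAlgebra ℂ V) :=
  (extFermion w).tensor (extFermion u)

/-- The linear form on `V` corresponding to an element of `V^∨`. -/
def pairingForm : VDual →ₗ[ℂ] Module.Dual ℂ V := w.constr ℂ fun i => (-1 : ℂ) ^ i • u.coord i

theorem pairingForm_w (a : ℤ) : pairingForm (w a) = (-1 : ℂ) ^ a • u.coord a := by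
  rw [pairingForm, Module.Basis.constr_basis]

theorem pairingForm_u (v : VDual) (a : ℤ) : pairingForm v (u a) = (-1 : ℂ) ^ a * w.coord a v := by
  have : (LinearMap.applyₗ (u a)) ∘ₗ pairingForm = (-1 : ℂ) ^ a • w.coord a := w.ext fun i => by
    rw [LinearMap.comp_apply, LinearMap.applyₗ_apply_apply, pairingForm_w, LinearMap.smul_apply,
      LinearMap.smul_apply, Module.Basis.coord_apply, Module.Basis.coord_apply,
      Module.Basis.repr_self, Module.Basis.repr_self, Finsupp.single_apply, Finsupp.single_apply]
    by_cases h : i = a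
    · simp [h]
    · simp [h, Ne.symm h]
  exact LinearMap.congr_fun this v

theorem pairing_tmul (x : VDual) (v : V) : pairing (x ⊗ₜ v) = pairingForm x v := rfl

/-- The action of the exterior algebra of `V^∨` on that of `V` by contractions. -/
def extContract : ExteriorAlgebra ℂ VDual →ₐ[ℂ] Module.End ℂ (ExteriorAlgebra ℂ V) :=
  ExteriorAlgebra.lift ℂ ⟨contractForm ∘ₗ pairingForm, fun _ =>
    LinearMap.ext fun x => CliffordAlgebra.contractLeft_contractLeft _ x⟩

theorem extContract_ι (v : VDual) :
    extContract (ExteriorAlgebra.ι ℂ v) = contractForm (pairingForm v) := by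
  rw [extContract, ExteriorAlgebra.lift_ι_apply]
  rfl

/-- The reversal of products in the exterior algebra of `V^∨`. -/
def extReverse : ExteriorAlgebra ℂ VDual →ₗ[ℂ] ExteriorAlgebra ℂ VDual := CliffordAlgebra.reverse

theorem extReverse_ι_mul (v : VDual) (x : ExteriorAlgebra ℂ VDual) :
    extReverse (ExteriorAlgebra.ι ℂ v * x) = extReverse x * ExteriorAlgebra.ι ℂ v := by
  refine (CliffordAlgebra.reverse.map_mul _ _).trans ?_
  congr 1
  exact CliffordAlgebra.reverse_ι v

/-- The invariant bilinear form on exterior algebras. -/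
def extForm : ExteriorAlgebra ℂ VDual →ₗ[ℂ] ExteriorAlgebra ℂ V →ₗ[ℂ] ℂ :=
  (LinearMap.compRight ℂ (ExteriorAlgebra.algebraMapInv (R := ℂ) (M := V)).toLinearMap) ∘ₗ
    extContract.toLinearMap ∘ₗ extReverse

theorem extForm_apply (x : ExteriorAlgebra ℂ VDual) (y : ExteriorAlgebra ℂ V) :
    extForm x y = ExteriorAlgebra.algebraMapInv (extContract (extReverse x) y) := rfl

/-- The reversal makes the leftmost factor act first on y, which gives adjointness to left
multiplication without a degree-dependent sign. -/
theorem extForm_ι_mul (v : VDual) (x : ExteriorAlgebra ℂ VDual) (y : ExteriorAlgebra ℂ V) :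
    extForm (ExteriorAlgebra.ι ℂ v * x) y = extForm x (contractForm (pairingForm v) y) := by
  rw [extForm_apply, extReverse_ι_mul, map_mul, extContract_ι]
  rfl

theorem extForm_algebraMap (r : ℂ) (y : ExteriorAlgebra ℂ V) :
    extForm (algebraMap ℂ _ r) y = r * ExteriorAlgebra.algebraMapInv y := by
  have : extReverse (algebraMap ℂ _ r) = algebraMap ℂ _ r := CliffordAlgebra.reverse.commutes r
  rw [extForm_apply, this, AlgHom.commutes, Module.algebraMap_end_apply, map_smul, smul_eq_mul]

theorem extForm_c_left (a : ℤ) (x : ExteriorAlgebra ℂ VDual) (y : ExteriorAlgebra ℂ V) :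
    extForm ((extFermion w).c a x) y = (-1 : ℂ) ^ a * extForm x ((extFermion u).d a y) := by
  rw [extFermion_c, extForm_ι_mul, pairingForm_w, map_smul, LinearMap.smul_apply, map_smul,
    smul_eq_mul, extFermion_d]

/-- By induction on x from the left: the contraction rules on both sides have the same shape, and
their scalar terms agree because the pairing of v with u_a is (-1)^a times the a-th coordinate of v.
-/
theorem extForm_c_right (a : ℤ) (x : ExteriorAlgebra ℂ VDual) (y : ExteriorAlgebra ℂ V) :
    extForm x ((extFermion u).c a y) = (-1 : ℂ) ^ a * extForm ((extFermion w).d a x) y := by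
  simp only [extFermion_c, extFermion_d]
  induction x using CliffordAlgebra.left_induction generalizing y with
  | algebraMap r =>
    refine (extForm_algebraMap r _).trans ?_
    rw [map_mul, show ExteriorAlgebra.algebraMapInv (ExteriorAlgebra.ι ℂ (u a)) = 0 by
      simp [ExteriorAlgebra.algebraMapInv], zero_mul, mul_zero]
    have : contractForm (w.coord a) (algebraMap ℂ (ExteriorAlgebra ℂ VDual) r) = 0 :=
      contractForm_algebraMap _ _
    refine Eq.symm ((congrArg (fun z => (-1 : ℂ) ^ a * extForm z y) this).trans ?_)
    rw [map_zero, LinearMap.zero_apply, mul_zero]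
  | add x x' hx hx' =>
    have h1 : extForm (x + x') = extForm x + extForm x' := map_add _ _ _
    have h2 : contractForm (w.coord a) (x + x') = contractForm (w.coord a) x
      + contractForm (w.coord a) x' := map_add _ _ _
    rw [h1, LinearMap.add_apply, hx, hx', h2, map_add, LinearMap.add_apply, mul_add]
  | ι_mul x v ih =>
    refine (extForm_ι_mul v x _).trans ?_
    refine Eq.symm ((congrArg (fun z => (-1 : ℂ) ^ a * extForm z y)
      (contractForm_ι_mul (w.coord a) v x)).trans ?_)
    rw [contractForm_ι_mul, map_sub, map_sub, map_smul, map_smul, LinearMap.sub_apply,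
      LinearMap.smul_apply, ih, pairingForm_u, extForm_ι_mul, smul_eq_mul, smul_eq_mul]
    ring

/-- The invariant functional on the tensor product of exterior algebras. -/
abbrev extTrace : ExteriorAlgebra ℂ VDual ⊗[ℂ] ExteriorAlgebra ℂ V →ₗ[ℂ] ℂ :=
  TensorProduct.lift extForm

theorem isInvariant_extTrace : extPair.IsInvariant extTrace :=
  Fermion.isInvariant_tensor _ _ extForm_c_right extForm_c_left

theorem isVacuum_ext (Z : Set ℤ) : extPair.IsVacuum Z (1 ⊗ₜ 1) :=
  Fermion.isVacuum_tensor _ _ (fun _ _ => contractForm_one _) fun _ _ => contractForm_one _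

theorem extTrace_vac : extTrace (1 ⊗ₜ 1) = 1 := by
  rw [TensorProduct.lift.tmul, ← map_one (algebraMap ℂ (ExteriorAlgebra ℂ VDual)),
    extForm_algebraMap, map_one, one_mul]

/-! ### The inclusion of the mixed exterior powers -/

/-- The inclusion of `MixedWedge m n` into the tensor product of exterior algebras. -/
def mixedIncl (m n : ℕ) :
    MixedWedge m n →ₗ[ℂ] ExteriorAlgebra ℂ VDual ⊗[ℂ] ExteriorAlgebra ℂ V :=
  TensorProduct.map (⋀[ℂ]^m VDual).subtype (⋀[ℂ]^n V).subtype

theorem mixedIncl_injective (m n : ℕ) : Function.Injective (mixedIncl m n) :=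
  TensorProduct.map_injective_of_flat_flat _ _ Subtype.val_injective Subtype.val_injective

theorem mixedIncl_tmul {m n : ℕ} (x : ⋀[ℂ]^m VDual) (y : ⋀[ℂ]^n V) :
    mixedIncl m n (x ⊗ₜ y) = (x : ExteriorAlgebra ℂ VDual) ⊗ₜ (y : ExteriorAlgebra ℂ V) := rfl

/-- Off-diagonal matrix units have rank one on both V and V^∨, so `sum_ιMulti_update` gives their
action as creation after annihilation. -/
theorem coe_lie_exteriorPower {X : Type*} [AddCommGroup X] [Module ℂ X] [LieRingModule slInf X]
    [LieModule ℂ slInf X] {g : slInf} {l : Module.Dual ℂ X} {e : X} (h : ∀ v : X, ⁅g, v⁆ = l v • e)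
    {n : ℕ} (x : ⋀[ℂ]^n X) :
    ((⁅g, x⁆ : ⋀[ℂ]^n X) : ExteriorAlgebra ℂ X) = ExteriorAlgebra.ι ℂ e * contractForm l x := by
  have hx : x ∈ Submodule.span ℂ (Set.range (exteriorPower.ιMulti ℂ n (M := X))) := by
    rw [exteriorPower.ιMulti_span]
    exact Submodule.mem_top
  induction hx using Submodule.span_induction with
  | mem x hx =>
    obtain ⟨v, rfl⟩ := hx
    rw [ExteriorLie.lie_ιMulti, AddSubmonoidClass.coe_finsetSum]
    simp only [exteriorPower.ιMulti_apply_coe, h, sum_ιMulti_update]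
  | zero => simp
  | add x y _ _ hx hy =>
    rw [lie_add, Submodule.coe_add, hx, hy, Submodule.coe_add, map_add, mul_add]
  | smul c x _ hx => rw [lie_smul, Submodule.coe_smul, hx, Submodule.coe_smul, map_smul,
      mul_smul_comm]

theorem lie_V_matUnit {a b : ℤ} (hab : a ≠ b) (v : V) :
    ⁅(matUnit hab : slInf), v⁆ = u.coord b v • u a := matEnd_apply a b v

theorem lie_VDual_matUnit {a b : ℤ} (hab : a ≠ b) (v : VDual) :
    ⁅(matUnit hab : slInf), v⁆ = w.coord a v • ((-(-1 : ℂ) ^ (a + b)) • w b) := by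
  change (twist (matUnit hab)).1 v = _
  rw [twist_matUnit, smul_comm]
  exact congrArg ((-(-1 : ℂ) ^ (a + b)) • ·) (matEnd_apply b a v)

theorem mixedIncl_lie (m n : ℕ) {a b : ℤ} (hab : a ≠ b) (v : MixedWedge m n) :
    mixedIncl m n ⁅(matUnit hab : slInf), v⁆ = extPair.E a b (mixedIncl m n v) := by
  have h : mixedIncl m n ∘ₗ LieModule.toEnd ℂ slInf (MixedWedge m n) (matUnit hab)
      = extPair.E a b ∘ₗ mixedIncl m n := TensorProduct.ext' fun x y => by
    refine (congrArg (mixedIncl m n)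
      (TensorProduct.LieModule.lie_tmul_right (matUnit hab : slInf) x y)).trans ?_
    rw [map_add, LinearMap.comp_apply, mixedIncl_tmul, mixedIncl_tmul,
      mixedIncl_tmul, Fermion.tensor_E_tmul]
    congr 2
    · refine (coe_lie_exteriorPower (lie_VDual_matUnit hab) x).trans ?_
      rw [map_smul, smul_mul_assoc]
      rfl
    · exact coe_lie_exteriorPower (lie_V_matUnit hab) y
  exact LinearMap.congr_fun h v

theorem level_ιMulti_tmul (m n : ℕ) (i : Fin m → ℤ) (j : Fin n → ℤ) :
    extPair.Level (1 ⊗ₜ 1) Set.univ m n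
      (ExteriorAlgebra.ιMulti ℂ m (w ∘ i) ⊗ₜ ExteriorAlgebra.ιMulti ℂ n (u ∘ j)) := by
  induction n with
  | zero =>
    rw [ExteriorAlgebra.ιMulti_zero_apply]
    induction m with
    | zero =>
      rw [ExteriorAlgebra.ιMulti_zero_apply]
      exact .vac
    | succ m ih =>
      have h := (FermionPair.Level.χ (Set.mem_univ (i 0)) (ih (i ∘ Fin.succ))).smul
        ((-1 : ℂ) ^ (i 0))
      rw [Fermion.tensor_χ_tmul, smul_smul, ← mul_zpow, neg_one_mul, neg_neg, one_zpow,
        one_smul] at h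
      rw [ExteriorAlgebra.ιMulti_succ_apply]
      exact h
  | succ n ih =>
    rw [ExteriorAlgebra.ιMulti_succ_apply]
    exact FermionPair.Level.ψ (Set.mem_univ (j 0)) (ih (j ∘ Fin.succ))

theorem level_mixedIncl {m n : ℕ} (v : MixedWedge m n) :
    extPair.Level (1 ⊗ₜ 1) Set.univ m n (mixedIncl m n v) := by
  induction v using TensorProduct.induction_on with
  | zero => rw [map_zero]; exact .zero _ _
  | add v w hv hw => rw [map_add]; exact hv.add hw
  | tmul x y =>
    have hx : x ∈ Submodule.span ℂ (exteriorPower.ιMulti ℂ m (M := VDual) ''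
        {a | Set.range a ⊆ Set.range w}) := by
      rw [exteriorPower.ιMulti_span_of_span ℂ m VDual w.span_eq]
      exact Submodule.mem_top
    have hy : y ∈ Submodule.span ℂ (exteriorPower.ιMulti ℂ n (M := V) ''
        {a | Set.range a ⊆ Set.range u}) := by
      rw [exteriorPower.ιMulti_span_of_span ℂ n V u.span_eq]
      exact Submodule.mem_top
    induction hx using Submodule.span_induction with
    | zero => rw [TensorProduct.zero_tmul, map_zero]; exact .zero _ _
    | add x x' _ _ h h' => rw [TensorProduct.add_tmul, map_add]; exact h.add h'
    | smul c x _ h => rw [← TensorProduct.smul_tmul', map_smul]; exact h.smul c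
    | mem x hx =>
      obtain ⟨f, hf, rfl⟩ := hx
      induction hy using Submodule.span_induction with
      | zero => rw [TensorProduct.tmul_zero, map_zero]; exact .zero _ _
      | add x x' _ _ h h' => rw [TensorProduct.tmul_add, map_add]; exact h.add h'
      | smul c x _ h => rw [TensorProduct.tmul_smul, map_smul]; exact h.smul c
      | mem y hy =>
        obtain ⟨g, hg, rfl⟩ := hy
        choose i hi using fun k => hf ⟨k, rfl⟩
        choose j hj using fun k => hg ⟨k, rfl⟩
        obtain rfl : w ∘ i = f := funext hi
        obtain rfl : u ∘ j = g := funext hj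
        exact level_ιMulti_tmul m n i j

theorem pairing_eq_sum (x : VDual) (v : V) {F : Finset ℤ} (hF : (u.repr v).support ⊆ F) :
    pairing (x ⊗ₜ v) = ∑ a ∈ F, (-1 : ℂ) ^ a * (w.coord a x * u.coord a v) := by
  rw [pairing_tmul]
  conv_lhs => rw [← u.linearCombination_repr v, Finsupp.linearCombination_apply,
    Finsupp.sum_of_support_subset _ hF _ (by simp), map_sum]
  refine Finset.sum_congr rfl fun a _ => ?_
  rw [map_smul, pairingForm_u, smul_eq_mul, Module.Basis.coord_apply u]
  ring

/-- Expanding the pairing in coordinates gives the sum of χd_q ψd_q over all q. On a given vector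
only finitely many q contribute, so F has to depend on it. -/
theorem exists_mixedIncl_contraction {m n : ℕ} (y : MixedWedge (m + 1) (n + 1)) :
    ∃ F₀ : Finset ℤ, ∀ F, F₀ ⊆ F → mixedIncl m n (ExteriorLie.contraction pairing m n y)
      = extPair.contr F (mixedIncl (m + 1) (n + 1) y) := by
  classical
  have hadd : ∀ y y' : MixedWedge (m + 1) (n + 1),
      (∃ F₀ : Finset ℤ, ∀ F, F₀ ⊆ F → mixedIncl m n (ExteriorLie.contraction pairing m n y)
        = extPair.contr F (mixedIncl (m + 1) (n + 1) y)) →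
      (∃ F₀ : Finset ℤ, ∀ F, F₀ ⊆ F → mixedIncl m n (ExteriorLie.contraction pairing m n y')
        = extPair.contr F (mixedIncl (m + 1) (n + 1) y')) →
      ∃ F₀ : Finset ℤ, ∀ F, F₀ ⊆ F → mixedIncl m n (ExteriorLie.contraction pairing m n (y + y'))
        = extPair.contr F (mixedIncl (m + 1) (n + 1) (y + y')) := by
    rintro y y' ⟨F₁, h₁⟩ ⟨F₂, h₂⟩
    refine ⟨F₁ ∪ F₂, fun F hF => ?_⟩
    rw [map_add, map_add, map_add, map_add, h₁ F (Finset.union_subset_left hF),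
      h₂ F (Finset.union_subset_right hF)]
  have hsmul : ∀ (c : ℂ) (y : MixedWedge (m + 1) (n + 1)),
      (∃ F₀ : Finset ℤ, ∀ F, F₀ ⊆ F → mixedIncl m n (ExteriorLie.contraction pairing m n y)
        = extPair.contr F (mixedIncl (m + 1) (n + 1) y)) →
      ∃ F₀ : Finset ℤ, ∀ F, F₀ ⊆ F → mixedIncl m n (ExteriorLie.contraction pairing m n (c • y))
        = extPair.contr F (mixedIncl (m + 1) (n + 1) (c • y)) := by
    rintro c y ⟨F₁, h₁⟩
    refine ⟨F₁, fun F hF => ?_⟩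
    rw [map_smul, map_smul, map_smul, map_smul, h₁ F hF]
  have hzero : ∃ F₀ : Finset ℤ, ∀ F, F₀ ⊆ F →
      mixedIncl m n (ExteriorLie.contraction pairing m n 0)
        = extPair.contr F (mixedIncl (m + 1) (n + 1) 0) :=
    ⟨∅, fun F _ => by rw [map_zero, map_zero, map_zero, map_zero]⟩
  induction y using TensorProduct.induction_on with
  | zero => exact hzero
  | add y y' hy hy' => exact hadd y y' hy hy'
  | tmul x y =>
    have hx : x ∈ Submodule.span ℂ (Set.range (exteriorPower.ιMulti ℂ (m + 1) (M := VDual))) := by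
      rw [exteriorPower.ιMulti_span]
      exact Submodule.mem_top
    have hy : y ∈ Submodule.span ℂ (Set.range (exteriorPower.ιMulti ℂ (n + 1) (M := V))) := by
      rw [exteriorPower.ιMulti_span]
      exact Submodule.mem_top
    induction hx using Submodule.span_induction with
    | zero => rw [TensorProduct.zero_tmul]; exact hzero
    | add x x' _ _ h h' => rw [TensorProduct.add_tmul]; exact hadd _ _ h h'
    | smul c x _ h => rw [← TensorProduct.smul_tmul']; exact hsmul c _ h
    | mem x hx =>
      obtain ⟨f, rfl⟩ := hx
      induction hy using Submodule.span_induction with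
      | zero => rw [TensorProduct.tmul_zero]; exact hzero
      | add x x' _ _ h h' => rw [TensorProduct.tmul_add]; exact hadd _ _ h h'
      | smul c x _ h => rw [TensorProduct.tmul_smul]; exact hsmul c _ h
      | mem y hy =>
        obtain ⟨g, rfl⟩ := hy
        refine ⟨Finset.univ.biUnion fun j => (u.repr (g j)).support, fun F hF => ?_⟩
        have hF' : ∀ j, (u.repr (g j)).support ⊆ F := fun j =>
          (Finset.subset_biUnion_of_mem (fun j => (u.repr (g j)).support)
            (Finset.mem_univ j)).trans hF
        rw [ExteriorLie.contraction_ιMulti_tmul, FermionPair.contr_apply, mixedIncl_tmul]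
        simp only [Fermion.tensor_ψd_tmul, Fermion.tensor_χd_tmul, extFermion_d,
          exteriorPower.ιMulti_apply_coe, contractForm_ιMulti, TensorProduct.sum_tmul,
          TensorProduct.tmul_sum, map_sum, map_smul, mixedIncl_tmul,
          ← TensorProduct.smul_tmul', TensorProduct.tmul_smul, Finset.smul_sum, smul_smul]
        rw [Finset.sum_comm (s := F)]
        rw [Finset.sum_comm]
        refine Finset.sum_congr rfl fun j _ => ?_
        rw [Finset.sum_comm (s := F)]
        refine Finset.sum_congr rfl fun i _ => ?_
        rw [pairing_eq_sum _ _ (hF' j), Finset.mul_sum, Finset.sum_smul]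
        refine Finset.sum_congr rfl fun a _ => ?_
        rw [pow_add]
        congr 1
        ring

/-! ### Products of creation operators with distinct indices -/

namespace FermionPair

variable {T T' : Type*} [AddCommGroup T] [Module ℂ T] [AddCommGroup T'] [Module ℂ T']
  {A : FermionPair T} {A' : FermionPair T'} {v₀ : T} {v₀' : T'} {Z Z' : Set ℤ} {c s k : ℕ}

theorem exists_isProd (A : FermionPair T) (v₀ : T) (hZ : Z.Infinite) (c s : ℕ) :
    ∃ x, A.IsProd v₀ Z c s 0 x := by
  have hdiff : ∀ {Z : Set ℤ} (_ : Z.Infinite) (p : ℤ), (Z \ {p}).Infinite :=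
    fun hZ p => hZ.sdiff (Set.finite_singleton p)
  induction s generalizing Z with
  | succ s ih =>
    obtain ⟨p, hp⟩ := hZ.nonempty
    obtain ⟨x, hx⟩ := ih (hdiff hZ p)
    exact ⟨_, .ψ hp hx⟩
  | zero =>
    induction c generalizing Z with
    | succ c ih =>
      obtain ⟨p, hp⟩ := hZ.nonempty
      obtain ⟨x, hx⟩ := ih (hdiff hZ p)
      exact ⟨_, .χ hp hx⟩
    | zero => exact ⟨_, .vac Z⟩

theorem IsProd.level {x v : T} (h : A.IsProd v₀ Z c s k x) (hv : A.Level v Z' 0 0 v₀)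
    (hZ : Z ⊆ Z') : A.Level v Z' (c + k) (s + k) x := by
  induction h with
  | vac => exact hv
  | @ψ Z c s k x p hp _ ih =>
    rw [add_right_comm]
    exact .ψ (hZ hp) (ih (Set.sdiff_subset.trans hZ))
  | @χ Z c s k x p hp _ ih =>
    rw [add_right_comm]
    exact .χ (hZ hp) (ih (Set.sdiff_subset.trans hZ))
  | pair hp _ ih => exact .χ (hZ hp) (.ψ (hZ hp) (ih (Set.sdiff_subset.trans hZ)))

theorem IsProd.ψd_eq_zero {x : T} {q : ℤ} (h : A.IsProd v₀ (Z \ {q}) c s k x)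
    (hq : A.ψd q v₀ = 0) : A.ψd q x = 0 :=
  (h.level .vac subset_rfl).ψd_eq_zero hq fun h => h.2 rfl

theorem IsProd.χd_eq_zero {x : T} {q : ℤ} (h : A.IsProd v₀ (Z \ {q}) c s k x)
    (hq : A.χd q v₀ = 0) : A.χd q x = 0 :=
  (h.level .vac subset_rfl).χd_eq_zero hq fun h => h.2 rfl

theorem IsVacuum.mono (h : A.IsVacuum Z v₀) (hZ : Z' ⊆ Z) : A.IsVacuum Z' v₀ :=
  ⟨fun a ha => h.ψd a (hZ ha), fun a ha => h.χd a (hZ ha)⟩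

theorem IsVacuum.smul (h : A.IsVacuum Z v₀) (r : ℂ) : A.IsVacuum Z (r • v₀) :=
  ⟨fun a ha => by rw [map_smul, h.ψd a ha, smul_zero],
    fun a ha => by rw [map_smul, h.χd a ha, smul_zero]⟩

theorem IsVacuum.prod (h : A.IsVacuum Z v₀) (h' : A'.IsVacuum Z v₀') :
    (A.prod A').IsVacuum Z (v₀, v₀') :=
  ⟨fun a ha => Prod.ext (h.ψd a ha) (h'.ψd a ha), fun a ha => Prod.ext (h.χd a ha) (h'.χd a ha)⟩

/-- With fewer ψd's than ψ's, some ψ_q reaches τ and becomes χd_q; the indices being distinct and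
unpaired, no χ_q is there to absorb it. -/
theorem IsProd.mem_vanish_of_lt {τ : T →ₗ[ℂ] ℂ} (hτ : A.IsInvariant τ) {x : T}
    (h : A.IsProd v₀ Z c s 0 x) (hv₀ : A.IsVacuum Z v₀) {c' s' : ℕ} (hs : s' < s) (Y : Set ℤ) :
    x ∈ A.vanish τ Y c' s' := by
  generalize hk : 0 = k at h
  induction h generalizing c' s' with
  | vac => exact absurd hs (Nat.not_lt_zero _)
  | ψ hp hx ih =>
    have hq := hx.χd_eq_zero (hv₀.χd _ hp)
    cases s' with
    | zero => exact hτ.ψ_mem_vanish_zero hq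
    | succ s' =>
      exact hτ.ψ_mem_vanish hq (ih (hv₀.mono Set.sdiff_subset) (by omega) hk)
  | χ hp hx ih =>
    have hq := hx.ψd_eq_zero (hv₀.ψd _ hp)
    cases c' with
    | zero => exact hτ.χ_mem_vanish_zero hq
    | succ c' => exact hτ.χ_mem_vanish hq (ih (hv₀.mono Set.sdiff_subset) hs hk)
  | pair => omega

/-- Annihilating at the indices of the product strips its factors one by one down to the vacuum; any
other contraction of this type leaves a factor that τ kills or is a multiple of τ v₀. -/
theorem IsProd.mem_vanish_iff {τ : T →ₗ[ℂ] ℂ} (hτ : A.IsInvariant τ) {x : T}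
    (h : A.IsProd v₀ Z c s 0 x) (hv₀ : A.IsVacuum Z v₀) :
    x ∈ A.vanish τ Set.univ c s ↔ τ v₀ = 0 := by
  generalize hk : 0 = k at h
  induction h with
  | vac => exact A.mem_vanish_zero
  | @ψ Z c s k x p hp hx ih =>
    rw [← ih (hv₀.mono Set.sdiff_subset) hk]
    refine ⟨fun h => ?_, hτ.ψ_mem_vanish (hx.χd_eq_zero (hv₀.χd _ hp))⟩
    have := A.mem_vanish_succ_right.1 h p (Set.mem_univ p)
    rwa [A.ψd_ψ, if_pos rfl, hx.ψd_eq_zero (hv₀.ψd _ hp), map_zero, sub_zero] at this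
  | @χ Z c s k x p hp hx ih =>
    rw [← ih (hv₀.mono Set.sdiff_subset) hk]
    refine ⟨fun h => ?_, hτ.χ_mem_vanish (hx.ψd_eq_zero (hv₀.ψd _ hp))⟩
    have := A.mem_vanish_succ_left.1 h p (Set.mem_univ p)
    rwa [A.χd_χ, if_pos rfl, hx.χd_eq_zero (hv₀.χd _ hp), map_zero, sub_zero] at this
  | pair => omega

theorem IsProd.fst {x : T × T'} (h : (A.prod A').IsProd (v₀, v₀') Z c s k x) :
    A.IsProd v₀ Z c s k x.1 := by
  induction h with
  | vac Z => exact .vac Z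
  | ψ hp _ ih => exact .ψ hp ih
  | χ hp _ ih => exact .χ hp ih
  | pair hp _ ih => exact .pair hp ih

theorem IsProd.snd {x : T × T'} (h : (A.prod A').IsProd (v₀, v₀') Z c s k x) :
    A'.IsProd v₀' Z c s k x.2 := by
  induction h with
  | vac Z => exact .vac Z
  | ψ hp _ ih => exact .ψ hp ih
  | χ hp _ ih => exact .χ hp ih
  | pair hp _ ih => exact .pair hp ih

theorem Level.eq_zero_of_mem_vanish_univ {τ : T →ₗ[ℂ] ℂ} {m n : ℕ} {v : T} (hτ : τ v₀ ≠ 0)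
    (hv₀ : A.IsVacuum Z v₀) (h : A.Level v₀ Z m n v) (hv : v ∈ A.vanish τ Set.univ m n) :
    v = 0 := by
  obtain ⟨F, hF, hL⟩ := h.exists_finset
  exact hL.eq_zero hτ (hv₀.mono hF) (A.vanish_anti (Set.subset_univ _) _ _ hv)

end FermionPair

theorem Fermion.mem_range_map_of_level {X Y : Type*} [AddCommGroup X] [Module ℂ X]
    [AddCommGroup Y] [Module ℂ Y] (F : Fermion X) (G : Fermion Y) {P : ℕ → Submodule ℂ X}
    {Q : ℕ → Submodule ℂ Y} (hP : ∀ a m, ∀ x ∈ P m, F.c a x ∈ P (m + 1))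
    (hQ : ∀ a n, ∀ y ∈ Q n, G.c a y ∈ Q (n + 1)) {x : X} {y : Y} (hx : x ∈ P 0) (hy : y ∈ Q 0)
    {Z : Set ℤ} {m n : ℕ} {v : X ⊗[ℂ] Y} (h : (F.tensor G).Level (x ⊗ₜ y) Z m n v) :
    v ∈ LinearMap.range (TensorProduct.map (P m).subtype (Q n).subtype) := by
  induction h with
  | vac => exact ⟨⟨x, hx⟩ ⊗ₜ ⟨y, hy⟩, rfl⟩
  | @ψ m n v a _ hv ih =>
    clear hv
    obtain ⟨z, rfl⟩ := ih
    induction z using TensorProduct.induction_on with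
    | zero => rw [map_zero, map_zero]; exact Submodule.zero_mem _
    | add z z' hz hz' => rw [map_add, map_add]; exact Submodule.add_mem _ hz hz'
    | tmul x y => exact ⟨x ⊗ₜ ⟨_, hQ a n y y.2⟩, rfl⟩
  | @χ m n v a _ hv ih =>
    clear hv
    obtain ⟨z, rfl⟩ := ih
    induction z using TensorProduct.induction_on with
    | zero => rw [map_zero, map_zero]; exact Submodule.zero_mem _
    | add z z' hz hz' => rw [map_add, map_add]; exact Submodule.add_mem _ hz hz'
    | tmul x y =>
      rw [TensorProduct.map_tmul, tensor_χ_tmul]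
      exact Submodule.smul_mem _ _ ⟨⟨_, hP a m x x.2⟩ ⊗ₜ y, rfl⟩
  | zero => exact Submodule.zero_mem _
  | add _ _ ih ih' => exact Submodule.add_mem _ ih ih'
  | smul c _ ih => exact Submodule.smul_mem _ c ih

theorem ι_mul_mem_exteriorPower {X : Type*} [AddCommGroup X] [Module ℂ X] (e : X) {n : ℕ}
    {x : ExteriorAlgebra ℂ X} (hx : x ∈ ⋀[ℂ]^n X) : ExteriorAlgebra.ι ℂ e * x ∈ ⋀[ℂ]^(n + 1) X := by
  change _ ∈ LinearMap.range (ExteriorAlgebra.ι ℂ : X →ₗ[ℂ] _) ^ (n + 1)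
  rw [pow_succ']
  exact Submodule.mul_mem_mul ⟨e, rfl⟩ hx

theorem one_mem_exteriorPower (X : Type*) [AddCommGroup X] [Module ℂ X] :
    (1 : ExteriorAlgebra ℂ X) ∈ ⋀[ℂ]^0 X := by
  change _ ∈ LinearMap.range (ExteriorAlgebra.ι ℂ : X →ₗ[ℂ] _) ^ 0
  rw [pow_zero]
  exact Submodule.one_le.1 le_rfl

theorem exists_mixedIncl_eq {m n : ℕ} {Z : Set ℤ}
    {x : ExteriorAlgebra ℂ VDual ⊗[ℂ] ExteriorAlgebra ℂ V}
    (h : extPair.Level (1 ⊗ₜ 1) Z m n x) : ∃ v, mixedIncl m n v = x := by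
  exact Fermion.mem_range_map_of_level (extFermion w) (extFermion u)
    (P := fun m => ⋀[ℂ]^m VDual) (Q := fun n => ⋀[ℂ]^n V)
    (fun a _ _ => ι_mul_mem_exteriorPower (w a)) (fun a _ _ => ι_mul_mem_exteriorPower (u a))
    (one_mem_exteriorPower _) (one_mem_exteriorPower _) h

theorem create_mem_chargeSpace (a : ℤ) {t : ℤ} {f : FockAll} (hf : f ∈ chargeSpace t) :
    create a f ∈ chargeSpace (t + 1) := by
  have := wedge_mem_chargeSpace (u a) hf
  rwa [wedge, Module.Basis.constr_basis] at this

/-- Creation raises the charge by one from -M. After M creations of the first kind the second factor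
has charge 0, and after m of the second kind the first has charge t. -/
theorem exists_fockProdIncl_eq {t : ℤ} {m M : ℕ} (hm : (m : ℤ) - M = t) {Z : Set ℤ}
    {x : FockAll ⊗[ℂ] FockAll} (h : fockPair.Level (fockVac M) Z m M x) :
    ∃ v, fockProdIncl t v = x := by
  have hstep : ∀ (a : ℤ) (m : ℕ), ∀ x ∈ chargeSpace (m - M),
      create a x ∈ chargeSpace ((m + 1 : ℕ) - M) := fun a m x hx => by
    have := create_mem_chargeSpace a hx
    rwa [show (m : ℤ) - M + 1 = (m + 1 : ℕ) - M by push_cast; ring] at this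
  have hvac : semiWedge (deep M) ∈ chargeSpace ((0 : ℕ) - M) :=
    semiWedge_mem_chargeSpace (by rw [charge_deep]; simp)
  have := Fermion.mem_range_map_of_level fockFermion fockFermion
    (P := fun m => chargeSpace (m - M)) (Q := fun m => chargeSpace (m - M)) hstep hstep hvac hvac h
  rw [hm, sub_self] at this
  exact this

/-! ### Socles, and isomorphisms from invariant relations -/

section Algebra

variable {L M : Type*} [LieRing L] [AddCommGroup M] [Module ℂ M] [LieRingModule L M]

/-- A smallest non-zero submodule is simple. -/
theorem isIrreducible_of_forall_le {K : LieSubmodule ℂ L M} (hK : K ≠ ⊥)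
    (h : ∀ N : LieSubmodule ℂ L M, N ≠ ⊥ → K ≤ N) : LieModule.IsIrreducible ℂ L K := by
  have : Nontrivial K := (LieSubmodule.nontrivial_iff_ne_bot ℂ L M).2 hK
  refine .mk fun N hN => ?_
  have hle := h (N.map K.incl) fun h' => hN ?_
  · refine eq_top_iff.2 fun v _ => ?_
    obtain ⟨v', hv', h'⟩ := (LieSubmodule.mem_map _).1 (hle v.2)
    obtain rfl : v' = v := Subtype.ext h'
    exact hv'
  · refine eq_bot_iff.2 fun v hv => ?_
    have : K.incl v ∈ N.map K.incl := LieSubmodule.mem_map_of_mem hv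
    rw [h', LieSubmodule.mem_bot] at this
    exact (LieSubmodule.mem_bot v).2 (Subtype.ext this)

variable [LieAlgebra ℂ L] [LieModule ℂ L M]

/-- The socle is the smallest non-zero submodule, if there is one. -/
theorem socle_eq_of_forall_le {K : LieSubmodule ℂ L M} (hK : K ≠ ⊥)
    (h : ∀ N : LieSubmodule ℂ L M, N ≠ ⊥ → K ≤ N) : socle L M = K := by
  refine le_antisymm (sSup_le fun N hN => ?_) (le_sSup (isIrreducible_of_forall_le hK h))
  have hN : LieModule.IsIrreducible ℂ L N := hN
  -- A simple submodule contains K; K is not zero, so it is all of it.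
  have hKN := h N ((LieSubmodule.nontrivial_iff_ne_bot ℂ L M).1
    (LieModule.nontrivial_of_isIrreducible ℂ L N))
  rcases hN.eq_bot_or_eq_top (K.comap N.incl) with h' | h'
  · refine absurd ?_ hK
    refine eq_bot_iff.2 fun v hv => ?_
    have : (⟨v, hKN hv⟩ : N) ∈ K.comap N.incl := hv
    rw [h', LieSubmodule.mem_bot] at this
    exact (LieSubmodule.mem_bot v).2 (congrArg Subtype.val this)
  · intro v hv
    have : (⟨v, hv⟩ : N) ∈ K.comap N.incl := h' ▸ LieSubmodule.mem_top _
    exact this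

/-- The isomorphism determined by an invariant relation. -/
theorem nonempty_lieModuleEquiv_of_rel {M' : Type*} [AddCommGroup M'] [Module ℂ M']
    [LieRingModule L M'] {K K' : LieSubmodule ℂ L M} {S : LieSubmodule ℂ L M'}
    (G : Submodule ℂ (M × M')) (hG : ∀ (x : L), ∀ v ∈ G, (⁅x, v.1⁆, ⁅x, v.2⁆) ∈ G)
    (hS : ∀ v ∈ G, v.2 ∈ S) (h₁ : ∀ v ∈ K, ∃ y, (v, y) ∈ G) (h₂ : ∀ y ∈ S, ∃ v ∈ K, (v, y) ∈ G)
    (hK' : ∀ v ∈ K, (v, 0) ∈ G ↔ v ∈ K') (h0 : ∀ y, (0, y) ∈ G → y = 0) :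
    Nonempty ((K ⧸ K'.comap K.incl) ≃ₗ⁅ℂ,L⁆ S) := by
  choose! f hf using h₁
  -- The relation is single-valued, so the chosen partners are forced; linearity and equivariance of
  -- the map follow from this.
  have huniq : ∀ {v y y'}, (v, y) ∈ G → (v, y') ∈ G → y = y' := fun h h' =>
    sub_eq_zero.1 (h0 _ (by simpa using G.sub_mem h h'))
  let φ : K →ₗ[ℂ] S :=
    { toFun := fun v => ⟨f v, hS _ (hf v v.2)⟩
      map_add' := fun v v' => Subtype.ext
        (huniq (hf _ (v + v').2) (G.add_mem (hf v v.2) (hf v' v'.2)))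
      map_smul' := fun c v => Subtype.ext (huniq (hf _ (c • v).2) (G.smul_mem c (hf v v.2))) }
  have hφ : Function.Surjective φ := fun y => by
    obtain ⟨v, hv, h⟩ := h₂ y y.2
    exact ⟨⟨v, hv⟩, Subtype.ext (huniq (hf v hv) h)⟩
  have hker : (K'.comap K.incl).toSubmodule = LinearMap.ker φ := by
    ext v
    rw [LinearMap.mem_ker]
    refine ((hK' v v.2).symm.trans ⟨fun h => Subtype.ext (huniq (hf v v.2) h), fun h => ?_⟩)
    have := hf v v.2
    rwa [show f v = 0 from congrArg Subtype.val h] at this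
  let e := (Submodule.quotEquivOfEq _ _ hker).trans (φ.quotKerEquivOfSurjective hφ)
  refine ⟨{ e with map_lie' := fun {x q} => ?_ }⟩
  obtain ⟨v, rfl⟩ := Submodule.Quotient.mk_surjective _ q
  exact Subtype.ext (huniq (hf _ (⁅x, v⁆ : K).2) (hG x _ (hf v v.2)))

end Algebra

/-! ### The mixed exterior powers -/

/-- The pair contraction preserves vanishing of each type with s below the number of ψ's. So a zero
contraction gives all the conditions, and conversely the single condition with s one less than that
number kills the contraction, whose complete contractions have exactly this type. -/
theorem mem_contractionKer_iff {m n : ℕ} {y : MixedWedge m n} :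
    y ∈ ExteriorLie.contractionKer pairing m n ↔ ∀ c, ∀ s < n, m + s = n + c →
      mixedIncl m n y ∈ extPair.vanish extTrace Set.univ c s := by
  match m, n with
  | 0, n => exact ⟨fun _ c s _ _ => by omega, fun _ => Submodule.mem_top⟩
  | m + 1, 0 => exact ⟨fun _ c s _ _ => by omega, fun _ => Submodule.mem_top⟩
  | m + 1, n + 1 =>
    classical
    obtain ⟨F₀, h₀⟩ := exists_mixedIncl_contraction y
    obtain ⟨F₁, -, h₁⟩ := (level_mixedIncl y).exists_finset
    have hL : ∀ F, F₁ ⊆ F →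
        extPair.Level (1 ⊗ₜ 1) F (m + 1) (n + 1) (mixedIncl (m + 1) (n + 1) y) :=
      fun F hF => h₁.mono (Finset.coe_subset.2 hF)
    have hν : ∀ F, F₁ ⊆ F → extPair.numψ F (mixedIncl (m + 1) (n + 1) y)
        = ((n + 1 : ℕ) : ℂ) • mixedIncl (m + 1) (n + 1) y := fun F hF =>
      (hL F hF).numψ (isVacuum_ext F)
    change ExteriorLie.contraction pairing m n y = 0 ↔ _
    refine ⟨fun h c s hs _ => ?_, fun h => ?_⟩
    · by_contra h'
      obtain ⟨F₂, -, h₂⟩ := extPair.exists_finset_notMem_vanish h'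
      let F := F₀ ∪ F₁ ∪ F₂
      have h₃ := h₀ F (Finset.subset_union_left.trans Finset.subset_union_left)
      rw [h, map_zero] at h₃
      refine h₂ (extPair.vanish_anti (Finset.coe_subset.2 Finset.subset_union_right) c s
        ((isInvariant_extTrace.contr_mem_vanish (F := F) (hν F (Finset.subset_union_right.trans
          Finset.subset_union_left)) (by exact_mod_cast hs.ne')).1 ?_))
      rw [← h₃]
      exact Submodule.zero_mem _
    · let F := F₀ ∪ F₁
      have hF : F₁ ⊆ F := Finset.subset_union_right
      refine mixedIncl_injective m n ?_
      rw [map_zero, h₀ F Finset.subset_union_left]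
      refine ((hL F hF).contr (isVacuum_ext F)).eq_zero (by rw [extTrace_vac]; exact one_ne_zero)
        (isVacuum_ext F) ((isInvariant_extTrace.contr_mem_vanish (hν F hF) ?_).2
          (extPair.vanish_anti (Set.subset_univ _) m n (h m n (Nat.lt_succ_self n) (by omega))))
      exact_mod_cast (Nat.succ_ne_self n)

/-- The kernel of the contraction, as a submodule. -/
def mixedKer (m n : ℕ) : LieSubmodule ℂ slInf (MixedWedge m n) :=
  lieSubmoduleOfMatUnit (ExteriorLie.contractionKer pairing m n) fun a b hab v hv => by
    rw [mem_contractionKer_iff] at hv ⊢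
    intro c s hs hc
    rw [mixedIncl_lie]
    exact isInvariant_extTrace.E_mem_vanish (Set.mem_univ _) (Set.mem_univ _) (hv c s hs hc)

theorem mem_mixedKer {m n : ℕ} {y : MixedWedge m n} :
    y ∈ mixedKer m n ↔ ∀ c, ∀ s < n, m + s = n + c →
      mixedIncl m n y ∈ extPair.vanish extTrace Set.univ c s := mem_contractionKer_iff

theorem eq_zero_of_mixedIncl_mem_vanish {m n : ℕ} {y : MixedWedge m n}
    (h : mixedIncl m n y ∈ extPair.vanish extTrace Set.univ m n) : y = 0 := by
  refine mixedIncl_injective m n ?_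
  rw [map_zero]
  exact (level_mixedIncl y).eq_zero_of_mem_vanish_univ (by rw [extTrace_vac]; exact one_ne_zero)
    (isVacuum_ext _) h

/-- A product of creation operators with m + n distinct indices over the vacuum is a non-zero
element. -/
theorem mixedKer_ne_bot (m n : ℕ) : mixedKer m n ≠ ⊥ := by
  obtain ⟨x, hx⟩ := extPair.exists_isProd (1 ⊗ₜ 1) Set.infinite_univ m n
  obtain ⟨y, rfl⟩ := exists_mixedIncl_eq (hx.level .vac subset_rfl)
  intro h
  have hy : y ∈ mixedKer m n := mem_mixedKer.2 fun c s hs _ =>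
    hx.mem_vanish_of_lt isInvariant_extTrace (isVacuum_ext _) hs _
  rw [h, LieSubmodule.mem_bot] at hy
  have := (hx.mem_vanish_iff isInvariant_extTrace (isVacuum_ext _)).1 (by
    rw [hy, map_zero]
    exact Submodule.zero_mem _)
  rw [extTrace_vac] at this
  exact one_ne_zero this

/-- A non-zero vector of level (m, n) has a non-zero complete contraction, so the core statement
applies with r = n, and its conditions are those defining the kernel. -/
theorem mixedKer_le {m n : ℕ} {N : LieSubmodule ℂ slInf (MixedWedge m n)} (hN : N ≠ ⊥) :
    mixedKer m n ≤ N := by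
  obtain ⟨v, hv, hv0⟩ : ∃ v ∈ N, v ≠ 0 := by
    simpa [LieSubmodule.eq_bot_iff] using hN
  intro y hy
  have hN : extPair.StableOn Set.univ (N.toSubmodule.map (mixedIncl m n)) := by
    rintro a - b - hab _ ⟨x, hx, rfl⟩
    exact ⟨_, N.lie_mem hx, mixedIncl_lie m n hab x⟩
  obtain ⟨x, hx, hxy⟩ := hN.mem_of_notMem_vanish isInvariant_extTrace
    (by rw [extTrace_vac]; exact one_ne_zero) (isVacuum_ext _) Set.infinite_univ
    (level_mixedIncl v) ⟨v, hv, rfl⟩ (fun h => hv0 (eq_zero_of_mixedIncl_mem_vanish h))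
    (add_comm m n) (level_mixedIncl y) (mem_mixedKer.1 hy)
  rwa [← mixedIncl_injective m n hxy]

theorem S_eq_mixedKer (m n : ℕ) : S m n = mixedKer m n :=
  socle_eq_of_forall_le (mixedKer_ne_bot m n) fun _ => mixedKer_le

theorem isIrreducible_S (m n : ℕ) : LieModule.IsIrreducible ℂ slInf (S m n) := by
  rw [S_eq_mixedKer]
  exact isIrreducible_of_forall_le (mixedKer_ne_bot m n) fun _ => mixedKer_le

/-! ### The layers of the filtration -/

/-- The product of the two pairs of fermions. -/
abbrev layerPair := fockPair.prod extPair

/-- The vacuum relating the two pairs of fermions. -/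
def layerVac (M : ℕ) :
    FockAll ⊗[ℂ] FockAll × ExteriorAlgebra ℂ VDual ⊗[ℂ] ExteriorAlgebra ℂ V :=
  (fockVac M, fockTrace (fockVac M) • (1 ⊗ₜ 1))

/-- The difference of the invariant functionals. -/
def layerTrace :
    FockAll ⊗[ℂ] FockAll × ExteriorAlgebra ℂ VDual ⊗[ℂ] ExteriorAlgebra ℂ V →ₗ[ℂ] ℂ :=
  fockTrace ∘ₗ LinearMap.fst ℂ _ _ - extTrace ∘ₗ LinearMap.snd ℂ _ _

theorem isInvariant_layerTrace : layerPair.IsInvariant layerTrace :=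
  isInvariant_fockTrace.prod isInvariant_extTrace

/-- The second vacuum is rescaled for this purpose: products of the same creation operators over the
two vacua then have equal contractions. -/
theorem layerTrace_layerVac (M : ℕ) : layerTrace (layerVac M) = 0 := by
  change fockTrace (fockVac M) - extTrace (fockTrace (fockVac M) • (1 ⊗ₜ 1)) = 0
  rw [map_smul, extTrace_vac, smul_eq_mul, mul_one, sub_self]

theorem isVacuum_layerVac (M : ℕ) : layerPair.IsVacuum (Set.Ici (-M : ℤ)) (layerVac M) :=
  (isVacuum_fockVac M).prod ((isVacuum_ext _).smul _)

theorem mem_vanish_inl {c s : ℕ} {v : FockAll ⊗[ℂ] FockAll} :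
    (v, 0) ∈ layerPair.vanish layerTrace Set.univ c s ↔
      v ∈ fockPair.vanish fockTrace Set.univ c s :=
  FermionPair.mem_vanish_map_iff (A := fockPair) (A' := layerPair) (LinearMap.inl ℂ _ _)
    (fun a _ => Prod.ext rfl (map_zero (extPair.ψd a)).symm)
    (fun a _ => Prod.ext rfl (map_zero (extPair.χd a)).symm) fun v => by
      change fockTrace v - extTrace 0 = 0 ↔ _
      rw [map_zero, sub_zero]

theorem mem_vanish_inr {c s : ℕ} {v : ExteriorAlgebra ℂ VDual ⊗[ℂ] ExteriorAlgebra ℂ V} :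
    (0, v) ∈ layerPair.vanish layerTrace Set.univ c s ↔
      v ∈ extPair.vanish extTrace Set.univ c s :=
  FermionPair.mem_vanish_map_iff (A := extPair) (A' := layerPair) (LinearMap.inr ℂ _ _)
    (fun a _ => Prod.ext (map_zero (fockPair.ψd a)).symm rfl)
    (fun a _ => Prod.ext (map_zero (fockPair.χd a)).symm rfl) fun v => by
      change fockTrace 0 - extTrace v = 0 ↔ _
      rw [map_zero, zero_sub, neg_eq_zero]

/-- The relation between the `j`-th term of the filtration and the kernel of a contraction. -/
def layerRel (t : ℤ) (j m n : ℕ) : Submodule ℂ (FockProd t × MixedWedge m n) :=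
  (fockFilt t j).toSubmodule.prod (mixedKer m n).toSubmodule ⊓
    (layerPair.vanish layerTrace Set.univ m n).comap ((fockProdIncl t).prodMap (mixedIncl m n))

variable {t : ℤ} {j m n : ℕ}

theorem mem_layerRel {v : FockProd t} {y : MixedWedge m n} :
    (v, y) ∈ layerRel t j m n ↔ (v ∈ fockFilt t j ∧ y ∈ mixedKer m n) ∧
      (fockProdIncl t v, mixedIncl m n y) ∈ layerPair.vanish layerTrace Set.univ m n := Iff.rfl

theorem matUnit_mem_layerRel {a b : ℤ} (hab : a ≠ b) {v : FockProd t} {y : MixedWedge m n}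
    (h : (v, y) ∈ layerRel t j m n) :
    (⁅(matUnit hab : slInf), v⁆, ⁅(matUnit hab : slInf), y⁆) ∈ layerRel t j m n := by
  obtain ⟨⟨h₁, h₂⟩, h₃⟩ := mem_layerRel.1 h
  have h₄ := (fockFilt t j).lie_mem (x := matUnit hab) h₁
  have h₅ := (mixedKer m n).lie_mem (x := matUnit hab) h₂
  have h₆ := fockProdIncl_lie t hab v
  have h₇ := mixedIncl_lie m n hab y
  have h₈ := isInvariant_layerTrace.E_mem_vanish (Set.mem_univ a) (Set.mem_univ b) h₃
  refine mem_layerRel.2 ⟨⟨h₄, h₅⟩, ?_⟩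
  rw [h₆, h₇]
  exact h₈

theorem lie_mem_layerRel (x : slInf) {v : FockProd t × MixedWedge m n}
    (hv : v ∈ layerRel t j m n) : (⁅x, v.1⁆, ⁅x, v.2⁆) ∈ layerRel t j m n := by
  have h := lie_rel_of_matUnit (M := FockProd t) (M' := MixedWedge m n) (layerRel t j m n) (by
    rintro a b hab ⟨v, y⟩ hv
    exact matUnit_mem_layerRel hab hv) x hv
  exact h

theorem eq_zero_of_zero_mem_layerRel {y : MixedWedge m n} (h : (0, y) ∈ layerRel t j m n) :
    y = 0 := by
  have := (mem_layerRel.1 h).2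
  rw [map_zero, mem_vanish_inr] at this
  exact eq_zero_of_mixedIncl_mem_vanish this

/-- The type of contraction compared in the relation is the one that separates consecutive terms of
the filtration. -/
theorem mem_layerRel_zero {v : FockProd t} :
    (v, 0) ∈ layerRel t j (j + t.toNat) (j + (-t).toNat) ↔ v ∈ fockFilt t (j + 1) := by
  rw [mem_layerRel, map_zero, mem_vanish_inl, mem_fockFilt_succ]
  exact ⟨fun h => ⟨h.1.1, h.2⟩, fun h => ⟨⟨h.1, LieSubmodule.zero_mem _⟩, h.2⟩⟩

-- The same product of creation operators with distinct indices is applied to both vacua. Its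
-- contractions with fewer ψd's vanish, and those of the critical type agree on the two sides but
-- are not all zero on the Fock side.
variable (t j) in
theorem exists_mem_layerRel :
    ∃ v y, (v, y) ∈ layerRel t j (j + t.toNat) (j + (-t).toNat) ∧ v ∉ fockFilt t (j + 1) := by
  -- The depth is the number of ψ's, so that the second factor ends up with charge 0 and the first
  -- with charge t.
  obtain ⟨x, hx⟩ := layerPair.exists_isProd (layerVac (j + (-t).toNat))
    (Set.Ici_infinite (-(j + (-t).toNat : ℕ) : ℤ)) (j + t.toNat) (j + (-t).toNat)
  have hvac := isVacuum_layerVac (j + (-t).toNat)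
  have h₁ := hx.fst
  have h₂ := hx.snd
  have hvac₁ := isVacuum_fockVac (j + (-t).toNat)
  obtain ⟨v, hv⟩ := exists_fockProdIncl_eq (t := t) (by omega)
    (h₁.level .vac subset_rfl)
  obtain ⟨y, hy⟩ := exists_mixedIncl_eq (h₂.level (FermionPair.Level.vac.smul _) subset_rfl)
  refine ⟨v, y, mem_layerRel.2 ⟨⟨mem_fockFilt.2 fun i hi => ?_, mem_mixedKer.2 fun c s hs _ => ?_⟩,
    ?_⟩, fun h => ?_⟩
  · rw [mem_layerKer, hv]
    exact h₁.mem_vanish_of_lt isInvariant_fockTrace hvac₁ (by omega) _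
  · erw [hy]
    exact h₂.mem_vanish_of_lt isInvariant_extTrace ((isVacuum_ext _).smul _) hs _
  · erw [hv, hy]
    exact (hx.mem_vanish_iff isInvariant_layerTrace hvac).2 (layerTrace_layerVac _)
  · have h₃ := (mem_fockFilt_succ.1 h).2
    rw [mem_layerKer, hv] at h₃
    exact fockTrace_fockVac _ ((h₁.mem_vanish_iff isInvariant_fockTrace hvac₁).1 h₃)

theorem strictAnti_fockFilt (t : ℤ) : StrictAnti (fockFilt t) :=
  strictAnti_nat_of_succ_lt fun j =>
    lt_of_le_of_ne (fockFilt_antitone t (Nat.le_succ j)) fun h => by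
    obtain ⟨v, y, hvy, hv⟩ := exists_mem_layerRel t j
    rw [h] at hv
    exact hv (mem_layerRel.1 hvy).1.1

/-- The first projection of the relation is a submodule not contained in the next term, hence
contains the whole j-th term by `fockFilt_le`. -/
theorem exists_right_mem_layerRel {v : FockProd t} (hv : v ∈ fockFilt t j) :
    ∃ y, (v, y) ∈ layerRel t j (j + t.toNat) (j + (-t).toNat) := by
  let N : LieSubmodule ℂ slInf (FockProd t) :=
    { toSubmodule := (layerRel t j (j + t.toNat) (j + (-t).toNat)).map (LinearMap.fst ℂ _ _)
      lie_mem := by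
        rintro x _ ⟨z, hz, rfl⟩
        exact ⟨_, lie_mem_layerRel x hz, rfl⟩ }
  obtain ⟨v₀, y₀, h₀, hv₀⟩ := exists_mem_layerRel t j
  obtain ⟨⟨_, y⟩, h, rfl⟩ := fockFilt_le (N := N) (fun h => hv₀ (h ⟨_, h₀, rfl⟩)) hv
  exact ⟨y, h⟩

/-- The second projection is a non-zero submodule, so it contains the smallest one. -/
theorem exists_left_mem_layerRel {y : MixedWedge (j + t.toNat) (j + (-t).toNat)}
    (hy : y ∈ mixedKer (j + t.toNat) (j + (-t).toNat)) :
    ∃ v ∈ fockFilt t j, (v, y) ∈ layerRel t j (j + t.toNat) (j + (-t).toNat) := by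
  let N : LieSubmodule ℂ slInf (MixedWedge (j + t.toNat) (j + (-t).toNat)) :=
    { toSubmodule := (layerRel t j (j + t.toNat) (j + (-t).toNat)).map (LinearMap.snd ℂ _ _)
      lie_mem := by
        rintro x _ ⟨z, hz, rfl⟩
        exact ⟨_, lie_mem_layerRel x hz, rfl⟩ }
  obtain ⟨v₀, y₀, h₀, hv₀⟩ := exists_mem_layerRel t j
  have hN : N ≠ ⊥ := fun h => hv₀ (by
    have : y₀ ∈ N := ⟨_, h₀, rfl⟩
    rw [h, LieSubmodule.mem_bot] at this
    rw [this] at h₀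
    exact mem_layerRel_zero.1 h₀)
  obtain ⟨⟨v, _⟩, h, rfl⟩ := mixedKer_le hN hy
  exact ⟨v, (mem_layerRel.1 h).1.1, h⟩

theorem nonempty_layerEquiv (t : ℤ) (j : ℕ) :
    Nonempty ((fockFilt t j ⧸ (fockFilt t (j + 1)).comap (fockFilt t j).incl) ≃ₗ⁅ℂ, slInf⁆
      S (j + t.toNat) (j + (-t).toNat)) := by
  rw [S_eq_mixedKer]
  exact nonempty_lieModuleEquiv_of_rel (layerRel t j (j + t.toNat) (j + (-t).toNat))
    (fun x _ => lie_mem_layerRel x) (fun _ hv => (mem_layerRel.1 hv).1.2)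
    (fun _ => exists_right_mem_layerRel) (fun _ => exists_left_mem_layerRel)
    (fun _ _ => mem_layerRel_zero)
    fun _ => eq_zero_of_zero_mem_layerRel

end FockTensor

end

theorem theorem1 (t : ℤ) :
    (∀ m n : ℕ, (m : ℤ) - n = t →
      LieModule.IsIrreducible ℂ FockTensor.slInf (FockTensor.S m n) ∧
      (FockTensor.S m n).toSubmodule = ExteriorLie.contractionKer FockTensor.pairing m n) ∧
    ∃ R : ℕ → LieSubmodule ℂ FockTensor.slInf
        (TensorProduct ℂ (FockTensor.FockDual t) FockTensor.Fock),
      R 0 = ⊤ ∧ StrictAnti R ∧ ⨅ k, R k = ⊥ ∧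
      (0 ≤ t → ∀ k : ℕ, Nonempty
        ((R k ⧸ (R (k + 1)).comap (R k).incl) ≃ₗ⁅ℂ, FockTensor.slInf⁆
          FockTensor.S (k + t.toNat) k)) ∧
      (t < 0 → ∀ k : ℕ, Nonempty
        ((R k ⧸ (R (k + 1)).comap (R k).incl) ≃ₗ⁅ℂ, FockTensor.slInf⁆
          FockTensor.S k (k + (-t).toNat))) ∧
      ∀ N : LieSubmodule ℂ FockTensor.slInf
          (TensorProduct ℂ (FockTensor.FockDual t) FockTensor.Fock),
        N ≠ ⊥ → ∃ r, N = R r := by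
  refine ⟨fun m n _ => ⟨FockTensor.isIrreducible_S m n, by rw [FockTensor.S_eq_mixedKer]; rfl⟩,
    FockTensor.fockFilt t, FockTensor.fockFilt_zero t, FockTensor.strictAnti_fockFilt t,
    FockTensor.iInf_fockFilt t, fun ht k => ?_, fun ht k => ?_,
    fun _ => FockTensor.exists_eq_fockFilt⟩
  -- The layers were computed uniformly in t with positive and negative parts; the sign of t makes
  -- one of them zero.
  · have := FockTensor.nonempty_layerEquiv t k
    rwa [show (-t).toNat = 0 by omega, add_zero] at this
  · have := FockTensor.nonempty_layerEquiv t k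
    rwa [show t.toNat = 0 by omega, add_zero] at this
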